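/- Let $n\ge 2$, $N\in\mathbb N$, $m>0$, $T>0$, let $\Omega\subset\mathbb R^n$ be a bounded open set, and put $\Omega_T:=\Omega\times(0,T)$. For $w\in\mathbb R^N$ write $\boldsymbol{w}^m:=|w|^{m-1}w$ (with $\boldsymbol 0^m=0$). Let $\mathbf A\colon\Omega_T\times\mathbb R^N\times\mathbb R^{Nn}\to\mathbb R^{Nn}$ be a Carathéodory function (measurable in $(x,t)$ for all $(u,\xi)$, continuous in $(u,\xi)$ for a.e. $(x,t)$), and suppose that there are constants $0<\nu\le L<\infty$ and $\mu>0$ such that for a.e. $(x,t)\in\Omega_T$ and all $(u,\xi),(v,\eta)\in\mathbb R^N\times\mathbb R^{Nn}$ $$\mathbf A(x,t,u,\xi)\cdot\xi\ge\nu|\xi|^2,\qquad |\mathbf A(x,t,u,\xi)|\le L|\xi|,\qquad \big(\mathbf A(x,t,u,\xi)-\mathbf A(x,t,v,\eta)\big)\cdot(\xi-\eta)\ge\mu|\xi-\eta|^2 .$$ A measurable map $u\colon\Omega_T\to\mathbb R^N$ is a *local weak solution* of $$\partial_t u-\operatorname{div}\mathbf A(x,t,u,D\boldsymbol u^m)=0\quad\text{in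 }\Omega_T \tag{1}$$ if $\boldsymbol u^m\in L^2_{\rm loc}(0,T;W^{1,2}_{\rm loc}(\Omega,\mathbb R^N))$, in case $m<1$ additionally $u\in L^{m+1}_{\rm loc}(\Omega_T,\mathbb R^N)$, and $$\iint_{\Omega_T}\big[-u\cdot\partial_t\varphi+\mathbf A(x,t,u,D\boldsymbol u^m)\cdot D\varphi\big]\,dx\,dt=0\qquad\text{for all }\varphi\in C_0^\infty(\Omega_T,\mathbb R^N).$$ Let $g\in C([0,T];L^{m+1}(\Omega,\mathbb R^N))$ with $\boldsymbol g^m\in L^2(0,T;W^{1,2}(\Omega,\mathbb R^N))$. A measurable map $u\colon\Omega_T\to\mathbb R^N$ is a *weak solution of the Cauchy–Dirichlet problem* for (1) with initial and boundary values $g$ if $\boldsymbol u^m\in L^2(0,T;W^{1,2}(\Omega,\mathbb R^N))$, in case $m<1$ additionally $u\in L^{m+1}(\Omega_T,\mathbb R^N)$, if $u$ is a local weak solution of (1), if $(\boldsymbol u^m-\boldsymbol g^m)(\cdot,t)\in W^{1,2}_0(\Omega,\mathbb R^N)$ for a.e. $t\in(0,T)$, and if $$\frac1h\int_0^h\!\int_\Omega\Big[\tfrac1{m+1}\big(|u|^{m+1}-|g|^{m+1}\big)-\boldsymbol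 g^m\cdot(u-g)\Big]dx\,dt\longrightarrow0\qquad\text{as }h\downarrow0 .$$ Then the following hold. 1. Every local weak solution of (1) has a representative (i.e. agrees a.e. in $\Omega_T$ with a map) in $C((0,T);L^{m+1}_{\rm loc}(\Omega,\mathbb R^N))$. 2. If, in addition, $\boldsymbol g^m$ has a weak time derivative $\partial_t\boldsymbol g^m\in L^{\frac{m+1}{m}}(\Omega_T,\mathbb R^N)$, then every weak solution of the Cauchy–Dirichlet problem with initial and boundary values $g$ has a representative in $C([0,T];L^{m+1}(\Omega,\mathbb R^N))$. -/

import Mathlib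

open MeasureTheory Filter Topology Set
open scoped ContDiff ENNReal

namespace PorousMedium

noncomputable section

/-- Euclidean space `ℝⁿ` (space variable for `n`, values for `N`). -/
abbrev Vec (n : ℕ) : Type := EuclideanSpace ℝ (Fin n)

/-- `ℝ^{Nn}` with its Euclidean structure; the entry `(j, i)` of a gradient is `∂ᵢ` of the
`j`-th component. -/
abbrev Mat (N n : ℕ) : Type := EuclideanSpace ℝ (Fin N × Fin n)

/-- The space-time cylinder `Ω_T = Ω × (0,T)`. -/
def cyl {n : ℕ} (Ω : Set (Vec n)) (T : ℝ) : Set (Vec n × ℝ) := Ω ×ˢ Ioo 0 T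

/-- The signed power `|u|^{m-1} u`. -/
def spow {N : ℕ} (m : ℝ) (u : Vec N) : Vec N := ‖u‖ ^ (m - 1) • u

/-- `φ ∈ C_0^∞(U)`. -/
def IsTest {X Y : Type*} [NormedAddCommGroup X] [NormedSpace ℝ X]
    [NormedAddCommGroup Y] [NormedSpace ℝ Y] (U : Set X) (φ : X → Y) : Prop :=
  ContDiff ℝ ∞ φ ∧ HasCompactSupport φ ∧ tsupport φ ⊆ U

/-- `f ∈ L^p_loc(U)`. -/
def MemLpLoc {X Y : Type*} [TopologicalSpace X] [MeasureSpace X] [NormedAddCommGroup Y]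
    (p : ℝ≥0∞) (U : Set X) (f : X → Y) : Prop :=
  ∀ K : Set X, IsCompact K → K ⊆ U → MemLp f p (volume.restrict K)

/-- Classical gradient of a map `ℝⁿ → ℝᴺ`. -/
def grad {N n : ℕ} (φ : Vec n → Vec N) (x : Vec n) : Mat N n :=
  WithLp.toLp 2 fun p => fderiv ℝ φ x (EuclideanSpace.single p.2 1) p.1

/-- Classical spatial gradient `D = D_x` of a map on space-time. -/
def spaceGrad {N n : ℕ} (φ : Vec n × ℝ → Vec N) (z : Vec n × ℝ) : Mat N n :=
  WithLp.toLp 2 fun p => fderiv ℝ φ z (EuclideanSpace.single p.2 1, 0) p.1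

/-- Classical time derivative of a map on space-time. -/
def timeDeriv {n : ℕ} {Y : Type*} [NormedAddCommGroup Y] [NormedSpace ℝ Y]
    (φ : Vec n × ℝ → Y) (z : Vec n × ℝ) : Y :=
  fderiv ℝ φ z (0, 1)

/-- `G` is the weak gradient of `f` in `Ω`. -/
def IsWeakGrad {N n : ℕ} (Ω : Set (Vec n)) (f : Vec n → Vec N) (G : Vec n → Mat N n) : Prop :=
  LocallyIntegrableOn f Ω ∧ LocallyIntegrableOn G Ω ∧
    ∀ φ : Vec n → ℝ, IsTest Ω φ → ∀ (j : Fin N) (i : Fin n),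
      ∫ x in Ω, f x j * fderiv ℝ φ x (EuclideanSpace.single i 1) = -∫ x in Ω, G x (j, i) * φ x

/-- `G(·,t)` is the weak gradient of `w(·,t)` in `Ω` for a.e. `t ∈ (0,T)`. -/
def IsSpatialWeakGrad {N n : ℕ} (Ω : Set (Vec n)) (T : ℝ)
    (w : Vec n × ℝ → Vec N) (G : Vec n × ℝ → Mat N n) : Prop :=
  ∀ᵐ t ∂(volume.restrict (Ioo (0 : ℝ) T)), IsWeakGrad Ω (fun x => w (x, t)) (fun x => G (x, t))

/-- `w ∈ L²_loc(0,T; W^{1,2}_loc(Ω))` with spatial gradient `G`. (Every compact subset of `Ω_T`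
lies in a product of compact subsets of `Ω` and `(0,T)`.) -/
def MemL2W12Loc {N n : ℕ} (Ω : Set (Vec n)) (T : ℝ)
    (w : Vec n × ℝ → Vec N) (G : Vec n × ℝ → Mat N n) : Prop :=
  MemLpLoc 2 (cyl Ω T) w ∧ MemLpLoc 2 (cyl Ω T) G ∧ IsSpatialWeakGrad Ω T w G

/-- `w ∈ L²(0,T; W^{1,2}(Ω))`. -/
def MemL2W12 {N n : ℕ} (Ω : Set (Vec n)) (T : ℝ) (w : Vec n × ℝ → Vec N) : Prop :=
  MemLp w 2 (volume.restrict (cyl Ω T)) ∧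
    ∃ G : Vec n × ℝ → Mat N n,
      MemLp G 2 (volume.restrict (cyl Ω T)) ∧ IsSpatialWeakGrad Ω T w G

/-- `f ∈ W_0^{1,2}(Ω)`: `f` is a limit of functions in `C_0^∞(Ω)` in the norm of `W^{1,2}(Ω)`
(the limit `G` of the gradients is then the weak gradient of `f`). -/
def MemW120 {N n : ℕ} (Ω : Set (Vec n)) (f : Vec n → Vec N) : Prop :=
  MemLp f 2 (volume.restrict Ω) ∧
    ∃ G : Vec n → Mat N n, MemLp G 2 (volume.restrict Ω) ∧
      ∃ φ : ℕ → Vec n → Vec N, (∀ k, IsTest Ω (φ k)) ∧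
        Tendsto (fun k => eLpNorm (fun x => φ k x - f x) 2 (volume.restrict Ω)) atTop (𝓝 0) ∧
        Tendsto (fun k => eLpNorm (fun x => grad (φ k) x - G x) 2 (volume.restrict Ω))
          atTop (𝓝 0)

/-- `w` has a weak time derivative in `L^p(Ω_T)`. -/
def HasWeakTimeDerivLp {N n : ℕ} (p : ℝ≥0∞) (Ω : Set (Vec n)) (T : ℝ)
    (w : Vec n × ℝ → Vec N) : Prop :=
  ∃ w' : Vec n × ℝ → Vec N, MemLp w' p (volume.restrict (cyl Ω T)) ∧
    ∀ φ : Vec n × ℝ → ℝ, IsTest (cyl Ω T) φ →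
      ∫ z in cyl Ω T, timeDeriv φ z • w z = -∫ z in cyl Ω T, φ z • w' z

/-- `v ∈ C(I; L^p(K))`, for an everywhere defined function `v`. -/
def ContInLp {N n : ℕ} (p : ℝ≥0∞) (K : Set (Vec n)) (I : Set ℝ) (v : Vec n × ℝ → Vec N) : Prop :=
  (∀ t ∈ I, MemLp (fun x => v (x, t)) p (volume.restrict K)) ∧
    ∀ t₀ ∈ I, Tendsto (fun t => eLpNorm (fun x => v (x, t) - v (x, t₀)) p (volume.restrict K))
      (𝓝[I] t₀) (𝓝 0)

/-- `u` has a representative in `C([0,T]; L^p(Ω))`. -/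
def HasContRep {N n : ℕ} (p : ℝ≥0∞) (Ω : Set (Vec n)) (T : ℝ) (u : Vec n × ℝ → Vec N) : Prop :=
  ∃ v : Vec n × ℝ → Vec N, v =ᵐ[volume.restrict (cyl Ω T)] u ∧ ContInLp p Ω (Icc 0 T) v

/-- `u` has a representative in `C((0,T); L^p_loc(Ω))`. -/
def HasContRepLoc {N n : ℕ} (p : ℝ≥0∞) (Ω : Set (Vec n)) (T : ℝ) (u : Vec n × ℝ → Vec N) : Prop :=
  ∃ v : Vec n × ℝ → Vec N, v =ᵐ[volume.restrict (cyl Ω T)] u ∧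
    ∀ K : Set (Vec n), IsCompact K → K ⊆ Ω → ContInLp p K (Ioo 0 T) v

/-- The assumptions on the vector field `A(x,t,u,ξ)`: Carathéodory function on
`Ω_T × ℝᴺ × ℝ^{Nn}` with ellipticity, growth and monotonicity. -/
structure IsAdmissible {N n : ℕ} (Ω : Set (Vec n)) (T ν L μ : ℝ)
    (A : Vec n × ℝ → Vec N → Mat N n → Mat N n) : Prop where
  measurable : ∀ (u : Vec N) (ξ : Mat N n),
    AEStronglyMeasurable (fun z => A z u ξ) (volume.restrict (cyl Ω T))
  continuous : ∀ᵐ z ∂(volume.restrict (cyl Ω T)),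
    Continuous fun q : Vec N × Mat N n => A z q.1 q.2
  elliptic : ∀ᵐ z ∂(volume.restrict (cyl Ω T)), ∀ (u : Vec N) (ξ : Mat N n),
    ν * ‖ξ‖ ^ 2 ≤ inner ℝ (A z u ξ) ξ
  growth : ∀ᵐ z ∂(volume.restrict (cyl Ω T)), ∀ (u : Vec N) (ξ : Mat N n),
    ‖A z u ξ‖ ≤ L * ‖ξ‖
  monotone : ∀ᵐ z ∂(volume.restrict (cyl Ω T)), ∀ (u v : Vec N) (ξ η : Mat N n),
    μ * ‖ξ - η‖ ^ 2 ≤ inner ℝ (A z u ξ - A z v η) (ξ - η)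

/-- `u` is a (local) weak solution of `∂_t u - div A(x,t,u,D(|u|^{m-1}u)) = 0` in `Ω_T`.
The spatial gradient `G` of `|u|^{m-1}u` is unique up to null sets. -/
def IsWeakSolution {N n : ℕ} (m : ℝ) (Ω : Set (Vec n)) (T : ℝ)
    (A : Vec n × ℝ → Vec N → Mat N n → Mat N n) (u : Vec n × ℝ → Vec N) : Prop :=
  AEStronglyMeasurable u (volume.restrict (cyl Ω T)) ∧
  (m < 1 → MemLpLoc (ENNReal.ofReal (m + 1)) (cyl Ω T) u) ∧
  ∃ G : Vec n × ℝ → Mat N n,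
    MemL2W12Loc Ω T (fun z => spow m (u z)) G ∧
    ∀ φ : Vec n × ℝ → Vec N, IsTest (cyl Ω T) φ →
      ∫ z in cyl Ω T,
        (-inner ℝ (u z) (timeDeriv φ z) + inner ℝ (A z (u z) (G z)) (spaceGrad φ z)) = 0

/-- `I(u,g) = (|u|^{m+1} - |g|^{m+1})/(m+1) - |g|^{m-1}g · (u-g)`. -/
def bdryTerm {N : ℕ} (m : ℝ) (u g : Vec N) : ℝ :=
  1 / (m + 1) * (‖u‖ ^ (m + 1) - ‖g‖ ^ (m + 1)) - inner ℝ (spow m g) (u - g)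

/-- The class of initial and boundary data:
`g ∈ C([0,T]; L^{m+1}(Ω))` with `|g|^{m-1}g ∈ L²(0,T; W^{1,2}(Ω))`. -/
def IsDatum {N n : ℕ} (m : ℝ) (Ω : Set (Vec n)) (T : ℝ) (g : Vec n × ℝ → Vec N) : Prop :=
  AEStronglyMeasurable g (volume.restrict (cyl Ω T)) ∧
  HasContRep (ENNReal.ofReal (m + 1)) Ω T g ∧
  MemL2W12 Ω T fun z => spow m (g z)

/-- `u` is a weak solution of the Cauchy–Dirichlet problem with initial and boundary values `g`. -/
structure IsGlobalWeakSolution {N n : ℕ} (m : ℝ) (Ω : Set (Vec n)) (T : ℝ)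
    (A : Vec n × ℝ → Vec N → Mat N n → Mat N n) (g u : Vec n × ℝ → Vec N) : Prop where
  datum : IsDatum m Ω T g
  weakSolution : IsWeakSolution m Ω T A u
  memL2W12 : MemL2W12 Ω T fun z => spow m (u z)
  memLp : m < 1 → MemLp u (ENNReal.ofReal (m + 1)) (volume.restrict (cyl Ω T))
  lateral : ∀ᵐ t ∂(volume.restrict (Ioo (0 : ℝ) T)),
    MemW120 Ω fun x => spow m (u (x, t)) - spow m (g (x, t))
  initial : Tendsto
    (fun h : ℝ => 1 / h * ∫ t in Ioo 0 h, ∫ x in Ω, bdryTerm m (u (x, t)) (g (x, t)))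
    (𝓝[>] 0) (𝓝 0)

end

end PorousMedium

/-! `bdryTerm` is the Bregman distance I(u,g) of the convex function |·|^{m+1}/(m+1): it is
nonnegative and vanishes only for u = g. Put f(t) = ∫ I(u(t),g(t)). The identity
`bdryTerm_four_point`, applied to u(t), g(t), u(s), g(s), bounds ∫ I(u(t),u(s)) by f(t) - f(s) plus
two pairings: u(s)^m - g(s)^m with u(s) - u(t), and g(s)^m - g(t)^m with g(s) - u(t). Only slices at
almost every time enter; the solution itself is never regularised in time.

The first pairing is controlled by the equation. Increments of u in time are integrals of the flux
(`exists_good_times_of_weak`), and the fixed function u(s)^m - g(s)^m can be reached by spatial test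
functions (`abs_pairing_le`). This gives a bound |∫_s^t a| + |t-s| b(s) with a, b integrable, b(s)
being a Dirichlet energy at time s. The second pairing is controlled by the time derivative of g^m
and Young's inequality (`abs_integral_inner_time_difference_le`).

The difficulty is that b is merely integrable, so b(s) has no uniform bound. Two devices remove it.
Since I ≥ 0, the estimate bounds increments of f in both directions by integrals and endpoint
values, and averaging over translated pairs of times turns the endpoint values into integrals
(`exists_sub_le_integral`). Hence f has small oscillation near every time, the endpoints included.
Next, near a given time t₀ a reference time s is chosen at which b does not exceed its mean over a
short interval, so that |t-s| b(s) is small too. Then ∫ I(u(t),u(s)) is small for almost every t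
near t₀, and the convexity estimate `exists_norm_sub_rpow_le_bdryTerm` makes u(t) - u(s) small in
L^{m+1}. This is `exists_cauchy_of_energy`. A curve that is Cauchy at every time along a set of full
measure has a continuous representative (`exists_contInLp_extension`).

For local solutions the scheme runs with g = 0 and the weighted measure η dx, η a spatial cutoff.
For the Cauchy–Dirichlet problem it runs with Lebesgue measure on Ω and the given g; the zero
lateral boundary values of u^m - g^m replace the cutoff. -/

open scoped Convolution

namespace PorousMedium

/-! ### Pointwise algebra and convexity of the signed power -/

section Pointwise

variable {N : ℕ} {m : ℝ}

theorem norm_spow (hm : 0 < m) (u : Vec N) : ‖spow m u‖ = ‖u‖ ^ m := by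
  rw [spow, norm_smul, Real.norm_of_nonneg (Real.rpow_nonneg (norm_nonneg _) _)]
  rcases eq_or_ne u 0 with rfl | hu
  · simp [Real.zero_rpow hm.ne']
  · have h := norm_pos_iff.2 hu
    rw [← Real.rpow_add_one h.ne']
    ring_nf

theorem inner_spow_self (hm : 0 < m) (u : Vec N) : inner ℝ (spow m u) u = ‖u‖ ^ (m + 1) := by
  rw [spow, real_inner_smul_left, real_inner_self_eq_norm_sq]
  rcases eq_or_ne u 0 with rfl | hu
  · simp [Real.zero_rpow (by linarith : m + 1 ≠ 0)]
  · have h := norm_pos_iff.2 hu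
    rw [← Real.rpow_natCast, ← Real.rpow_add h]
    norm_num
    ring_nf

theorem spow_zero : spow m (0 : Vec N) = 0 := by simp [spow]

theorem continuous_spow (hm : 0 < m) : Continuous (spow m : Vec N → Vec N) := by
  rw [continuous_iff_continuousAt]
  intro u
  rcases eq_or_ne u 0 with rfl | hu
  · rw [ContinuousAt, spow_zero, tendsto_zero_iff_norm_tendsto_zero]
    simp_rw [norm_spow hm]
    have : ContinuousAt (fun v : Vec N => ‖v‖ ^ m) 0 :=
      continuousAt_id.norm.rpow_const (Or.inr hm.le)
    simpa [ContinuousAt, Real.zero_rpow hm.ne'] using this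
  · exact (continuousAt_id.norm.rpow_const (Or.inl (norm_ne_zero_iff.2 hu))).smul continuousAt_id

theorem spow_smul {c : ℝ} (hc : 0 < c) (u : Vec N) : spow m (c • u) = c ^ m • spow m u := by
  rw [spow, spow, norm_smul, Real.norm_of_nonneg hc.le,
    Real.mul_rpow hc.le (norm_nonneg _), smul_smul, smul_smul, Real.rpow_sub_one hc.ne']
  congr 1
  field_simp

theorem bdryTerm_eq (hm : 0 < m) (u g : Vec N) :
    bdryTerm m u g = 1 / (m + 1) * ‖u‖ ^ (m + 1) + m / (m + 1) * ‖g‖ ^ (m + 1)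
      - inner ℝ (spow m g) u := by
  rw [bdryTerm, inner_sub_right, inner_spow_self hm]
  field_simp
  ring

theorem bdryTerm_smul (hm : 0 < m) {c : ℝ} (hc : 0 < c) (u g : Vec N) :
    bdryTerm m (c • u) (c • g) = c ^ (m + 1) * bdryTerm m u g := by
  rw [bdryTerm_eq hm, bdryTerm_eq hm, spow_smul hc, real_inner_smul_left, real_inner_smul_right,
    norm_smul, norm_smul, Real.norm_of_nonneg hc.le, Real.mul_rpow hc.le (norm_nonneg _),
    Real.mul_rpow hc.le (norm_nonneg _), Real.rpow_add_one hc.ne']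
  ring

theorem bdryTerm_self (u : Vec N) : bdryTerm m u u = 0 := by simp [bdryTerm]

theorem continuous_bdryTerm (hm : 0 < m) :
    Continuous fun q : Vec N × Vec N => bdryTerm m q.1 q.2 := by
  unfold bdryTerm
  have h1 : Continuous fun q : Vec N × Vec N => ‖q.1‖ ^ (m + 1) :=
    continuous_fst.norm.rpow_const fun _ => Or.inr (by linarith)
  have h2 : Continuous fun q : Vec N × Vec N => ‖q.2‖ ^ (m + 1) :=
    continuous_snd.norm.rpow_const fun _ => Or.inr (by linarith)
  exact (continuous_const.mul (h1.sub h2)).sub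
    (((continuous_spow hm).comp continuous_snd).inner (continuous_fst.sub continuous_snd))

/-- Strict convexity of |·|^{m+1}. If |u| = |g|, strictness comes from the equality case of
Cauchy–Schwarz, read off from |u - g|² > 0. If the norms differ, Cauchy–Schwarz reduces to one
variable, where Bernoulli's inequality is strict. -/
theorem bdryTerm_pos (hm : 0 < m) {u g : Vec N} (h : u ≠ g) : 0 < bdryTerm m u g := by
  rcases eq_or_ne g 0 with rfl | hg
  · have hu : 0 < ‖u‖ := norm_pos_iff.2 h
    simp only [bdryTerm, spow_zero, norm_zero, inner_zero_left,
      Real.zero_rpow (by linarith : m + 1 ≠ 0)]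
    have := Real.rpow_pos_of_pos hu (m + 1)
    simp only [sub_zero]
    positivity
  · have hg' : 0 < ‖g‖ := norm_pos_iff.2 hg
    have hgm : 0 < ‖g‖ ^ (m - 1) := Real.rpow_pos_of_pos hg' _
    have e1 : ‖g‖ ^ (m + 1) = ‖g‖ ^ (m - 1) * ‖g‖ ^ 2 := by
      rw [← Real.rpow_natCast, ← Real.rpow_add hg']
      norm_num
      ring_nf
    rw [bdryTerm_eq hm, spow, real_inner_smul_left]
    have hcs := real_inner_le_norm g u
    by_cases hn : ‖u‖ = ‖g‖
    · have hpos : 0 < ‖u - g‖ ^ 2 := by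
        have := norm_pos_iff.2 (sub_ne_zero.2 h)
        positivity
      rw [norm_sub_sq_real, hn, real_inner_comm] at hpos
      rw [hn, e1]
      have : 0 < ‖g‖ ^ (m - 1) * (‖g‖ ^ 2 - inner ℝ g u) := by
        apply mul_pos hgm
        linarith
      have e2 : 1 / (m + 1) + m / (m + 1) = 1 := by field_simp; ring
      rw [← add_mul, e2, one_mul]
      linarith
    · set x := ‖u‖ / ‖g‖ with hx
      have hux : ‖u‖ = x * ‖g‖ := by rw [hx]; field_simp
      have hx0 : 0 ≤ x := by positivity
      have hx1 : x - 1 ≠ 0 := by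
        intro h0
        apply hn
        rw [hux, sub_eq_zero.1 h0, one_mul]
      -- Bernoulli for x^{m+1} at x = |u|/|g| is the tangent line at 1, hence (m+1)x < x^{m+1} + m.
      have hb := one_add_mul_self_lt_rpow_one_add (s := x - 1) (by linarith) hx1
        (p := m + 1) (by linarith)
      rw [add_sub_cancel] at hb
      have e3 : ‖u‖ ^ (m + 1) = x ^ (m + 1) * (‖g‖ ^ (m - 1) * ‖g‖ ^ 2) := by
        rw [hux, Real.mul_rpow hx0 hg'.le, e1]
      rw [e3, e1]
      rw [hux] at hcs
      have hP : 0 < ‖g‖ ^ (m - 1) * ‖g‖ ^ 2 := by positivity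
      have h4 : ‖g‖ ^ (m - 1) * inner ℝ g u ≤ x * (‖g‖ ^ (m - 1) * ‖g‖ ^ 2) := by
        calc _ ≤ ‖g‖ ^ (m - 1) * (‖g‖ * (x * ‖g‖)) := by gcongr
          _ = _ := by ring
      have h5 : x < 1 / (m + 1) * x ^ (m + 1) + m / (m + 1) := by
        have : 1 / (m + 1) * x ^ (m + 1) + m / (m + 1) = (x ^ (m + 1) + m) / (m + 1) := by
          field_simp
        rw [this, lt_div_iff₀ (by linarith)]
        linarith
      nlinarith [mul_lt_mul_of_pos_right h5 hP]

theorem bdryTerm_nonneg (hm : 0 < m) (u g : Vec N) : 0 ≤ bdryTerm m u g := by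
  rcases eq_or_ne u g with rfl | h
  · rw [bdryTerm_self]
  · exact (bdryTerm_pos hm h).le

/-- The four-point identity behind all energy estimates. -/
theorem bdryTerm_four_point (hm : 0 < m) (u g v h : Vec N) :
    bdryTerm m u g - bdryTerm m v h + inner ℝ (spow m v - spow m h) (v - u)
      + inner ℝ (spow m h - spow m g) (h - u) = bdryTerm m u v + bdryTerm m h g := by
  simp only [bdryTerm_eq hm, inner_sub_left, inner_sub_right, inner_spow_self hm]
  field_simp
  ring

theorem norm_add_rpow_le (hm : 0 < m) (a b : Vec N) :
    ‖a + b‖ ^ (m + 1) ≤ 2 ^ (m + 1) * (‖a‖ ^ (m + 1) + ‖b‖ ^ (m + 1)) := by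
  have hp : 0 ≤ m + 1 := by linarith
  have ha := Real.rpow_nonneg (norm_nonneg a) (m + 1)
  have hb := Real.rpow_nonneg (norm_nonneg b) (m + 1)
  have key : ∀ x y : ℝ, 0 ≤ x → 0 ≤ y → x ≤ y → (x + y) ^ (m + 1) ≤
      2 ^ (m + 1) * y ^ (m + 1) := by
    intro x y hx hy hxy
    rw [← Real.mul_rpow (by norm_num) hy]
    exact Real.rpow_le_rpow (by linarith) (by linarith) hp
  have h2 : (0 : ℝ) < 2 ^ (m + 1) := by positivity
  calc ‖a + b‖ ^ (m + 1) ≤ (‖a‖ + ‖b‖) ^ (m + 1) :=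
        Real.rpow_le_rpow (norm_nonneg _) (norm_add_le _ _) hp
    _ ≤ _ := by
        rcases le_total ‖a‖ ‖b‖ with h | h
        · exact (key _ _ (norm_nonneg _) (norm_nonneg _) h).trans (by gcongr; linarith)
        · rw [add_comm ‖a‖]
          exact (key _ _ (norm_nonneg _) (norm_nonneg _) h).trans (by gcongr; linarith)

theorem norm_sub_rpow_le (hm : 0 < m) (a b : Vec N) :
    ‖a - b‖ ^ (m + 1) ≤ 2 ^ (m + 1) * (‖a‖ ^ (m + 1) + ‖b‖ ^ (m + 1)) := by
  simpa [sub_eq_add_neg] using norm_add_rpow_le hm a (-b)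

/-- Qualitative uniform convexity of `|·|^{m+1}`. -/
theorem exists_norm_sub_rpow_le_bdryTerm (hm : 0 < m) {δ : ℝ} (hδ : 0 < δ) :
    ∃ C, 0 ≤ C ∧ ∀ a b : Vec N, ‖a - b‖ ^ (m + 1) ≤
      C * bdryTerm m a b + δ * (‖a‖ ^ (m + 1) + ‖b‖ ^ (m + 1)) := by
  have hp : 0 < m + 1 := by linarith
  have c1 : Continuous fun q : Vec N × Vec N => ‖q.1‖ ^ (m + 1) :=
    continuous_fst.norm.rpow_const fun _ => Or.inr hp.le
  have c2 : Continuous fun q : Vec N × Vec N => ‖q.2‖ ^ (m + 1) :=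
    continuous_snd.norm.rpow_const fun _ => Or.inr hp.le
  have c3 : Continuous fun q : Vec N × Vec N => ‖q.1 - q.2‖ ^ (m + 1) :=
    (continuous_fst.sub continuous_snd).norm.rpow_const fun _ => Or.inr hp.le
  -- Both sides are homogeneous of degree m+1, so it suffices to treat the unit sphere. There the
  -- pairs with |a-b|^{m+1} ≥ δ form a compact set off the diagonal, on which `bdryTerm` has a
  -- positive minimum c.
  set Z : Set (Vec N × Vec N) :=
    {q | ‖q.1‖ ^ (m + 1) + ‖q.2‖ ^ (m + 1) = 1 ∧ δ ≤ ‖q.1 - q.2‖ ^ (m + 1)} with hZ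
  have hZc : IsCompact Z := by
    apply Metric.isCompact_of_isClosed_isBounded
    · exact (isClosed_eq (c1.add c2) continuous_const).inter (isClosed_le continuous_const c3)
    · refine (Metric.isBounded_closedBall (x := (0 : Vec N × Vec N)) (r := 1)).subset ?_
      rintro ⟨a, b⟩ ⟨h, -⟩
      simp only at h
      have ha := Real.rpow_nonneg (norm_nonneg a) (m + 1)
      have hb := Real.rpow_nonneg (norm_nonneg b) (m + 1)
      have aux : ∀ x : ℝ, 0 ≤ x → x ^ (m + 1) ≤ 1 → x ≤ 1 := by
        intro x hx h
        by_contra! hc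
        exact absurd h (not_le.2 (Real.one_lt_rpow hc hp))
      rw [mem_closedBall_zero_iff, Prod.norm_def]
      exact max_le (aux _ (norm_nonneg _) (by simp only; linarith))
        (aux _ (norm_nonneg _) (by simp only; linarith))
  have hpos : ∀ q ∈ Z, 0 < bdryTerm m q.1 q.2 := by
    rintro ⟨a, b⟩ ⟨-, h⟩
    apply bdryTerm_pos hm
    rintro hab
    simp only at hab h
    rw [hab, sub_self, norm_zero, Real.zero_rpow hp.ne'] at h
    linarith
  obtain ⟨c, hc, hcZ⟩ : ∃ c, 0 < c ∧ ∀ q ∈ Z, c ≤ bdryTerm m q.1 q.2 := by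
    rcases Z.eq_empty_or_nonempty with h | h
    · exact ⟨1, one_pos, by simp [h]⟩
    · obtain ⟨q, hq, hmin⟩ := hZc.exists_isMinOn h (continuous_bdryTerm hm).continuousOn
      exact ⟨_, hpos q hq, fun q' hq' => hmin hq'⟩
  refine ⟨2 ^ (m + 1) / c, by positivity, fun a b => ?_⟩
  have ha := Real.rpow_nonneg (norm_nonneg a) (m + 1)
  have hb := Real.rpow_nonneg (norm_nonneg b) (m + 1)
  rcases (add_nonneg ha hb).eq_or_lt with h0 | h0
  · have ha0 : ‖a‖ ^ (m + 1) = 0 := by linarith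
    have hb0 : ‖b‖ ^ (m + 1) = 0 := by linarith
    rw [Real.rpow_eq_zero (norm_nonneg _) hp.ne', norm_eq_zero] at ha0 hb0
    subst ha0 hb0
    simp [bdryTerm_self, Real.zero_rpow hp.ne']
  · set R := ‖a‖ ^ (m + 1) + ‖b‖ ^ (m + 1) with hR
    set r := R ^ (-(1 / (m + 1))) with hr
    have hr0 : 0 < r := Real.rpow_pos_of_pos h0 _
    have hrp : r ^ (m + 1) = R⁻¹ := by
      rw [hr, ← Real.rpow_mul h0.le, neg_mul, one_div_mul_cancel hp.ne', Real.rpow_neg_one]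
    have hscale : ∀ v : Vec N, ‖r • v‖ ^ (m + 1) = R⁻¹ * ‖v‖ ^ (m + 1) := by
      intro v
      rw [norm_smul, Real.norm_of_nonneg hr0.le, Real.mul_rpow hr0.le (norm_nonneg _), hrp]
    have hB := bdryTerm_nonneg hm a b
    by_cases hd : δ * R ≤ ‖a - b‖ ^ (m + 1)
    · have hmem : (r • a, r • b) ∈ Z := by
        refine ⟨?_, ?_⟩
        · simp only [hscale]
          rw [← mul_add, ← hR, inv_mul_cancel₀ h0.ne']
        · simp only [← smul_sub, hscale]
          rw [inv_mul_eq_div, le_div_iff₀ h0]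
          exact hd
      have h1 := hcZ _ hmem
      simp only at h1
      rw [bdryTerm_smul hm hr0, hrp, inv_mul_eq_div, le_div_iff₀ h0] at h1
      have h2 := norm_sub_rpow_le hm a b
      rw [← hR] at h2
      have h3 : 2 ^ (m + 1) * R ≤ 2 ^ (m + 1) / c * bdryTerm m a b := by
        rw [div_mul_eq_mul_div, le_div_iff₀ hc]
        have : (0 : ℝ) < 2 ^ (m + 1) := by positivity
        nlinarith
      nlinarith [mul_pos hδ h0]
    · have : 0 ≤ 2 ^ (m + 1) / c * bdryTerm m a b := by positivity
      linarith

/-- Split a = (a - b) + b and estimate a - b by convexity; the choice δ = 1/(2k) leaves half of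
|a|^{m+1} on the right, which is absorbed. -/
theorem exists_norm_rpow_le_bdryTerm (hm : 0 < m) :
    ∃ C, 0 ≤ C ∧ ∀ a b : Vec N, ‖a‖ ^ (m + 1) ≤ C * (bdryTerm m a b + ‖b‖ ^ (m + 1)) := by
  set k : ℝ := 2 ^ (m + 1) with hk
  have hk0 : 0 < k := by positivity
  obtain ⟨C, hC, h⟩ := exists_norm_sub_rpow_le_bdryTerm (N := N) hm
    (δ := 1 / (2 * k)) (by positivity)
  refine ⟨2 * k * C + 1 + 2 * k, by positivity, fun a b => ?_⟩
  have h1 := h a b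
  have h2 := norm_add_rpow_le hm (a - b) b
  rw [sub_add_cancel, ← hk] at h2
  have hB := bdryTerm_nonneg hm a b
  have hb := Real.rpow_nonneg (norm_nonneg b) (m + 1)
  have h3 : k * ‖a - b‖ ^ (m + 1) ≤
      k * C * bdryTerm m a b + 1 / 2 * (‖a‖ ^ (m + 1) + ‖b‖ ^ (m + 1)) := by
    calc _ ≤ k * (C * bdryTerm m a b + 1 / (2 * k) * (‖a‖ ^ (m + 1) + ‖b‖ ^ (m + 1))) := by
          gcongr
      _ = _ := by field_simp
  have h4 : 0 ≤ k * C * ‖b‖ ^ (m + 1) := by positivity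
  have h5 : 0 ≤ k * bdryTerm m a b := by positivity
  nlinarith

theorem norm_spow_mul_norm_le (hm : 0 < m) (a b : Vec N) :
    ‖spow m a‖ * ‖b‖ ≤ ‖a‖ ^ (m + 1) + ‖b‖ ^ (m + 1) := by
  have ha := norm_nonneg a
  have hb := norm_nonneg b
  have h1 := Real.rpow_nonneg ha (m + 1)
  have h2 := Real.rpow_nonneg hb (m + 1)
  rw [norm_spow hm]
  calc ‖a‖ ^ m * ‖b‖ ≤ (max ‖a‖ ‖b‖) ^ m * max ‖a‖ ‖b‖ := by gcongr <;> simp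
    _ = (max ‖a‖ ‖b‖) ^ (m + 1) := by
        rw [Real.rpow_add_one' (by positivity) (by linarith)]
    _ ≤ _ := by rcases max_choice ‖a‖ ‖b‖ with h | h <;> rw [h] <;> linarith

theorem abs_inner_spow_le (hm : 0 < m) (a b : Vec N) :
    |inner ℝ (spow m a) b| ≤ ‖a‖ ^ (m + 1) + ‖b‖ ^ (m + 1) :=
  (abs_real_inner_le_norm _ _).trans (norm_spow_mul_norm_le hm a b)

end Pointwise

/-! ### Increments bounded by endpoint values of an integrable function -/

section OneDim

/-- Apply the hypothesis to the pairs (r, r+k) and integrate over r from s to t. The left side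
telescopes to the difference of the integrals of f over [t,t+k] and [s,s+k]. After division by k,
letting k tend to 0 recovers f(t) - f(s) at Lebesgue points, while the right side tends to twice the
integral of c. -/
theorem sub_le_integral_of_locallyIntegrable {f c : ℝ → ℝ} {α β : ℝ} {S : Set ℝ}
    (hf : LocallyIntegrable f) (hc : LocallyIntegrable c)
    (hS : ∀ᵐ t, t ∈ Ioo α β → t ∈ S)
    (h : ∀ s ∈ S, ∀ t ∈ S, s < t → f t - f s ≤ (t - s) * (c s + c t)) :
    ∃ S' ⊆ S ∩ Ioo α β, (∀ᵐ t, t ∈ Ioo α β → t ∈ S') ∧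
      ∀ s ∈ S', ∀ t ∈ S', s < t → f t - f s ≤ 2 * ∫ x in s..t, c x := by
  have fi : ∀ x y, IntervalIntegrable f volume x y := fun x y =>
    (hf.integrableOn_isCompact isCompact_uIcc).intervalIntegrable
  have ci : ∀ x y, IntervalIntegrable c volume x y := fun x y =>
    (hc.integrableOn_isCompact isCompact_uIcc).intervalIntegrable
  -- The good times are those at which f is the derivative of its primitive.
  refine ⟨{t | t ∈ S ∩ Ioo α β ∧ HasDerivAt (fun x => ∫ r in α..x, f r) (f t) t},
    fun t ht => ht.1, ?_, ?_⟩
  · filter_upwards [hS, _root_.LocallyIntegrable.ae_hasDerivAt_integral hf] with t h1 h2 h3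
    exact ⟨⟨h1 h3, h3⟩, h2 α⟩
  rintro s ⟨⟨hsS, hsI⟩, hs⟩ t ⟨⟨htS, htI⟩, ht⟩ hst
  have h1 := ht.tendsto_slope_zero_right.sub hs.tendsto_slope_zero_right
  have hQ : Continuous fun x => ∫ r in α..x, c r :=
    intervalIntegral.continuous_primitive ci α
  have h2 : Tendsto (fun k : ℝ => (∫ r in s..t, c r) +
      ((∫ r in α..(t + k), c r) - ∫ r in α..(s + k), c r)) (𝓝[>] 0)
      (𝓝 ((∫ r in s..t, c r) + ((∫ r in α..(t + 0), c r) - ∫ r in α..(s + 0), c r))) := by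
    apply Tendsto.mono_left _ nhdsWithin_le_nhds
    apply Continuous.tendsto
      (f := fun k : ℝ => (∫ r in s..t, c r) +
        ((∫ r in α..(t + k), c r) - ∫ r in α..(s + k), c r))
    exact continuous_const.add ((hQ.comp (continuous_const.add continuous_id)).sub
      (hQ.comp (continuous_const.add continuous_id)))
  have h3 : (∫ r in s..t, c r) + ((∫ r in α..(t + 0), c r) - ∫ r in α..(s + 0), c r)
      = 2 * ∫ r in s..t, c r := by
    rw [add_zero, add_zero, intervalIntegral.integral_interval_sub_left (ci _ _) (ci _ _)]
    ring
  rw [h3] at h2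
  refine le_of_tendsto_of_tendsto h1 h2 ?_
  have hev : ∀ᶠ k : ℝ in 𝓝[>] 0, k < β - t :=
    nhdsWithin_le_nhds (eventually_lt_nhds (sub_pos.2 htI.2))
  filter_upwards [self_mem_nhdsWithin, hev] with k hk hkt
  simp only [mem_Ioi] at hk
  rw [← smul_sub, smul_eq_mul, inv_mul_le_iff₀ hk]
  have e1 : (∫ r in α..(t + k), f r) - (∫ r in α..t, f r) -
      ((∫ r in α..(s + k), f r) - ∫ r in α..s, f r) = ∫ r in s..t, (f (r + k) - f r) := by
    rw [intervalIntegral.integral_sub _ (fi _ _),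
      intervalIntegral.integral_comp_add_right (fun x => f x) k,
      ← intervalIntegral.integral_interval_sub_left (fi α (t + k)) (fi α (s + k)),
      ← intervalIntegral.integral_interval_sub_left (fi α t) (fi α s)]
    · ring
    · simpa using (fi (s + k) (t + k)).comp_add_right k
  have e2 : k * ((∫ r in s..t, c r) +
      ((∫ r in α..(t + k), c r) - ∫ r in α..(s + k), c r)) =
      ∫ r in s..t, k * (c r + c (r + k)) := by
    rw [intervalIntegral.integral_const_mul, intervalIntegral.integral_add (ci _ _),
      intervalIntegral.integral_comp_add_right (fun x => c x) k,
      ← intervalIntegral.integral_interval_sub_left (ci α (t + k)) (ci α (s + k))]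
    simpa using (ci (s + k) (t + k)).comp_add_right k
  rw [e1, e2]
  have i1 : IntervalIntegrable (fun r => f (r + k)) volume s t := by
    simpa using (fi (s + k) (t + k)).comp_add_right k
  have i2 : IntervalIntegrable (fun r => c (r + k)) volume s t := by
    simpa using (ci (s + k) (t + k)).comp_add_right k
  apply intervalIntegral.integral_mono_ae_restrict hst.le (i1.sub (fi _ _))
    (((ci _ _).add i2).const_mul k)
  have hS' : ∀ᵐ r, r + k ∈ Ioo α β → r + k ∈ S :=
    (measurePreserving_add_right volume k).quasiMeasurePreserving.ae hS
  rw [EventuallyLE, ae_restrict_iff' measurableSet_Icc]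
  filter_upwards [hS, hS'] with r hr1 hr2 hr
  have := h r (hr1 ⟨hsI.1.trans_le hr.1, hr.2.trans_lt htI.2⟩) (r + k)
    (hr2 ⟨by linarith [hr.1, hsI.1], by linarith [hr.2]⟩) (by linarith)
  simpa using this

/-- If increments of `f` are controlled by integrals and by endpoint values of an integrable
function, they are controlled by integrals alone. -/
theorem exists_sub_le_integral {f a c : ℝ → ℝ} {α β : ℝ} {S : Set ℝ}
    (hf : IntegrableOn f (Ioo α β)) (ha : IntegrableOn a (Ioo α β))
    (hc : IntegrableOn c (Ioo α β))
    (hS : ∀ᵐ t, t ∈ Ioo α β → t ∈ S)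
    (h : ∀ s ∈ S, ∀ t ∈ S, s < t →
      f t - f s ≤ (∫ x in s..t, a x) + (t - s) * (c s + c t)) :
    ∃ S' ⊆ S ∩ Ioo α β, (∀ᵐ t, t ∈ Ioo α β → t ∈ S') ∧
      ∀ s ∈ S', ∀ t ∈ S', s < t → f t - f s ≤ ∫ x in s..t, (a x + 2 * c x) := by
  set I := Ioo α β with hI
  have li : ∀ {φ : ℝ → ℝ}, IntegrableOn φ I → LocallyIntegrable (I.indicator φ) := fun hφ =>
    ((integrable_indicator_iff measurableSet_Ioo).2 hφ).locallyIntegrable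
  have eqI : ∀ (φ : ℝ → ℝ) {s t : ℝ}, s ∈ I → t ∈ I →
      ∫ x in s..t, I.indicator φ x = ∫ x in s..t, φ x := by
    intro φ s t hs ht
    apply intervalIntegral.integral_congr
    intro x hx
    exact indicator_of_mem (ordConnected_Ioo.uIcc_subset hs ht hx) _
  have aii : ∀ x y, IntervalIntegrable (I.indicator a) volume x y := fun x y =>
    ((li ha).integrableOn_isCompact isCompact_uIcc).intervalIntegrable
  -- The integral of a is additive in the endpoints, so subtracting this primitive from f reduces to
  -- the case a = 0.
  set P : ℝ → ℝ := fun x => ∫ r in α..x, I.indicator a r with hP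
  have hPc : Continuous P :=
    intervalIntegral.continuous_primitive aii α
  have hPi : LocallyIntegrable P := hPc.locallyIntegrable
  have hPsub : ∀ s ∈ I, ∀ t ∈ I, P t - P s = ∫ x in s..t, a x := by
    intro s hs t ht
    rw [hP, ← eqI a hs ht]
    exact intervalIntegral.integral_interval_sub_left (aii _ _) (aii _ _)
  obtain ⟨S', hS'S, hS'full, hS'⟩ := sub_le_integral_of_locallyIntegrable (S := S ∩ I)
    ((li hf).sub hPi) (li hc) (α := α) (β := β) (by
      filter_upwards [hS] with t ht h
      exact ⟨ht h, h⟩) (by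
      rintro s ⟨hs, hsI⟩ t ⟨ht, htI⟩ hst
      have := h s hs t ht hst
      simp only [Pi.sub_apply, indicator_of_mem hsI, indicator_of_mem htI]
      have := hPsub s hsI t htI
      linarith)
  refine ⟨S', hS'S.trans fun x hx => ⟨hx.1.1, hx.2⟩, hS'full, fun s hs t ht hst => ?_⟩
  have hsI : s ∈ I := (hS'S hs).2
  have htI : t ∈ I := (hS'S ht).2
  have h1 := hS' s hs t ht hst
  simp only [Pi.sub_apply, indicator_of_mem hsI, indicator_of_mem htI] at h1
  rw [eqI c hsI htI] at h1
  have h2 := hPsub s hsI t htI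
  have sub : uIcc s t ⊆ I := ordConnected_Ioo.uIcc_subset hsI htI
  rw [intervalIntegral.integral_add, intervalIntegral.integral_const_mul]
  · linarith
  · exact (ha.mono_set sub).intervalIntegrable
  · exact ((hc.mono_set sub).intervalIntegrable).const_mul 2

end OneDim

/-! ### From an energy inequality to the Cauchy property in time -/

section Energy

theorem memLp_ofReal_iff {X E : Type*} [MeasurableSpace X] {κ : Measure X} [NormedAddCommGroup E]
    {p : ℝ} (hp : 0 < p) {f : X → E} (hf : AEStronglyMeasurable f κ) :
    MemLp f (ENNReal.ofReal p) κ ↔ Integrable (fun x => ‖f x‖ ^ p) κ := by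
  have := integrable_norm_rpow_iff hf (p := ENNReal.ofReal p) (by simpa using hp) (by simp)
  rw [ENNReal.toReal_ofReal hp.le] at this
  exact this.symm

variable {N : ℕ} {m : ℝ} {X : Type*} [MeasurableSpace X] {κ : Measure X}

theorem MemLp.integrable_rpow {f : X → Vec N} (hm : 0 < m)
    (hf : MemLp f (ENNReal.ofReal (m + 1)) κ) : Integrable (fun x => ‖f x‖ ^ (m + 1)) κ :=
  (memLp_ofReal_iff (by linarith) hf.1).1 hf

theorem integrable_inner_spow (hm : 0 < m) {f g : X → Vec N}
    (hf : MemLp f (ENNReal.ofReal (m + 1)) κ) (hg : MemLp g (ENNReal.ofReal (m + 1)) κ) :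
    Integrable (fun x => inner ℝ (spow m (f x)) (g x)) κ := by
  refine Integrable.mono' ((MemLp.integrable_rpow hm hf).add (MemLp.integrable_rpow hm hg))
    (((continuous_spow hm).comp_aestronglyMeasurable hf.1).inner hg.1) ?_
  filter_upwards with x
  exact abs_inner_spow_le hm _ _

theorem integrable_bdryTerm (hm : 0 < m) {f g : X → Vec N}
    (hf : MemLp f (ENNReal.ofReal (m + 1)) κ) (hg : MemLp g (ENNReal.ofReal (m + 1)) κ) :
    Integrable (fun x => bdryTerm m (f x) (g x)) κ :=
  (((MemLp.integrable_rpow hm hf).sub (MemLp.integrable_rpow hm hg)).const_mul _).sub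
    (integrable_inner_spow hm hg (hf.sub hg))

theorem integral_bdryTerm_four_point (hm : 0 < m) {u g v h : X → Vec N}
    (hu : MemLp u (ENNReal.ofReal (m + 1)) κ) (hg : MemLp g (ENNReal.ofReal (m + 1)) κ)
    (hv : MemLp v (ENNReal.ofReal (m + 1)) κ) (hh : MemLp h (ENNReal.ofReal (m + 1)) κ) :
    (∫ x, bdryTerm m (u x) (g x) ∂κ) - (∫ x, bdryTerm m (v x) (h x) ∂κ)
      + (∫ x, inner ℝ (spow m (v x) - spow m (h x)) (v x - u x) ∂κ)
      + (∫ x, inner ℝ (spow m (h x) - spow m (g x)) (h x - u x) ∂κ)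
      = (∫ x, bdryTerm m (u x) (v x) ∂κ) + ∫ x, bdryTerm m (h x) (g x) ∂κ := by
  have i0 : Integrable (fun x => bdryTerm m (u x) (g x) - bdryTerm m (v x) (h x)) κ :=
    (integrable_bdryTerm hm hu hg).sub (integrable_bdryTerm hm hv hh)
  have i1 : Integrable (fun x => inner ℝ (spow m (v x) - spow m (h x)) (v x - u x)) κ := by
    simp_rw [inner_sub_left]
    exact (integrable_inner_spow hm hv (hv.sub hu)).sub (integrable_inner_spow hm hh (hv.sub hu))
  have i2 : Integrable (fun x => inner ℝ (spow m (h x) - spow m (g x)) (h x - u x)) κ := by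
    simp_rw [inner_sub_left]
    exact (integrable_inner_spow hm hh (hh.sub hu)).sub (integrable_inner_spow hm hg (hh.sub hu))
  rw [← integral_sub (integrable_bdryTerm hm hu hg) (integrable_bdryTerm hm hv hh),
    ← integral_add i0 i1, ← integral_add (i0.add i1 : Integrable (fun x => _ + _) κ) i2,
    ← integral_add (integrable_bdryTerm hm hu hv) (integrable_bdryTerm hm hh hg)]
  exact integral_congr_ae (Eventually.of_forall fun x => bdryTerm_four_point hm _ _ _ _)

theorem integral_norm_sub_rpow_le (hm : 0 < m) {f g : X → Vec N}
    (hf : MemLp f (ENNReal.ofReal (m + 1)) κ) (hg : MemLp g (ENNReal.ofReal (m + 1)) κ) :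
    ∫ x, ‖f x - g x‖ ^ (m + 1) ∂κ ≤
      2 ^ (m + 1) * ((∫ x, ‖f x‖ ^ (m + 1) ∂κ) + ∫ x, ‖g x‖ ^ (m + 1) ∂κ) := by
  rw [← integral_add (MemLp.integrable_rpow hm hf) (MemLp.integrable_rpow hm hg),
    ← integral_const_mul]
  exact integral_mono (MemLp.integrable_rpow hm (hf.sub hg))
    (((MemLp.integrable_rpow hm hf).add (MemLp.integrable_rpow hm hg)).const_mul _)
    fun x => norm_sub_rpow_le hm _ _

theorem abs_intervalIntegral_le {a b : ℝ → ℝ} {lo hi s t : ℝ} (hb : IntegrableOn b (Ioo lo hi))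
    (h0 : ∀ x, 0 ≤ a x) (hab : ∀ x, a x ≤ b x) (ha : IntegrableOn a (Ioo lo hi))
    (hs : s ∈ Ioo lo hi) (ht : t ∈ Ioo lo hi) :
    |∫ x in s..t, a x| ≤ ∫ x in Ioo lo hi, b x := by
  have hsub : uIoc s t ⊆ Ioo lo hi :=
    uIoc_subset_uIcc.trans (ordConnected_Ioo.uIcc_subset hs ht)
  calc |∫ x in s..t, a x| ≤ ∫ x in uIoc s t, ‖a x‖ := by
        simpa using intervalIntegral.norm_integral_le_integral_norm_uIoc (f := a) (a := s) (b := t)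
    _ = ∫ x in uIoc s t, a x := by simp_rw [Real.norm_of_nonneg (h0 _)]
    _ ≤ ∫ x in Ioo lo hi, a x :=
        setIntegral_mono_set ha (Eventually.of_forall h0) hsub.eventuallyLE
    _ ≤ _ := setIntegral_mono ha hb hab

theorem exists_setIntegral_Ioo_lt {b : ℝ → ℝ} {α β t₀ : ℝ} (hb : IntegrableOn b (Ioo α β))
    (h₀ : t₀ ∈ Icc α β) {ε : ℝ} (hε : 0 < ε) :
    ∃ δ > 0, ∀ δ' ∈ Ioc 0 δ,
      |∫ x in Ioo (max α (t₀ - δ')) (min β (t₀ + δ')), b x| < ε := by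
  have hli : Integrable ((Ioo α β).indicator b) := (integrable_indicator_iff measurableSet_Ioo).2 hb
  have ii : ∀ x y, IntervalIntegrable ((Ioo α β).indicator b) volume x y :=
    fun x y => hli.intervalIntegrable
  have hPc : Continuous fun x => ∫ r in α..x, (Ioo α β).indicator b r :=
    intervalIntegral.continuous_primitive ii α
  obtain ⟨δ, hδ, h⟩ := Metric.continuousAt_iff.1 (hPc.continuousAt (x := t₀)) (ε / 2) (half_pos hε)
  refine ⟨δ / 2, half_pos hδ, fun δ' hδ' => ?_⟩
  set lo := max α (t₀ - δ')
  set hi := min β (t₀ + δ')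
  have h1 := hδ'.1
  have h2 := hδ'.2
  have hlo1 : lo ≤ t₀ := max_le h₀.1 (by linarith)
  have hlo2 : t₀ - δ' ≤ lo := le_max_right _ _
  have hhi1 : t₀ ≤ hi := le_min h₀.2 (by linarith)
  have hhi2 : hi ≤ t₀ + δ' := min_le_right _ _
  have e : ∫ x in Ioo lo hi, b x = ∫ x in lo..hi, (Ioo α β).indicator b x := by
    rw [intervalIntegral.integral_of_le (hlo1.trans hhi1), integral_Ioc_eq_integral_Ioo]
    apply setIntegral_congr_fun measurableSet_Ioo
    intro x hx
    have hx' : x ∈ Ioo α β :=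
      ⟨(le_max_left _ _).trans_lt hx.1, hx.2.trans_le (min_le_left _ _)⟩
    exact (indicator_of_mem hx' _).symm
  rw [e, ← intervalIntegral.integral_interval_sub_left (ii α hi) (ii α lo)]
  have a1 := h (x := hi) (by rw [Real.dist_eq, abs_lt]; constructor <;> linarith)
  have a2 := h (x := lo) (by rw [Real.dist_eq, abs_lt]; constructor <;> linarith)
  rw [Real.dist_eq, abs_lt] at a1 a2
  rw [abs_lt]
  constructor <;> linarith [a1.1, a1.2, a2.1, a2.2]

/-- An integrable function does not exceed its mean on a set of positive measure, which therefore
meets S. This supplies the reference time at which the Dirichlet energy is under control. -/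
theorem exists_mem_mul_le_setIntegral {b : ℝ → ℝ} {lo hi : ℝ} {S : Set ℝ} (h : lo < hi)
    (hb : IntegrableOn b (Ioo lo hi)) (hS : ∀ᵐ t, t ∈ Ioo lo hi → t ∈ S) :
    ∃ s ∈ S ∩ Ioo lo hi, (hi - lo) * b s ≤ ∫ x in Ioo lo hi, b x := by
  have hv : volume (Ioo lo hi) = ENNReal.ofReal (hi - lo) := Real.volume_Ioo
  have hpos := measure_le_setAverage_pos (μ := volume) (s := Ioo lo hi) (f := b)
    (by rw [hv]; simpa using h) (by rw [hv]; simp) hb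
  have hne : ∃ s, s ∈ {x | x ∈ Ioo lo hi ∧ b x ≤ ⨍ a in Ioo lo hi, b a} ∧
      (s ∈ Ioo lo hi → s ∈ S) := by
    by_contra! hc
    refine hpos.ne' (measure_mono_null (t := {t | ¬ (t ∈ Ioo lo hi → t ∈ S)}) ?_ (ae_iff.1 hS))
    intro x hx
    have := hc x hx
    simp only [mem_ofPred_eq]
    tauto
  obtain ⟨s, ⟨hs, hbs⟩, hs2⟩ := hne
  refine ⟨s, ⟨hs2 hs, hs⟩, ?_⟩
  have hl : 0 < hi - lo := sub_pos.2 h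
  rw [setAverage_eq, measureReal_def, hv, ENNReal.toReal_ofReal hl.le, smul_eq_mul,
    inv_mul_eq_div, le_div_iff₀ hl] at hbs
  linarith

/-- Abstract time continuity: a curve `u` in `L^{m+1}` satisfying an energy inequality relative
to a curve `g` is Cauchy at every time of the closed interval, along a set of full measure. -/
theorem exists_cauchy_of_energy (hm : 0 < m) {α β : ℝ} (hαβ : α < β) {u g : ℝ → X → Vec N}
    {S : Set ℝ} {a b : ℝ → ℝ} {M : ℝ} (hS : ∀ᵐ t, t ∈ Ioo α β → t ∈ S)
    (hu : ∀ t ∈ S, MemLp (u t) (ENNReal.ofReal (m + 1)) κ)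
    (hg : ∀ t ∈ S, MemLp (g t) (ENNReal.ofReal (m + 1)) κ)
    (ha0 : ∀ t, 0 ≤ a t) (hb0 : ∀ t, 0 ≤ b t)
    (ha : IntegrableOn a (Ioo α β)) (hb : IntegrableOn b (Ioo α β))
    (hE : IntegrableOn (fun t => ∫ x, ‖u t x‖ ^ (m + 1) ∂κ) (Ioo α β))
    (hB : IntegrableOn (fun t => ∫ x, bdryTerm m (u t x) (g t x) ∂κ) (Ioo α β))
    (hM : ∀ t ∈ S, ∫ x, ‖g t x‖ ^ (m + 1) ∂κ ≤ M)
    (h1 : ∀ s ∈ S, ∀ t ∈ S,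
      |∫ x, inner ℝ (spow m (u s x) - spow m (g s x)) (u s x - u t x) ∂κ| ≤
        |∫ r in s..t, a r| + |t - s| * b s)
    (h2 : ∀ s ∈ S, ∀ t ∈ S, ∀ f : X → Vec N, MemLp f (ENNReal.ofReal (m + 1)) κ →
      |∫ x, inner ℝ (spow m (g s x) - spow m (g t x)) (f x) ∂κ| ≤
        |∫ r in s..t, a r| + |t - s| * ∫ x, ‖f x‖ ^ (m + 1) ∂κ) :
    ∃ S' ⊆ S ∩ Ioo α β, (∀ᵐ t, t ∈ Ioo α β → t ∈ S') ∧
      ∀ t₀ ∈ Icc α β, ∀ ε > 0, ∃ δ > 0, ∀ t ∈ S', ∀ t' ∈ S', |t - t₀| < δ → |t' - t₀| < δ →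
        ∫ x, ‖u t x - u t' x‖ ^ (m + 1) ∂κ ≤ ε := by
  set E : ℝ → ℝ := fun t => ∫ x, ‖u t x‖ ^ (m + 1) ∂κ with hEdef
  set f : ℝ → ℝ := fun t => ∫ x, bdryTerm m (u t x) (g t x) ∂κ with hfdef
  have hE0 : ∀ t, 0 ≤ E t := fun t => integral_nonneg fun x => Real.rpow_nonneg (norm_nonneg _) _
  have hM' : ∀ t ∈ S, 0 ≤ M := fun t ht =>
    (integral_nonneg fun x => Real.rpow_nonneg (norm_nonneg _) _).trans (hM t ht)
  set K : ℝ := 2 ^ (m + 1) with hK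
  have hK0 : 0 < K := by positivity
  have hnn : ∀ v w : X → Vec N, 0 ≤ ∫ x, bdryTerm m (v x) (w x) ∂κ := fun v w =>
    integral_nonneg fun x => bdryTerm_nonneg hm _ _
  -- the energy inequality, in a form symmetric in the two times
  have main : ∀ s ∈ S, ∀ t ∈ S, ∫ x, bdryTerm m (u t x) (u s x) ∂κ ≤
      f t - f s + 2 * |∫ r in s..t, a r| + |t - s| * (b s + K * (M + E t)) := by
    intro s hs t ht
    have e := integral_bdryTerm_four_point hm (hu t ht) (hg t ht) (hu s hs) (hg s hs)
    have i1 := h1 s hs t ht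
    have i2 := h2 s hs t ht (fun x => g s x - u t x) ((hg s hs).sub (hu t ht))
    have i3 := (integral_norm_sub_rpow_le hm (hg s hs) (hu t ht)).trans
      (mul_le_mul_of_nonneg_left (add_le_add_left (hM s hs) _) hK0.le)
    have i4 := mul_le_mul_of_nonneg_left i3 (abs_nonneg (t - s))
    have i5 := hnn (g s) (g t)
    have i6 := (le_abs_self _).trans i1
    have i7 := (le_abs_self _).trans i2
    rw [mul_add]
    linarith
  set c : ℝ → ℝ := fun t => b t + K * (M + E t) with hc
  have hci : IntegrableOn c (Ioo α β) :=
    hb.add (((integrableOn_const (by simp)).add hE).const_mul K)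
  -- Dropping the nonnegative left side of `main` leaves a bound on f s - f t. As s and t are
  -- arbitrary, it bounds the increments of f in both directions, whence the two applications below,
  -- to f and to -f.
  have incr : ∀ s ∈ S, ∀ t ∈ S, f s - f t ≤ 2 * |∫ r in s..t, a r| + |t - s| * (c s + c t) := by
    intro s hs t ht
    have e := main s hs t ht
    have e1 := hnn (u t) (u s)
    have e2 : |t - s| * (b s + K * (M + E t)) ≤ |t - s| * (c s + c t) := by
      have := hM' s hs
      have := hE0 s
      have := hb0 t
      apply mul_le_mul_of_nonneg_left _ (abs_nonneg _)
      simp only [hc]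
      have : 0 ≤ K * (M + E s) := by positivity
      linarith
    linarith
  obtain ⟨S₁, hS₁S, hS₁, hf₁⟩ := exists_sub_le_integral (f := f) (a := fun x => 2 * a x) hB
    (ha.const_mul 2) hci hS (by
      intro s hs t ht hst
      have := incr t ht s hs
      rw [intervalIntegral.integral_symm, abs_neg, abs_sub_comm, abs_of_pos (sub_pos.2 hst),
        abs_of_nonneg (intervalIntegral.integral_nonneg hst.le fun x _ => ha0 x)] at this
      rw [intervalIntegral.integral_const_mul]
      linarith)
  obtain ⟨S₂, hS₂S, hS₂, hf₂⟩ := exists_sub_le_integral (f := fun x => - f x)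
    (a := fun x => 2 * a x) hB.neg (ha.const_mul 2) hci hS (by
      intro s hs t ht hst
      have := incr s hs t ht
      rw [abs_of_pos (sub_pos.2 hst),
        abs_of_nonneg (intervalIntegral.integral_nonneg hst.le fun x _ => ha0 x)] at this
      rw [intervalIntegral.integral_const_mul]
      linarith)
  refine ⟨S₁ ∩ S₂, fun t ht => hS₁S ht.1, ?_, ?_⟩
  · filter_upwards [hS₁, hS₂] with t h h' ht
    exact ⟨h ht, h' ht⟩
  have hS' : ∀ᵐ t, t ∈ Ioo α β → t ∈ S₁ ∩ S₂ := by
    filter_upwards [hS₁, hS₂] with t h h' ht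
    exact ⟨h ht, h' ht⟩
  obtain ⟨s₀, ⟨hs₀, hs₀I⟩, -⟩ := exists_mem_mul_le_setIntegral hαβ hb hS'
  have hM0 : 0 ≤ M := hM' s₀ (hS₁S hs₀.1).1
  have hc0 : ∀ t, 0 ≤ c t := fun t => by
    have := hE0 t
    have := hb0 t
    simp only [hc]
    positivity
  set d : ℝ → ℝ := fun t => 2 * a t + 2 * c t with hd
  have hd0 : ∀ t, 0 ≤ d t := fun t => by
    have := ha0 t
    have := hc0 t
    simp only [hd]
    positivity
  have hdi : IntegrableOn d (Ioo α β) := (ha.const_mul 2).add (hci.const_mul 2)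
  have hosc : ∀ s ∈ S₁ ∩ S₂, ∀ t ∈ S₁ ∩ S₂, f t - f s ≤ |∫ r in s..t, d r| := by
    intro s hs t ht
    rcases lt_trichotomy s t with h | h | h
    · exact (hf₁ s hs.1 t ht.1 h).trans (le_abs_self _)
    · simp [h]
    · have := hf₂ t ht.2 s hs.2 h
      rw [intervalIntegral.integral_symm, abs_neg]
      refine le_trans ?_ (le_abs_self _)
      simp only [hd]
      linarith
  obtain ⟨C₁, hC₁, hC₁le⟩ := exists_norm_rpow_le_bdryTerm (N := N) hm
  -- The oscillation bound from one fixed time s₀ makes f bounded, and with the bound M on g this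
  -- makes the L^{m+1} norms of u bounded on the good times.
  set E₁ : ℝ := C₁ * (f s₀ + (∫ x in Ioo α β, d x) + M) with hE₁
  have hEle : ∀ t ∈ S₁ ∩ S₂, E t ≤ E₁ := by
    intro t ht
    have htS := (hS₁S ht.1).1
    have k1 : E t ≤ C₁ * (f t + ∫ x, ‖g t x‖ ^ (m + 1) ∂κ) := by
      simp only [hEdef, hfdef]
      rw [← integral_add (integrable_bdryTerm hm (hu t htS) (hg t htS))
        (MemLp.integrable_rpow hm (hg t htS)), ← integral_const_mul]
      exact integral_mono (MemLp.integrable_rpow hm (hu t htS))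
        (((integrable_bdryTerm hm (hu t htS) (hg t htS)).add
          (MemLp.integrable_rpow hm (hg t htS))).const_mul _) fun x => hC₁le _ _
    refine k1.trans (mul_le_mul_of_nonneg_left ?_ hC₁)
    have k2 := hosc s₀ hs₀ t ht
    have k3 := abs_intervalIntegral_le hdi hd0 (fun x => le_rfl) hdi hs₀I (hS₁S ht.1).2
    have k4 := hM t htS
    linarith
  have hE₁0 : 0 ≤ E₁ := (hE0 _).trans (hEle s₀ hs₀)
  set D : ℝ → ℝ := fun t => d t + 2 * a t + b t with hD
  have hDi : IntegrableOn D (Ioo α β) := (hdi.add (ha.const_mul 2)).add hb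
  intro t₀ ht₀ ε hε
  -- The factor 2K is spent in the final comparison of u(t) and u(t') through u(s). Half of ε' goes
  -- to the Bregman term, by the choice of η, and half to the δ-term of the convexity estimate,
  -- whose coefficient is divided by 2E₁ + 1 accordingly.
  set ε' := ε / (2 * K) with hε'
  have hε'0 : 0 < ε' := by positivity
  obtain ⟨C, hC, hCle⟩ := exists_norm_sub_rpow_le_bdryTerm (N := N) hm
    (δ := ε' / 2 / (2 * E₁ + 1)) (by positivity)
  set η := ε' / 2 / (C + 1) with hη
  have hη0 : 0 < η := by positivity
  obtain ⟨δ₁, hδ₁, hδ₁'⟩ := exists_setIntegral_Ioo_lt hDi ht₀ (half_pos hη0)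
  set K₁ : ℝ := K * (M + E₁) with hK₁
  have hK₁0 : 0 ≤ K₁ := by positivity
  set δ := min δ₁ (η / 4 / (K₁ + 1)) with hδdef
  have hδ0 : 0 < δ := lt_min hδ₁ (by positivity)
  have hδK : 2 * δ * K₁ ≤ η / 2 := by
    have : δ ≤ η / 4 / (K₁ + 1) := min_le_right _ _
    rw [le_div_iff₀ (by linarith)] at this
    nlinarith
  set lo := max α (t₀ - δ) with hlo
  set hi := min β (t₀ + δ) with hhi
  have hlohi : lo < hi := by
    apply lt_min <;> apply max_lt <;> linarith [ht₀.1, ht₀.2]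
  have hsub : Ioo lo hi ⊆ Ioo α β := Ioo_subset_Ioo (le_max_left _ _) (min_le_left _ _)
  -- For t in the same short interval |t-s| ≤ hi - lo, so |t-s| b(s) is at most the integral of b
  -- over that interval, however large b(s) itself may be.
  obtain ⟨s, ⟨hsS, hsI⟩, hsb⟩ := exists_mem_mul_le_setIntegral (S := S₁ ∩ S₂) hlohi
    (hb.mono_set hsub) (by
      filter_upwards [hS'] with t ht h
      exact ht (hsub h))
  have hsmall : ∀ t ∈ S₁ ∩ S₂, |t - t₀| < δ → ∫ x, ‖u t x - u s x‖ ^ (m + 1) ∂κ ≤ ε' := by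
    intro t ht htδ
    have htS := (hS₁S ht.1).1
    have hsS' := (hS₁S hsS.1).1
    have htI : t ∈ Ioo lo hi := by
      have := (hS₁S ht.1).2
      rw [abs_lt] at htδ
      exact ⟨max_lt this.1 (by linarith), lt_min this.2 (by linarith)⟩
    have hts : |t - s| ≤ hi - lo := by
      rw [abs_le]
      constructor <;> linarith [htI.1, htI.2, hsI.1, hsI.2]
    have hts2 : |t - s| ≤ 2 * δ := by
      have : hi ≤ t₀ + δ := min_le_right _ _
      have : t₀ - δ ≤ lo := le_max_right _ _
      linarith
    have k1 := main s hsS' t htS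
    have k2 := hosc s hsS t ht
    have k3 := abs_intervalIntegral_le (hdi.mono_set hsub) hd0 (fun x => le_rfl)
      (hdi.mono_set hsub) hsI htI
    have k4 := abs_intervalIntegral_le (ha.mono_set hsub) ha0 (fun x => le_rfl)
      (ha.mono_set hsub) hsI htI
    have k5 : |t - s| * b s ≤ ∫ x in Ioo lo hi, b x :=
      (mul_le_mul_of_nonneg_right hts (hb0 s)).trans hsb
    have k6 : |t - s| * (K * (M + E t)) ≤ 2 * δ * K₁ := by
      have := hEle t ht
      have := hE0 t
      apply mul_le_mul hts2 _ (by positivity) (by positivity)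
      rw [hK₁]
      gcongr
    have k7 : ∫ x in Ioo lo hi, D x = (∫ x in Ioo lo hi, d x) + 2 * (∫ x in Ioo lo hi, a x)
        + ∫ x in Ioo lo hi, b x := by
      simp only [hD]
      have : IntegrableOn (fun x => d x + 2 * a x) (Ioo lo hi) :=
        (hdi.mono_set hsub).add ((ha.mono_set hsub).const_mul 2)
      rw [integral_add this (hb.mono_set hsub),
        integral_add (hdi.mono_set hsub) ((ha.mono_set hsub).const_mul 2),
        integral_const_mul]
    have k8 := (le_abs_self _).trans_lt (hδ₁' δ ⟨hδ0, min_le_left _ _⟩)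
    rw [← hlo, ← hhi] at k8
    have k9 : ∫ x, bdryTerm m (u t x) (u s x) ∂κ ≤ η := by
      rw [mul_add] at k1
      linarith
    calc ∫ x, ‖u t x - u s x‖ ^ (m + 1) ∂κ
        ≤ ∫ x, (C * bdryTerm m (u t x) (u s x) + ε' / 2 / (2 * E₁ + 1) *
          (‖u t x‖ ^ (m + 1) + ‖u s x‖ ^ (m + 1))) ∂κ :=
          integral_mono (MemLp.integrable_rpow hm ((hu t htS).sub (hu s hsS')))
            (((integrable_bdryTerm hm (hu t htS) (hu s hsS')).const_mul _).add
              (((MemLp.integrable_rpow hm (hu t htS)).add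
                (MemLp.integrable_rpow hm (hu s hsS'))).const_mul _))
            fun x => hCle _ _
      _ = C * (∫ x, bdryTerm m (u t x) (u s x) ∂κ) + ε' / 2 / (2 * E₁ + 1) * (E t + E s) := by
          have : Integrable (fun x => ‖u t x‖ ^ (m + 1) + ‖u s x‖ ^ (m + 1)) κ :=
            (MemLp.integrable_rpow hm (hu t htS)).add (MemLp.integrable_rpow hm (hu s hsS'))
          rw [integral_add ((integrable_bdryTerm hm (hu t htS) (hu s hsS')).const_mul _)
              (this.const_mul _), integral_const_mul,
            integral_const_mul, integral_add (MemLp.integrable_rpow hm (hu t htS))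
              (MemLp.integrable_rpow hm (hu s hsS'))]
      _ ≤ C * η + ε' / 2 / (2 * E₁ + 1) * (2 * E₁ + 1) := by
          have := hEle t ht
          have := hEle s hsS
          exact add_le_add (mul_le_mul_of_nonneg_left k9 hC)
            (mul_le_mul_of_nonneg_left (by linarith) (by positivity))
      _ ≤ ε' := by
          have : C * η ≤ ε' / 2 := by
            rw [hη, mul_div_assoc', div_le_iff₀ (by linarith)]
            nlinarith
          rw [div_mul_cancel₀ _ (by linarith)]
          linarith
  refine ⟨δ, hδ0, fun t ht t' ht' htδ htδ' => ?_⟩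
  have htS := (hS₁S ht.1).1
  have htS' := (hS₁S ht'.1).1
  have hsS' := (hS₁S hsS.1).1
  have := integral_norm_sub_rpow_le hm ((hu t htS).sub (hu s hsS')) ((hu t' htS').sub (hu s hsS'))
  simp only [Pi.sub_apply, sub_sub_sub_cancel_right] at this
  calc _ ≤ _ := this
    _ ≤ K * (ε' + ε') := by
        gcongr
        · exact hsmall t ht htδ
        · exact hsmall t' ht' htδ'
    _ = ε := by
        rw [hε']
        field_simp
        norm_num

end Energy

/-! ### Continuous extension of a curve in L^p -/

section Extension

theorem exists_memLp_limit {X E : Type*} [MeasurableSpace X] {κ : Measure X}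
    [NormedAddCommGroup E] [CompleteSpace E] {p : ℝ≥0∞} (hp : 1 ≤ p) {f : ℕ → X → E}
    (hf : ∀ j, MemLp (f j) p κ)
    (hc : ∀ ε : ℝ≥0∞, 0 < ε → ∃ J, ∀ i ≥ J, ∀ j ≥ J, eLpNorm (f i - f j) p κ ≤ ε) :
    ∃ g, MemLp g p κ ∧ Tendsto (fun j => eLpNorm (f j - g) p κ) atTop (𝓝 0) := by
  have : Fact (1 ≤ p) := ⟨hp⟩
  have hcs : CauchySeq fun j => (hf j).toLp (f j) := by
    rw [EMetric.cauchySeq_iff]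
    intro ε hε
    obtain ⟨ε', hε', hlt⟩ := exists_between hε
    obtain ⟨J, hJ⟩ := hc ε' hε'
    refine ⟨J, fun i hi j hj => ?_⟩
    rw [Lp.edist_toLp_toLp]
    exact (hJ i hi j hj).trans_lt hlt
  obtain ⟨G, hG⟩ := cauchySeq_tendsto_of_complete hcs
  refine ⟨G, Lp.memLp G, ?_⟩
  rw [← Lp.tendsto_Lp_iff_tendsto_eLpNorm'' f hf G (Lp.memLp G), Lp.toLp_coeFn]
  exact hG

variable {n N : ℕ}

/-- At a time of I outside S the new slice is the L^p limit of slices along times of S, which exists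
by completeness. Limits on different K k agree almost everywhere on the smaller set, so they glue to
one function. Keeping u unchanged on S preserves the almost everywhere class when S has full
measure. -/
theorem exists_contInLp_extension {p : ℝ≥0∞} (hp : 1 ≤ p) {K : ℕ → Set (Vec n)}
    (hK : Monotone K) (hKm : ∀ k, MeasurableSet (K k)) {I S : Set ℝ} (hdense : I ⊆ closure S)
    {u : Vec n × ℝ → Vec N}
    (hmem : ∀ k, ∀ t ∈ S, MemLp (fun x => u (x, t)) p (volume.restrict (K k)))
    (hcau : ∀ k, ∀ t₀ ∈ I, ∀ ε : ℝ≥0∞, 0 < ε → ∃ δ > 0, ∀ t ∈ S, ∀ t' ∈ S,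
      |t - t₀| < δ → |t' - t₀| < δ →
        eLpNorm (fun x => u (x, t) - u (x, t')) p (volume.restrict (K k)) ≤ ε) :
    ∃ v : Vec n × ℝ → Vec N, (∀ t ∈ S, ∀ x, v (x, t) = u (x, t)) ∧
      ∀ k, ContInLp p (K k) I v := by
  classical
  have hseq : ∀ t ∈ I, ∃ τ : ℕ → ℝ, (∀ j, τ j ∈ S) ∧ Tendsto τ atTop (𝓝 t) := fun t ht =>
    mem_closure_iff_seq_limit.1 (hdense ht)
  choose! τ hτS hτ using hseq
  have hlim : ∀ t ∈ I, ∀ k, ∃ f : Vec n → Vec N, MemLp f p (volume.restrict (K k)) ∧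
      Tendsto (fun j => eLpNorm ((fun x => u (x, τ t j)) - f) p (volume.restrict (K k)))
        atTop (𝓝 0) := by
    intro t ht k
    refine exists_memLp_limit hp (fun j => hmem k _ (hτS t ht j)) fun ε hε => ?_
    obtain ⟨δ, hδ, h⟩ := hcau k t ht ε hε
    obtain ⟨J, hJ⟩ := Metric.tendsto_atTop.1 (hτ t ht) δ hδ
    exact ⟨J, fun i hi j hj => h _ (hτS t ht i) _ (hτS t ht j) (hJ i hi) (hJ j hj)⟩
  choose! f hfmem hf using hlim
  have huniq : ∀ t ∈ I, ∀ i k, i ≤ k → f t i =ᵐ[volume.restrict (K i)] f t k := by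
    intro t ht i k hik
    have h1 := hf t ht i
    have h2 : Tendsto (fun j => eLpNorm ((fun x => u (x, τ t j)) - f t k) p
        (volume.restrict (K i))) atTop (𝓝 0) :=
      tendsto_of_tendsto_of_tendsto_of_le_of_le tendsto_const_nhds (hf t ht k)
        (fun _ => zero_le) fun j => eLpNorm_mono_measure _ (Measure.restrict_mono (hK hik) le_rfl)
    have hmk : MemLp (f t k) p (volume.restrict (K i)) :=
      (hfmem t ht k).mono_measure (Measure.restrict_mono (hK hik) le_rfl)
    have h3 : eLpNorm (f t i - f t k) p (volume.restrict (K i)) = 0 := by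
      refine le_antisymm (le_of_tendsto_of_tendsto' tendsto_const_nhds
        (by simpa using h1.add h2) fun j => ?_) zero_le
      have hm := hmem i _ (hτS t ht j)
      have e : f t i - f t k = ((fun x => u (x, τ t j)) - f t k) -
          ((fun x => u (x, τ t j)) - f t i) := by abel
      rw [e, add_comm]
      exact eLpNorm_sub_le (hm.1.sub hmk.1) (hm.1.sub (hfmem t ht i).1) hp
    rw [eLpNorm_eq_zero_iff ((hfmem t ht i).1.sub hmk.1) (zero_lt_one.trans_le hp).ne'] at h3
    filter_upwards [h3] with x hx
    simpa [sub_eq_zero] using hx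
  -- Gluing uses, at each point, the limit belonging to the first K k that contains it; `Nat.find`
  -- makes this choice definite.
  let v : Vec n × ℝ → Vec N := fun z =>
    if z.2 ∈ S then u z else if h : ∃ k, z.1 ∈ K k then f z.2 (Nat.find h) z.1 else 0
  have hvS : ∀ t ∈ S, ∀ x, v (x, t) = u (x, t) := fun t ht x => by simp [v, ht]
  have hvf : ∀ t ∈ I, t ∉ S → ∀ k, (fun x => v (x, t)) =ᵐ[volume.restrict (K k)] f t k := by
    intro t ht htS k
    have : ∀ᵐ x ∂(volume.restrict (K k)), ∀ i ≤ k, x ∈ K i → f t i x = f t k x := by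
      rw [ae_all_iff]
      intro i
      by_cases hik : i ≤ k
      · have := huniq t ht i k hik
        rw [EventuallyEq, ae_restrict_iff' (hKm i)] at this
        filter_upwards [ae_restrict_of_ae this] with x hx _ using hx
      · exact Eventually.of_forall fun x h => absurd h hik
    filter_upwards [this, ae_restrict_mem (hKm k)] with x hx hxk
    have hex : ∃ k, x ∈ K k := ⟨k, hxk⟩
    simp only [v, htS, if_false, dif_pos hex]
    exact hx _ (Nat.find_min' hex hxk) (Nat.find_spec hex)
  -- every slice of `v` is a limit of slices of `u` at times in `S`
  have happ : ∀ t ∈ I, ∀ k, MemLp (fun x => v (x, t)) p (volume.restrict (K k)) ∧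
      ∀ δ > 0, ∀ ε : ℝ≥0∞, 0 < ε → ∃ s ∈ S, |s - t| < δ ∧
        eLpNorm (fun x => v (x, t) - u (x, s)) p (volume.restrict (K k)) ≤ ε := by
    intro t ht k
    by_cases htS : t ∈ S
    · simp only [hvS t htS]
      exact ⟨hmem k t htS, fun δ hδ ε hε => ⟨t, htS, by simpa using hδ, by simp⟩⟩
    · have hv := hvf t ht htS k
      refine ⟨(memLp_congr_ae hv).2 (hfmem t ht k), fun δ hδ ε hε => ?_⟩
      obtain ⟨j, hj1, hj2⟩ := (((hf t ht k).eventually_lt_const hε).and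
        (Metric.tendsto_nhds.1 (hτ t ht) δ hδ)).exists
      refine ⟨τ t j, hτS t ht j, hj2, ?_⟩
      rw [← eLpNorm_neg]
      refine le_trans (le_of_eq (eLpNorm_congr_ae ?_)) hj1.le
      filter_upwards [hv] with x hx
      simp [← hx]
  refine ⟨v, hvS, fun k => ⟨fun t ht => (happ t ht k).1, fun t₀ ht₀ => ?_⟩⟩
  rw [ENNReal.tendsto_nhds_zero]
  intro ε hε
  have hε3 : 0 < ε / 3 := ENNReal.div_pos hε.ne' (by simp)
  -- Both slices of v are replaced by slices of u at nearby times of S, where the Cauchy property at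
  -- t₀ applies; hence ε/3 and the radius δ/2.
  obtain ⟨δ, hδ, h⟩ := hcau k t₀ ht₀ (ε / 3) hε3
  filter_upwards [self_mem_nhdsWithin,
    nhdsWithin_le_nhds (Metric.ball_mem_nhds t₀ (half_pos hδ))] with t htI htδ
  rw [Metric.mem_ball, Real.dist_eq] at htδ
  obtain ⟨s, hsS, hs, hsv⟩ := (happ t htI k).2 (δ / 2) (half_pos hδ) _ hε3
  obtain ⟨s₀, hs₀S, hs₀, hs₀v⟩ := (happ t₀ ht₀ k).2 δ hδ _ hε3
  have hss := h s hsS s₀ hs₀S (by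
    have : s - t₀ = (s - t) + (t - t₀) := by ring
    rw [this]
    exact (abs_add_le _ _).trans_lt (by linarith)) hs₀
  have m1 := (happ t htI k).1
  have m2 := (happ t₀ ht₀ k).1
  have m3 := hmem k s hsS
  have m4 := hmem k s₀ hs₀S
  have e : (fun x => v (x, t) - v (x, t₀)) = ((fun x => v (x, t) - u (x, s)) +
      (fun x => u (x, s) - u (x, s₀))) - (fun x => v (x, t₀) - u (x, s₀)) := by
    ext1 x
    simp
  rw [e]
  calc _ ≤ _ := eLpNorm_sub_le ((m1.1.sub m3.1).add (m3.1.sub m4.1)) (m2.1.sub m4.1) hp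
    _ ≤ (ε / 3 + ε / 3) + ε / 3 :=
        add_le_add ((eLpNorm_add_le (m1.1.sub m3.1) (m3.1.sub m4.1) hp).trans
          (add_le_add hsv hss)) hs₀v
    _ = ε := ENNReal.add_thirds ε

end Extension

/-! ### Compact exhaustions and Lebesgue points of curves of slices -/

section TimeSlices

theorem exists_compact_exhaustion {X : Type*} [TopologicalSpace X] [LocallyCompactSpace X]
    [SecondCountableTopology X] {Ω : Set X} (hΩ : IsOpen Ω) :
    ∃ K : ℕ → Set X, (∀ k, IsCompact (K k)) ∧ Monotone K ∧ (∀ k, K k ⊆ Ω) ∧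
      ∀ C, IsCompact C → C ⊆ Ω → ∃ k, C ⊆ interior (K k) := by
  have : LocallyCompactSpace Ω := hΩ.locallyCompactSpace
  let E : CompactExhaustion Ω := default
  refine ⟨fun k => Subtype.val '' E k, fun k => (E.isCompact k).image continuous_subtype_val,
    fun i j h => image_mono (E.subset h), fun k => by simp, fun C hC hCΩ => ?_⟩
  have hC' : IsCompact (Subtype.val ⁻¹' C : Set Ω) := by
    rw [Topology.IsEmbedding.subtypeVal.isCompact_iff, image_preimage_eq_inter_range,
      Subtype.range_coe, inter_eq_left.2 hCΩ]
    exact hC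
  obtain ⟨k, hk⟩ := E.exists_superset_of_isCompact hC'
  refine ⟨k + 1, fun x hx => ?_⟩
  have h1 : (⟨x, hCΩ hx⟩ : Ω) ∈ interior (E (k + 1)) := E.subset_interior_succ k (hk hx)
  have h2 : IsOpen (Subtype.val '' interior (E (k + 1))) :=
    hΩ.isOpenMap_subtype_val _ isOpen_interior
  exact interior_maximal (image_mono interior_subset) h2 ⟨_, h1, rfl⟩

/-- A sequence of bump functions shrinking to the origin. -/
noncomputable def shrinkingBump (E : Type*) [NormedAddCommGroup E] (i : ℕ) :
    ContDiffBump (0 : E) :=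
  ⟨1 / (i + 1), 2 / (i + 1), by positivity, by gcongr; norm_num⟩

theorem tendsto_shrinkingBump_rOut (E : Type*) [NormedAddCommGroup E] :
    Tendsto (fun i => (shrinkingBump E i).rOut) atTop (𝓝 0) := by
  have := (tendsto_one_div_add_atTop_nhds_zero_nat (𝕜 := ℝ)).const_mul 2
  simpa [shrinkingBump, div_eq_mul_inv] using this

theorem ae_tendsto_shrinkingBump_convolution {E F : Type*} [NormedAddCommGroup E]
    [NormedSpace ℝ E] [FiniteDimensional ℝ E] [MeasurableSpace E] [BorelSpace E]
    [NormedAddCommGroup F] [NormedSpace ℝ F] [CompleteSpace F]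
    (μ : Measure E) [μ.IsAddHaarMeasure] {g : E → F} (hg : LocallyIntegrable g μ) :
    ∀ᵐ x ∂μ, Tendsto (fun i =>
      ((shrinkingBump E i).normed μ ⋆[ContinuousLinearMap.lsmul ℝ ℝ, μ] g) x) atTop (𝓝 (g x)) :=
  ContDiffBump.ae_convolution_tendsto_right_of_locallyIntegrable (K := 2)
    (tendsto_shrinkingBump_rOut E)
    (Eventually.of_forall fun i => by simp [shrinkingBump, div_eq_mul_inv]) hg

theorem integrable_bump_mul {f : ℝ → ℝ} (hf : Integrable f) (φ : ContDiffBump (0 : ℝ)) (t : ℝ) :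
    Integrable fun x => φ.normed volume x * f (t - x) := by
  have h1 : Integrable fun x => f (t - x) := hf.comp_sub_left t
  obtain ⟨C, hC⟩ :=
    (φ.contDiff_normed (μ := volume) (n := 0)).continuous.bounded_above_of_compact_support
    φ.hasCompactSupport_normed
  exact h1.bdd_mul φ.continuous_normed.aestronglyMeasurable (Eventually.of_forall hC)

/-- Lebesgue points of the curve `t ↦ U(·,t)`, in the weak sense, simultaneously for all
continuous weights. -/
theorem ae_tendsto_convolution_slices {n : ℕ} {U : Vec n × ℝ → ℝ} {K : Set (Vec n)}
    (hK : IsCompact K) {α β : ℝ} (hU : IntegrableOn U (K ×ˢ Ioo α β)) :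
    ∀ᵐ t, t ∈ Ioo α β → IntegrableOn (fun x => U (x, t)) K ∧ ∀ ψ : C(Vec n, ℝ),
      Tendsto (fun i => ((shrinkingBump ℝ i).normed volume ⋆[ContinuousLinearMap.lsmul ℝ ℝ]
        (Ioo α β).indicator fun τ => ∫ x in K, ψ x * U (x, τ)) t) atTop
        (𝓝 (∫ x in K, ψ x * U (x, t))) := by
  have hU' : Integrable U ((volume.restrict K).prod (volume.restrict (Ioo α β))) := by
    rw [Measure.prod_restrict]
    exact hU
  have hψU : ∀ ψ : C(Vec n, ℝ), Integrable (fun z => ψ z.1 * U z)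
      ((volume.restrict K).prod (volume.restrict (Ioo α β))) := by
    intro ψ
    obtain ⟨C, hC⟩ := hK.exists_bound_of_continuousOn ψ.continuous.continuousOn
    refine hU'.bdd_mul (c := C) (ψ.continuous.comp continuous_fst).aestronglyMeasurable ?_
    exact Measure.quasiMeasurePreserving_fst.ae
      ((ae_restrict_mem hK.measurableSet).mono fun x hx => hC x hx)
  set I : C(Vec n, ℝ) → ℝ → ℝ := fun ψ =>
    (Ioo α β).indicator fun τ => ∫ x in K, ψ x * U (x, τ) with hI
  set Nn : ℝ → ℝ := (Ioo α β).indicator fun τ => ∫ x in K, |U (x, τ)| with hNn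
  have hIi : ∀ ψ, Integrable (I ψ) := fun ψ =>
    (integrable_indicator_iff measurableSet_Ioo).2 (hψU ψ).integral_prod_right
  have hNi : Integrable Nn :=
    (integrable_indicator_iff measurableSet_Ioo).2 hU'.abs.integral_prod_right
  have hslice : ∀ᵐ t, t ∈ Ioo α β → IntegrableOn (fun x => U (x, t)) K := by
    rw [← ae_restrict_iff' measurableSet_Ioo]
    exact hU'.prod_left_ae
  have hψslice : ∀ (ψ : C(Vec n, ℝ)) {t : ℝ}, IntegrableOn (fun x => U (x, t)) K →
      IntegrableOn (fun x => ψ x * U (x, t)) K := by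
    intro ψ t ht
    obtain ⟨C, hC⟩ := hK.exists_bound_of_continuousOn ψ.continuous.continuousOn
    exact Integrable.bdd_mul (c := C) ht ψ.continuous.aestronglyMeasurable
      ((ae_restrict_mem hK.measurableSet).mono fun x hx => hC x hx)
  -- comparison of two weights
  have hdiff : ∀ (ψ ψ' : C(Vec n, ℝ)) (c : ℝ), (∀ x ∈ K, |ψ x - ψ' x| ≤ c) →
      ∀ t, (t ∈ Ioo α β → IntegrableOn (fun x => U (x, t)) K) →
        |I ψ t - I ψ' t| ≤ c * Nn t := by
    intro ψ ψ' c hc t ht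
    by_cases h : t ∈ Ioo α β
    · simp only [hI, hNn, indicator_of_mem h]
      rw [← integral_sub (hψslice ψ (ht h)) (hψslice ψ' (ht h)), ← integral_const_mul]
      rw [← Real.norm_eq_abs]
      refine norm_integral_le_of_norm_le (Integrable.const_mul (ht h).abs c) ?_
      filter_upwards [ae_restrict_mem hK.measurableSet] with x hx
      rw [← sub_mul, norm_mul]
      exact mul_le_mul_of_nonneg_right (hc x hx) (norm_nonneg _)
    · simp [hI, hNn, indicator_of_notMem h]
  -- Each weight has its own null set of bad times. Separability of C(ℝⁿ) for locally uniform
  -- convergence leaves only countably many null sets to discard.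
  have hdense := TopologicalSpace.exists_countable_dense C(Vec n, ℝ)
  obtain ⟨D, hDc, hD⟩ := hdense
  have hDae : ∀ᵐ t, ∀ ψ ∈ D, Tendsto (fun i =>
      ((shrinkingBump ℝ i).normed volume ⋆[ContinuousLinearMap.lsmul ℝ ℝ] I ψ) t) atTop
        (𝓝 (I ψ t)) :=
    (ae_ball_iff hDc).2 fun ψ _ =>
      ae_tendsto_shrinkingBump_convolution volume (hIi ψ).locallyIntegrable
  filter_upwards [hslice, hDae,
    ae_tendsto_shrinkingBump_convolution volume hNi.locallyIntegrable] with t ht1 ht2 ht3 htI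
  refine ⟨ht1 htI, fun ψ => ?_⟩
  have e0 : ∀ ψ : C(Vec n, ℝ), ∫ x in K, ψ x * U (x, t) = I ψ t := fun ψ => by
    simp only [hI, indicator_of_mem htI]
  rw [e0]
  have hN0 : 0 ≤ Nn t := by
    simp only [hNn, indicator_of_mem htI]
    exact integral_nonneg fun x => abs_nonneg _
  rw [Metric.tendsto_atTop']
  intro ε hε
  -- The mollified norm is eventually below Nn t + 1, so replacing ψ by ψ' costs less than ε/3 both
  -- before and after the limit.
  set c := ε / 3 / (Nn t + 1) with hc
  have hc0 : 0 < c := by positivity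
  have hψcl : ψ ∈ closure D := hD ψ
  obtain ⟨ψs, hψsD, hψs⟩ := mem_closure_iff_seq_limit.1 hψcl
  rw [ContinuousMap.tendsto_iff_forall_isCompact_tendstoUniformlyOn] at hψs
  have hunif := Metric.tendstoUniformlyOn_iff.1 (hψs K hK) c hc0
  obtain ⟨j, hj⟩ := hunif.exists
  set ψ' := ψs j with hψ'
  have hle : ∀ x ∈ K, |ψ x - ψ' x| ≤ c := fun x hx => by
    have := hj x hx
    rw [Real.dist_eq] at this
    exact this.le
  have hconv : ∀ i, |((shrinkingBump ℝ i).normed volume ⋆[ContinuousLinearMap.lsmul ℝ ℝ] I ψ) t -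
      ((shrinkingBump ℝ i).normed volume ⋆[ContinuousLinearMap.lsmul ℝ ℝ] I ψ') t| ≤
      c * ((shrinkingBump ℝ i).normed volume ⋆[ContinuousLinearMap.lsmul ℝ ℝ] Nn) t := by
    intro i
    simp only [convolution_def, ContinuousLinearMap.lsmul_apply, smul_eq_mul]
    rw [← integral_sub (integrable_bump_mul (hIi ψ) _ t) (integrable_bump_mul (hIi ψ') _ t),
      ← integral_const_mul]
    rw [← Real.norm_eq_abs]
    refine norm_integral_le_of_norm_le ((integrable_bump_mul hNi _ t).const_mul c) ?_
    have : ∀ᵐ x, (t - x ∈ Ioo α β → IntegrableOn (fun y => U (y, t - x)) K) :=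
      (Measure.measurePreserving_sub_left volume t).quasiMeasurePreserving.ae hslice
    filter_upwards [this] with x hx
    rw [← mul_sub, norm_mul, Real.norm_of_nonneg ((shrinkingBump ℝ i).nonneg_normed x)]
    have := hdiff ψ ψ' c hle (t - x) hx
    calc _ ≤ (shrinkingBump ℝ i).normed volume x * (c * Nn (t - x)) :=
          mul_le_mul_of_nonneg_left this ((shrinkingBump ℝ i).nonneg_normed x)
      _ = _ := by ring
  have ev1 := Metric.tendsto_atTop.1 (ht2 ψ' (hψsD j)) (ε / 3) (by positivity)
  have ev2 : ∀ᶠ i in atTop,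
      ((shrinkingBump ℝ i).normed volume ⋆[ContinuousLinearMap.lsmul ℝ ℝ] Nn) t < Nn t + 1 :=
    ht3.eventually_lt_const (by linarith)
  obtain ⟨J1, hJ1⟩ := ev1
  obtain ⟨J2, hJ2⟩ := eventually_atTop.1 ev2
  refine ⟨max J1 J2, fun i hi => ?_⟩
  have b1 := hJ1 i (le_of_lt ((le_max_left _ _).trans_lt hi))
  have b2 := hJ2 i (le_of_lt ((le_max_right _ _).trans_lt hi))
  have b3 := hconv i
  have b4 := hdiff ψ ψ' c hle t (fun _ => ht1 htI)
  have b5 : c * (Nn t + 1) = ε / 3 := by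
    rw [hc]
    field_simp
  have b6 : c * ((shrinkingBump ℝ i).normed volume ⋆[ContinuousLinearMap.lsmul ℝ ℝ] Nn) t
      < ε / 3 := by
    rw [← b5]
    exact mul_lt_mul_of_pos_left b2 hc0
  have b7 : c * Nn t < ε / 3 := by
    rw [← b5]
    exact mul_lt_mul_of_pos_left (by linarith) hc0
  rw [Real.dist_eq] at b1 ⊢
  have := abs_lt.1 b1
  have := abs_le.1 b3
  have := abs_le.1 b4
  rw [abs_lt]
  constructor <;> linarith

end TimeSlices

/-! ### Weak time derivatives and the fundamental theorem of calculus -/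

section WeakDerivative

theorem bump_normed_eq_zero {φ : ContDiffBump (0 : ℝ)} {x : ℝ} (hx : φ.rOut ≤ |x|) :
    φ.normed volume x = 0 := by
  by_contra h
  have : x ∈ Function.support (φ.normed volume) := h
  rw [φ.support_normed_eq, mem_ball_zero_iff, Real.norm_eq_abs] at this
  linarith

/-- The mollified indicator function of `[s,t]`. -/
noncomputable def smoothStep (φ : ContDiffBump (0 : ℝ)) (s t τ : ℝ) : ℝ :=
  ∫ x in (τ - t)..(τ - s), φ.normed volume x

variable {φ : ContDiffBump (0 : ℝ)} {s t : ℝ}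

theorem hasDerivAt_smoothStep (τ : ℝ) :
    HasDerivAt (smoothStep φ s t) (φ.normed volume (τ - s) - φ.normed volume (τ - t)) τ := by
  have hc : Continuous (φ.normed volume) := φ.continuous_normed
  have h := fun a : ℝ => (hc.integral_hasStrictDerivAt 0 (τ - a)).hasDerivAt.comp τ
    ((hasDerivAt_id τ).sub_const a)
  have h2 := (h s).sub (h t)
  simp only [mul_one] at h2
  refine h2.congr_of_eventuallyEq (Eventually.of_forall fun σ => ?_)
  exact (intervalIntegral.integral_interval_sub_left (hc.intervalIntegrable _ _)
    (hc.intervalIntegrable _ _)).symm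

theorem contDiff_smoothStep : ContDiff ℝ ∞ (smoothStep φ s t) := by
  rw [contDiff_infty_iff_deriv]
  refine ⟨fun τ => (hasDerivAt_smoothStep τ).differentiableAt, ?_⟩
  have : deriv (smoothStep φ s t) =
      fun τ => φ.normed volume (τ - s) - φ.normed volume (τ - t) :=
    funext fun τ => (hasDerivAt_smoothStep τ).deriv
  rw [this]
  exact (φ.contDiff_normed.comp (contDiff_id.sub contDiff_const)).sub
    (φ.contDiff_normed.comp (contDiff_id.sub contDiff_const))

theorem smoothStep_eq_zero (hst : s < t) {τ : ℝ} (h : τ ≤ s - φ.rOut ∨ t + φ.rOut ≤ τ) :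
    smoothStep φ s t τ = 0 := by
  rw [smoothStep]
  apply intervalIntegral.integral_zero_ae
  refine Eventually.of_forall fun x hx => bump_normed_eq_zero ?_
  rw [uIoc_of_le (by linarith)] at hx
  rcases h with h | h
  · exact le_trans (by linarith [hx.2]) (neg_le_abs x)
  · exact le_trans (by linarith [hx.1]) (le_abs_self x)

theorem smoothStep_eq_one {τ : ℝ} (h1 : s + φ.rOut ≤ τ) (h2 : τ ≤ t - φ.rOut) :
    smoothStep φ s t τ = 1 := by
  rw [smoothStep, intervalIntegral.integral_eq_integral_of_support_subset, φ.integral_normed]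
  rw [φ.support_normed_eq]
  intro x hx
  rw [mem_ball_zero_iff, Real.norm_eq_abs, abs_lt] at hx
  exact ⟨by linarith, by linarith⟩

theorem abs_smoothStep_le_one (hst : s < t) (τ : ℝ) : |smoothStep φ s t τ| ≤ 1 := by
  rw [smoothStep, intervalIntegral.integral_of_le (by linarith),
    abs_of_nonneg (integral_nonneg fun x => φ.nonneg_normed x), ← φ.integral_normed (μ := volume)]
  exact setIntegral_le_integral φ.integrable_normed (Eventually.of_forall φ.nonneg_normed)

theorem tsupport_smoothStep_subset (hst : s < t) :
    tsupport (smoothStep φ s t) ⊆ Icc (s - φ.rOut) (t + φ.rOut) := by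
  apply closure_minimal _ isClosed_Icc
  intro τ hτ
  by_contra h
  apply hτ
  rw [mem_Icc, not_and_or, not_le, not_le] at h
  exact smoothStep_eq_zero hst (h.imp le_of_lt le_of_lt)

/-- Test with the mollified indicator of [s,t]: its derivative is a bump at s minus a bump at t,
which produces the mollifications of I at these two points. As the bumps shrink, the test functions
converge boundedly to the indicator. -/
theorem sub_eq_integral_of_weakDeriv {I J : ℝ → ℝ} {α β s t : ℝ}
    (hI : IntegrableOn I (Ioo α β)) (hJ : IntegrableOn J (Ioo α β)) (hs : s ∈ Ioo α β)
    (ht : t ∈ Ioo α β) (hst : s < t)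
    (hw : ∀ θ : ℝ → ℝ, IsTest (Ioo α β) θ →
      ∫ τ in Ioo α β, deriv θ τ * I τ = -∫ τ in Ioo α β, θ τ * J τ)
    (hcs : Tendsto (fun i => ((shrinkingBump ℝ i).normed volume ⋆[ContinuousLinearMap.lsmul ℝ ℝ]
        (Ioo α β).indicator I) s) atTop (𝓝 (I s)))
    (hct : Tendsto (fun i => ((shrinkingBump ℝ i).normed volume ⋆[ContinuousLinearMap.lsmul ℝ ℝ]
        (Ioo α β).indicator I) t) atTop (𝓝 (I t))) :
    I t - I s = ∫ x in s..t, J x := by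
  set φ := shrinkingBump ℝ with hφ
  have hr := tendsto_shrinkingBump_rOut ℝ
  have hIi : Integrable ((Ioo α β).indicator I) := (integrable_indicator_iff measurableSet_Ioo).2 hI
  have hconv : ∀ (i : ℕ) (r : ℝ), ((φ i).normed volume ⋆[ContinuousLinearMap.lsmul ℝ ℝ]
        (Ioo α β).indicator I) r = ∫ τ in Ioo α β, (φ i).normed volume (τ - r) * I τ := by
    intro i r
    rw [convolution_eq_swap, ← integral_indicator measurableSet_Ioo]
    apply integral_congr_ae
    refine Eventually.of_forall fun τ => ?_
    simp only [ContinuousLinearMap.lsmul_apply, smul_eq_mul]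
    rw [← (φ i).normed_neg, neg_sub]
    by_cases h : τ ∈ Ioo α β <;> simp [h, indicator]
  have hintg : ∀ (i : ℕ) (r : ℝ), IntegrableOn (fun τ => (φ i).normed volume (τ - r) * I τ)
      (Ioo α β) := by
    intro i r
    obtain ⟨C, hC⟩ := ((φ i).contDiff_normed (μ := volume)
      (n := 0)).continuous.bounded_above_of_compact_support (φ i).hasCompactSupport_normed
    exact Integrable.bdd_mul hI ((φ i).continuous_normed.comp
      (continuous_id.sub continuous_const)).aestronglyMeasurable
      (Eventually.of_forall fun τ => hC (τ - r))
  have hev : ∀ᶠ i in atTop, (∫ τ in Ioo α β, smoothStep (φ i) s t τ * J τ) =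
      ((φ i).normed volume ⋆[ContinuousLinearMap.lsmul ℝ ℝ] (Ioo α β).indicator I) t -
      ((φ i).normed volume ⋆[ContinuousLinearMap.lsmul ℝ ℝ] (Ioo α β).indicator I) s := by
    have hmin : 0 < min (s - α) (β - t) :=
      lt_min (by linarith [hs.1]) (by linarith [ht.2])
    filter_upwards [hr.eventually_lt_const hmin] with i hi
    have h1 := hi.trans_le (min_le_left _ _)
    have h2 := hi.trans_le (min_le_right _ _)
    have hsupp := tsupport_smoothStep_subset (φ := φ i) hst
    have htest : IsTest (Ioo α β) (smoothStep (φ i) s t) :=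
      ⟨contDiff_smoothStep, isCompact_Icc.of_isClosed_subset (isClosed_tsupport _) hsupp,
        hsupp.trans fun x hx => ⟨by linarith [hx.1], by linarith [hx.2]⟩⟩
    have := hw _ htest
    rw [hconv, hconv, ← integral_sub (hintg i t) (hintg i s), eq_comm, ← neg_inj, ← this,
      ← integral_neg]
    apply integral_congr_ae
    refine Eventually.of_forall fun τ => ?_
    simp only [(hasDerivAt_smoothStep τ).deriv]
    ring
  have hlim : Tendsto (fun i => ∫ τ in Ioo α β, smoothStep (φ i) s t τ * J τ) atTop
      (𝓝 (∫ τ in Ioo α β, (Ioo s t).indicator J τ)) := by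
    refine tendsto_integral_of_dominated_convergence (fun τ => |J τ|) (fun i => ?_) hJ.abs
      (fun i => ?_) ?_
    · exact contDiff_smoothStep.continuous.aestronglyMeasurable.mul hJ.1
    · refine Eventually.of_forall fun τ => ?_
      rw [norm_mul]
      exact mul_le_of_le_one_left (norm_nonneg _) (abs_smoothStep_le_one hst τ)
    -- Away from the two jump points the mollified indicator is eventually constant.
    · have hne : ∀ᵐ τ ∂(volume.restrict (Ioo α β)), τ ≠ s ∧ τ ≠ t := by
        apply ae_restrict_of_ae
        filter_upwards [compl_mem_ae_iff.2 (measure_singleton s),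
          compl_mem_ae_iff.2 (measure_singleton t)] with τ h1 h2
        exact ⟨h1, h2⟩
      filter_upwards [hne] with τ ⟨hτs, hτt⟩
      apply tendsto_const_nhds.congr'
      by_cases h : τ ∈ Ioo s t
      · filter_upwards [hr.eventually_lt_const (sub_pos.2 h.1),
          hr.eventually_lt_const (sub_pos.2 h.2)] with i h1 h2
        rw [smoothStep_eq_one (by linarith) (by linarith), indicator_of_mem h, one_mul]
      · rw [mem_Ioo, not_and_or, not_lt, not_lt] at h
        rcases h with h | h
        · filter_upwards [hr.eventually_lt_const (sub_pos.2 (lt_of_le_of_ne h hτs))] with i h1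
          rw [smoothStep_eq_zero hst (Or.inl (by linarith)), indicator_of_notMem, zero_mul]
          exact fun hh => absurd hh.1 (not_lt.2 h)
        · filter_upwards [hr.eventually_lt_const (sub_pos.2 (lt_of_le_of_ne h hτt.symm))] with i h1
          rw [smoothStep_eq_zero hst (Or.inr (by linarith)), indicator_of_notMem, zero_mul]
          exact fun hh => absurd hh.2 (not_lt.2 h)
  have huniq := tendsto_nhds_unique (hlim.congr' hev) (hct.sub hcs)
  rw [← huniq, setIntegral_indicator measurableSet_Ioo, intervalIntegral.integral_of_le hst.le,
    integral_Ioc_eq_integral_Ioo, inter_eq_right.2 (Ioo_subset_Ioo hs.1.le ht.2.le)]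

/-- A full-measure set of times at which the curve `t ↦ U(·,t)` is represented, for all test
functions at once, by the primitive of its weak time derivative. -/
theorem exists_good_times {n : ℕ} {Ω : Set (Vec n)} (hΩ : IsOpen Ω) {T : ℝ}
    {U : Vec n × ℝ → ℝ}
    (hU : ∀ K, IsCompact K → K ⊆ Ω → ∀ α β, 0 < α → β < T → IntegrableOn U (K ×ˢ Ioo α β)) :
    ∃ S ⊆ Ioo 0 T, (∀ᵐ t, t ∈ Ioo 0 T → t ∈ S) ∧
      ∀ ψ : Vec n → ℝ, IsTest Ω ψ → ∀ J : ℝ → ℝ,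
        (∀ α β, 0 < α → β < T → IntegrableOn J (Ioo α β)) →
        (∀ θ : ℝ → ℝ, IsTest (Ioo 0 T) θ →
          ∫ τ in Ioo 0 T, deriv θ τ * ∫ x in Ω, ψ x * U (x, τ) = -∫ τ in Ioo 0 T, θ τ * J τ) →
        ∀ s ∈ S, ∀ t ∈ S,
          (∫ x in Ω, ψ x * U (x, t)) - (∫ x in Ω, ψ x * U (x, s)) = ∫ τ in s..t, J τ := by
  obtain ⟨K, hKc, hKm, hKΩ, hKex⟩ := exists_compact_exhaustion hΩ
  have hδ : ∀ k : ℕ, 0 < (1 : ℝ) / (k + 1) := fun k => by positivity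
  -- U is integrable only away from t = 0 and t = T, so the good times are collected along an
  -- exhaustion indexed by the same k as K k.
  set α : ℕ → ℝ := fun k => 1 / ((k : ℝ) + 1) with hα
  set β : ℕ → ℝ := fun k => T - 1 / ((k : ℝ) + 1) with hβ
  have hall : ∀ᵐ t, ∀ k : ℕ, t ∈ Ioo (α k) (β k) →
      IntegrableOn (fun x => U (x, t)) (K k) ∧ ∀ ψ : C(Vec n, ℝ),
      Tendsto (fun i => ((shrinkingBump ℝ i).normed volume ⋆[ContinuousLinearMap.lsmul ℝ ℝ]
        (Ioo (α k) (β k)).indicator fun τ => ∫ x in K k, ψ x * U (x, τ)) t) atTop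
        (𝓝 (∫ x in K k, ψ x * U (x, t))) :=
    ae_all_iff.2 fun k => ae_tendsto_convolution_slices (hKc k)
      (hU _ (hKc k) (hKΩ k) _ _ (hδ k) (by linarith [hδ k]))
  refine ⟨{t | t ∈ Ioo 0 T ∧ ∀ k : ℕ, t ∈ Ioo (α k) (β k) →
      IntegrableOn (fun x => U (x, t)) (K k) ∧ ∀ ψ : C(Vec n, ℝ),
      Tendsto (fun i => ((shrinkingBump ℝ i).normed volume ⋆[ContinuousLinearMap.lsmul ℝ ℝ]
        (Ioo (α k) (β k)).indicator fun τ => ∫ x in K k, ψ x * U (x, τ)) t) atTop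
        (𝓝 (∫ x in K k, ψ x * U (x, t)))}, fun t ht => ht.1, ?_, ?_⟩
  · filter_upwards [hall] with t ht h
    exact ⟨h, ht⟩
  intro ψ hψ J hJ hw
  -- reduction to ordered times
  have key : ∀ s t : ℝ, s < t → s ∈ Ioo 0 T → t ∈ Ioo 0 T →
      (∀ k : ℕ, s ∈ Ioo (α k) (β k) → ∀ ψ : C(Vec n, ℝ),
      Tendsto (fun i => ((shrinkingBump ℝ i).normed volume ⋆[ContinuousLinearMap.lsmul ℝ ℝ]
        (Ioo (α k) (β k)).indicator fun τ => ∫ x in K k, ψ x * U (x, τ)) s) atTop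
        (𝓝 (∫ x in K k, ψ x * U (x, s)))) →
      (∀ k : ℕ, t ∈ Ioo (α k) (β k) → ∀ ψ : C(Vec n, ℝ),
      Tendsto (fun i => ((shrinkingBump ℝ i).normed volume ⋆[ContinuousLinearMap.lsmul ℝ ℝ]
        (Ioo (α k) (β k)).indicator fun τ => ∫ x in K k, ψ x * U (x, τ)) t) atTop
        (𝓝 (∫ x in K k, ψ x * U (x, t)))) →
      (∫ x in Ω, ψ x * U (x, t)) - (∫ x in Ω, ψ x * U (x, s)) = ∫ τ in s..t, J τ := by
    intro s t hst hsT htT hs ht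
    obtain ⟨k₁, hk₁⟩ := hKex _ hψ.2.1 hψ.2.2
    obtain ⟨k₂, hk₂⟩ := exists_nat_one_div_lt (show 0 < min s (T - t) from
      lt_min hsT.1 (by linarith [htT.2]))
    set k := max k₁ k₂ with hk
    have hsupp : tsupport ψ ⊆ K k := (hk₁.trans interior_subset).trans (hKm (le_max_left _ _))
    have hαk : α k < min s (T - t) := by
      refine lt_of_le_of_lt ?_ hk₂
      simp only [hα]
      gcongr
      exact le_max_right _ _
    have hsI : s ∈ Ioo (α k) (β k) := by
      have h1 := hαk.trans_le (min_le_left _ _)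
      have h2 := hαk.trans_le (min_le_right _ _)
      simp only [hα, hβ] at h1 h2 ⊢
      exact ⟨h1, by linarith⟩
    have htI : t ∈ Ioo (α k) (β k) := by
      have h1 := hαk.trans_le (min_le_left _ _)
      have h2 := hαk.trans_le (min_le_right _ _)
      simp only [hα, hβ] at h1 h2 ⊢
      exact ⟨by linarith, by linarith⟩
    have hsub : Ioo (α k) (β k) ⊆ Ioo 0 T := by
      apply Ioo_subset_Ioo (hδ k).le
      simp only [hβ]
      linarith [hδ k]
    -- This k was chosen so that K k contains the support of ψ and the k-th time interval contains s
    -- and t; all of Ω_T thus reduces to one compact piece.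
    have eK : ∀ τ, ∫ x in Ω, ψ x * U (x, τ) = ∫ x in K k, ψ x * U (x, τ) := by
      intro τ
      apply setIntegral_eq_of_subset_of_forall_sdiff_eq_zero hΩ.measurableSet (hKΩ k)
      intro x hx
      rw [image_eq_zero_of_notMem_tsupport fun h => hx.2 (hsupp h), zero_mul]
    simp_rw [eK] at hw ⊢
    have hUk := hU _ (hKc k) (hKΩ k) _ _ (hδ k) (show β k < T by simp only [hβ]; linarith [hδ k])
    have hψU : Integrable (fun z : Vec n × ℝ => ψ z.1 * U z)
        ((volume.restrict (K k)).prod (volume.restrict (Ioo (α k) (β k)))) := by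
      obtain ⟨C, hC⟩ := hψ.1.continuous.bounded_above_of_compact_support hψ.2.1
      rw [Measure.prod_restrict]
      exact Integrable.bdd_mul (c := C) hUk
        (hψ.1.continuous.comp continuous_fst).aestronglyMeasurable
        (Eventually.of_forall fun z => hC _)
    refine sub_eq_integral_of_weakDeriv (α := α k) (β := β k)
      (I := fun τ => ∫ x in K k, ψ x * U (x, τ)) hψU.integral_prod_right
      (hJ _ _ (hδ k) (by simp only [hβ]; linarith [hδ k])) hsI htI hst (fun θ hθ => ?_)
      (hs k hsI ⟨ψ, hψ.1.continuous⟩) (ht k htI ⟨ψ, hψ.1.continuous⟩)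
    have h0 : ∀ τ ∉ Ioo (α k) (β k), θ τ = 0 := fun τ hτ =>
      image_eq_zero_of_notMem_tsupport fun h => hτ (hθ.2.2 h)
    have h0' : ∀ τ ∉ Ioo (α k) (β k), deriv θ τ = 0 := fun τ hτ =>
      image_eq_zero_of_notMem_tsupport fun h => hτ (hθ.2.2 (tsupport_deriv_subset h))
    have := hw θ ⟨hθ.1, hθ.2.1, hθ.2.2.trans hsub⟩
    rw [setIntegral_eq_of_subset_of_forall_sdiff_eq_zero measurableSet_Ioo hsub
      (fun τ hτ => by rw [h0' τ hτ.2, zero_mul]),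
      setIntegral_eq_of_subset_of_forall_sdiff_eq_zero measurableSet_Ioo hsub
      (fun τ hτ => by rw [h0 τ hτ.2, zero_mul])] at this
    exact this
  rintro s ⟨hsT, hs⟩ t ⟨htT, ht⟩
  rcases lt_trichotomy s t with h | h | h
  · exact key s t h hsT htT (fun k hk => (hs k hk).2) (fun k hk => (ht k hk).2)
  · simp [h]
  · rw [intervalIntegral.integral_symm, ← key t s h htT hsT (fun k hk => (ht k hk).2)
      (fun k hk => (hs k hk).2)]
    ring

end WeakDerivative

/-! ### Smooth truncation and approximation in the pairing -/

section Approximation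

variable {n : ℕ}

/-- The squared length of the gradient of a scalar function. -/
noncomputable def gradSq (ψ : Vec n → ℝ) (x : Vec n) : ℝ :=
  ∑ i, (fderiv ℝ ψ x (EuclideanSpace.single i 1)) ^ 2

theorem gradSq_nonneg (ψ : Vec n → ℝ) (x : Vec n) : 0 ≤ gradSq ψ x :=
  Finset.sum_nonneg fun _ _ => sq_nonneg _

theorem IsTest.continuous_partial {Ω : Set (Vec n)} {ψ : Vec n → ℝ} (h : IsTest Ω ψ) (e : Vec n) :
    Continuous fun x => fderiv ℝ ψ x e :=
  (h.1.continuous_fderiv (by simp)).clm_apply continuous_const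

theorem IsTest.hasCompactSupport_partial {Ω : Set (Vec n)} {ψ : Vec n → ℝ} (h : IsTest Ω ψ)
    (e : Vec n) : HasCompactSupport fun x => fderiv ℝ ψ x e :=
  h.2.1.fderiv_apply ℝ e

theorem IsTest.integrable_gradSq {Ω : Set (Vec n)} {ψ : Vec n → ℝ} (h : IsTest Ω ψ) :
    Integrable (gradSq ψ) := by
  apply integrable_finsetSum
  intro i _
  have hc := h.continuous_partial (EuclideanSpace.single i 1)
  have hs := h.hasCompactSupport_partial (EuclideanSpace.single i 1)
  simp_rw [pow_two]
  exact (hc.mul hc).integrable_of_hasCompactSupport (hs.mul_left)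

/-- A smooth truncation of `ψ` at height `M`. -/
noncomputable def sinTrunc (M : ℝ) (ψ : Vec n → ℝ) (x : Vec n) : ℝ := M * Real.sin (ψ x / M)

theorem abs_sinTrunc_le {M : ℝ} (hM : 0 < M) (ψ : Vec n → ℝ) (x : Vec n) :
    |sinTrunc M ψ x| ≤ M := by
  rw [sinTrunc, abs_mul, abs_of_pos hM]
  exact mul_le_of_le_one_right hM.le (Real.abs_sin_le_one _)

theorem abs_sinTrunc_le_abs {M : ℝ} (hM : 0 < M) (ψ : Vec n → ℝ) (x : Vec n) :
    |sinTrunc M ψ x| ≤ |ψ x| := by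
  rw [sinTrunc, abs_mul, abs_of_pos hM]
  calc M * |Real.sin (ψ x / M)| ≤ M * |ψ x / M| := by
        exact mul_le_mul_of_nonneg_left Real.abs_sin_le_abs hM.le
    _ = |ψ x| := by
        rw [abs_div, abs_of_pos hM]
        field_simp

theorem tendsto_mul_sin_div (y : ℝ) :
    Tendsto (fun j : ℕ => ((j : ℝ) + 1) * Real.sin (y / ((j : ℝ) + 1))) atTop (𝓝 y) := by
  have h1 : HasDerivAt (fun x : ℝ => Real.sin (y * x)) y 0 := by
    have h := ((hasDerivAt_id (0 : ℝ)).const_mul y).sin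
    simpa using h
  have h2 := h1.tendsto_slope_zero_right
  have h3 : Tendsto (fun j : ℕ => 1 / ((j : ℝ) + 1)) atTop (𝓝[>] 0) :=
    tendsto_nhdsWithin_iff.2 ⟨tendsto_one_div_add_atTop_nhds_zero_nat,
      Eventually.of_forall fun j => by simp only [mem_Ioi]; positivity⟩
  refine (h2.comp h3).congr fun j => ?_
  simp [div_eq_mul_inv]

theorem IsTest.sinTrunc {Ω : Set (Vec n)} {ψ : Vec n → ℝ} (h : IsTest Ω ψ) (M : ℝ) :
    IsTest Ω (sinTrunc M ψ) := by
  have hsub : tsupport (PorousMedium.sinTrunc M ψ) ⊆ tsupport ψ := by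
    apply closure_mono
    intro x hx hψ
    apply hx
    simp [PorousMedium.sinTrunc, hψ]
  exact ⟨contDiff_const.mul (Real.contDiff_sin.comp (h.1.div_const M)),
    h.2.1.of_isClosed_subset (isClosed_tsupport _) hsub, hsub.trans h.2.2⟩

/-- The chain rule multiplies the gradient by cos(ψ/M). The sine thus truncates without leaving the
smooth class, vanishes where ψ does, and does not increase the energy. -/
theorem IsTest.gradSq_sinTrunc_le {Ω : Set (Vec n)} {ψ : Vec n → ℝ} (h : IsTest Ω ψ) {M : ℝ}
    (hM : 0 < M) (x : Vec n) : gradSq (PorousMedium.sinTrunc M ψ) x ≤ gradSq ψ x := by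
  have hd : HasFDerivAt ψ (fderiv ℝ ψ x) x :=
    ((h.1.differentiable (by simp)) x).hasFDerivAt
  have h1 : HasFDerivAt (PorousMedium.sinTrunc M ψ) (Real.cos (ψ x / M) • fderiv ℝ ψ x) x := by
    have h2 := ((hd.mul_const M⁻¹).sin).const_mul M
    refine (h2.congr_fderiv ?_)
    ext e
    simp [div_eq_mul_inv]
    field_simp
  rw [gradSq, gradSq, h1.fderiv]
  apply Finset.sum_le_sum
  intro i _
  simp only [smul_apply, smul_eq_mul, mul_pow]
  exact mul_le_of_le_one_left (sq_nonneg _) (Real.cos_sq_le_one _)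

/-- A bound on the pairing with test functions in terms of their Dirichlet energy extends to
almost everywhere limits of test functions of bounded energy. -/
theorem abs_integral_mul_le_of_tendsto {Ω : Set (Vec n)}
    {d φ : Vec n → ℝ} {A C R : ℝ} (hC : 0 ≤ C) (hd : IntegrableOn d Ω)
    (hbound : ∀ ψ : Vec n → ℝ, IsTest Ω ψ →
      |∫ x in Ω, ψ x * d x| ≤ A + C * ∫ x in Ω, gradSq ψ x)
    (hφd : IntegrableOn (fun x => φ x * d x) Ω) {φs : ℕ → Vec n → ℝ} {Rs : ℕ → ℝ}
    (hφs : ∀ k, IsTest Ω (φs k))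
    (hlim : ∀ᵐ x ∂(volume.restrict Ω), Tendsto (fun k => φs k x) atTop (𝓝 (φ x)))
    (hRs : ∀ k, ∫ x in Ω, gradSq (φs k) x ≤ Rs k) (hR : Tendsto Rs atTop (𝓝 R)) :
    |∫ x in Ω, φ x * d x| ≤ A + C * R := by
  -- As d is only integrable, almost everywhere convergence of `φs` does not pass to the integral.
  -- After truncation at M the integrands are dominated by M|d|. Afterwards M tends to infinity with
  -- dominating function |φ d|.
  have step : ∀ M : ℝ, 0 < M → |∫ x in Ω, sinTrunc M φ x * d x| ≤ A + C * R ∧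
      AEStronglyMeasurable (fun x => sinTrunc M φ x * d x) (volume.restrict Ω) := by
    intro M hM
    have hmeas : ∀ k, AEStronglyMeasurable (fun x => sinTrunc M (φs k) x * d x)
        (volume.restrict Ω) := fun k =>
      ((hφs k).sinTrunc M).1.continuous.aestronglyMeasurable.mul hd.1
    have hl : ∀ᵐ x ∂(volume.restrict Ω), Tendsto (fun k => sinTrunc M (φs k) x * d x) atTop
        (𝓝 (sinTrunc M φ x * d x)) := by
      filter_upwards [hlim] with x hx
      exact (((Real.continuous_sin.tendsto _).comp (hx.div_const M)).const_mul M).mul_const _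
    have h1 : Tendsto (fun k => ∫ x in Ω, sinTrunc M (φs k) x * d x) atTop
        (𝓝 (∫ x in Ω, sinTrunc M φ x * d x)) := by
      refine tendsto_integral_of_dominated_convergence (fun x => M * |d x|) hmeas
        (hd.abs.const_mul M) (fun k => Eventually.of_forall fun x => ?_) hl
      rw [norm_mul]
      exact mul_le_mul_of_nonneg_right (abs_sinTrunc_le hM _ _) (norm_nonneg _)
    refine ⟨le_of_tendsto_of_tendsto' h1.abs ((hR.const_mul C).const_add A) fun k => ?_,
      aestronglyMeasurable_of_tendsto_ae _ hmeas hl⟩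
    refine (hbound _ ((hφs k).sinTrunc M)).trans (by
      gcongr
      refine le_trans ?_ (hRs k)
      exact setIntegral_mono ((hφs k).sinTrunc M).integrable_gradSq.integrableOn
        (hφs k).integrable_gradSq.integrableOn fun x => (hφs k).gradSq_sinTrunc_le hM x)
  have hpos : ∀ j : ℕ, 0 < (j : ℝ) + 1 := fun j => by positivity
  have h2 : Tendsto (fun j : ℕ => ∫ x in Ω, sinTrunc ((j : ℝ) + 1) φ x * d x) atTop
      (𝓝 (∫ x in Ω, φ x * d x)) := by
    refine tendsto_integral_of_dominated_convergence (fun x => |φ x * d x|)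
      (fun j => (step _ (hpos j)).2) hφd.abs (fun j => Eventually.of_forall fun x => ?_)
      (Eventually.of_forall fun x => (tendsto_mul_sin_div (φ x)).mul_const _)
    rw [norm_mul, abs_mul]
    exact mul_le_mul_of_nonneg_right (abs_sinTrunc_le_abs (hpos j) _ _) (norm_nonneg _)
  exact le_of_tendsto h2.abs (Eventually.of_forall fun j => (step _ (hpos j)).1)

end Approximation

/-! ### Mollification of weakly differentiable functions -/

section Mollification

variable {n : ℕ}

/-- Jensen's inequality for the square, from nonnegativity of the variance of H under the
probability density ρ. -/
theorem sq_integral_mul_le {X : Type*} [MeasurableSpace X] {κ : Measure X} {ρ H : X → ℝ}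
    (hρ0 : ∀ x, 0 ≤ ρ x) (hρ1 : ∫ x, ρ x ∂κ = 1) (hρ : Integrable ρ κ)
    (h1 : Integrable (fun x => ρ x * H x) κ) (h2 : Integrable (fun x => ρ x * H x ^ 2) κ) :
    (∫ x, ρ x * H x ∂κ) ^ 2 ≤ ∫ x, ρ x * H x ^ 2 ∂κ := by
  set c := ∫ x, ρ x * H x ∂κ with hc
  have h0 : 0 ≤ ∫ x, ρ x * (H x - c) ^ 2 ∂κ :=
    integral_nonneg fun x => mul_nonneg (hρ0 x) (sq_nonneg _)
  have e : ∫ x, ρ x * (H x - c) ^ 2 ∂κ = (∫ x, ρ x * H x ^ 2 ∂κ) - c ^ 2 := by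
    have : ∀ x, ρ x * (H x - c) ^ 2 = ρ x * H x ^ 2 - 2 * c * (ρ x * H x) + c ^ 2 * ρ x :=
      fun x => by ring
    simp_rw [this]
    have h3 : Integrable (fun x => ρ x * H x ^ 2 - 2 * c * (ρ x * H x)) κ :=
      h2.sub (h1.const_mul (2 * c))
    rw [integral_add h3 (hρ.const_mul _), integral_sub h2 (h1.const_mul _), integral_const_mul,
      integral_const_mul, ← hc, hρ1]
    ring
  linarith

/-- The weak identity with ζ(x) = ρ(y - x) moves the derivative from the kernel to v. This ζ is
tested on the whole space, where v has been extended by zero. -/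
theorem fderiv_convolution_eq {ρ v H : Vec n → ℝ} {e : Vec n} (hρ : ContDiff ℝ ∞ ρ)
    (hρc : HasCompactSupport ρ) (hv : Integrable v)
    (hweak : ∀ ζ : Vec n → ℝ, ContDiff ℝ ∞ ζ → ∫ x, v x * fderiv ℝ ζ x e = -∫ x, H x * ζ x)
    (y : Vec n) :
    fderiv ℝ (ρ ⋆[ContinuousLinearMap.lsmul ℝ ℝ] v) y e
      = (ρ ⋆[ContinuousLinearMap.lsmul ℝ ℝ] H) y := by
  have h1 := hρc.hasFDerivAt_convolution_left (ContinuousLinearMap.lsmul ℝ ℝ)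
    (hρ.of_le (by simp)) hv.locallyIntegrable y
  have hex : Integrable (fun x => ((ContinuousLinearMap.lsmul ℝ ℝ).precompL (Vec n))
      (fderiv ℝ ρ (y - x)) (v x)) := by
    have := ((hρc.fderiv ℝ).convolutionExists_left ((ContinuousLinearMap.lsmul ℝ ℝ).precompL (Vec n))
      (hρ.continuous_fderiv (by simp)) hv.locallyIntegrable y).integrable_swap
    exact this
  rw [h1.fderiv, convolution_eq_swap, ContinuousLinearMap.integral_apply hex, convolution_eq_swap]
  have hζ : ContDiff ℝ ∞ fun x => ρ (y - x) := hρ.comp (contDiff_const.sub contDiff_id)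
  have h2 := hweak _ hζ
  have h3 : ∀ x, fderiv ℝ (fun x => ρ (y - x)) x e = -(fderiv ℝ ρ (y - x) e) := by
    intro x
    have hd : HasFDerivAt ρ (fderiv ℝ ρ (y - x)) (y - x) :=
      ((hρ.differentiable (by simp)) _).hasFDerivAt
    have := hd.comp x ((hasFDerivAt_id x).const_sub y)
    have h4 := this.fderiv
    simp only [Function.comp_def] at h4
    rw [h4]
    simp
  simp_rw [h3, mul_neg] at h2
  rw [integral_neg, neg_inj] at h2
  simp only [ContinuousLinearMap.precompL_apply, ContinuousLinearMap.lsmul_apply, smul_eq_mul]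
  simp_rw [mul_comm _ (v _), h2, mul_comm]

/-- Compactly supported functions with square integrable weak gradient are almost everywhere
limits of test functions of no larger energy. -/
theorem exists_test_tendsto {Ω K : Set (Vec n)} (hΩ : IsOpen Ω) (hK : IsCompact K) (hKΩ : K ⊆ Ω)
    {v : Vec n → ℝ} {H : Fin n → Vec n → ℝ} (hv : Integrable v) (hv0 : ∀ x ∉ K, v x = 0)
    (hH : ∀ i, Integrable (H i)) (hH2 : ∀ i, Integrable fun x => H i x ^ 2)
    (hweak : ∀ i, ∀ ζ : Vec n → ℝ, ContDiff ℝ ∞ ζ →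
      ∫ x, v x * fderiv ℝ ζ x (EuclideanSpace.single i 1) = -∫ x, H i x * ζ x) :
    ∃ φ : ℕ → Vec n → ℝ, (∀ k, IsTest Ω (φ k)) ∧
      (∀ᵐ x, Tendsto (fun k => φ k x) atTop (𝓝 (v x))) ∧
      ∀ k, ∫ x in Ω, gradSq (φ k) x ≤ ∑ i, ∫ x, H i x ^ 2 := by
  set φ : ℕ → Vec n → ℝ := fun k =>
    (shrinkingBump (Vec n) k).normed volume ⋆[ContinuousLinearMap.lsmul ℝ ℝ] v with hφ
  -- Mollification enlarges the support by the bump radius, so the sequence starts at an index k₀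
  -- where this radius is below the distance δ left inside Ω.
  obtain ⟨δ, hδ, hδΩ⟩ := hK.exists_cthickening_subset_open hΩ hKΩ
  obtain ⟨k₀, hk₀⟩ := eventually_atTop.1
    ((tendsto_shrinkingBump_rOut (Vec n)).eventually_lt_const hδ)
  have htest : ∀ k, IsTest Ω (φ (k + k₀)) := by
    intro k
    set ρ := shrinkingBump (Vec n) (k + k₀)
    have hsub : Function.support (φ (k + k₀)) ⊆ Metric.cthickening δ K := by
      intro y hy
      obtain ⟨a, ha, b, hb, rfl⟩ := support_convolution_subset _ hy
      rw [ρ.support_normed_eq, mem_ball_zero_iff] at ha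
      have hbK : b ∈ K := by
        by_contra h
        exact hb (hv0 b h)
      apply Metric.mem_cthickening_of_dist_le _ b δ K hbK
      have := hk₀ (k + k₀) (Nat.le_add_left _ _)
      simp only [dist_eq_norm, add_sub_cancel_right]
      exact (ha.trans this).le
    have hts : tsupport (φ (k + k₀)) ⊆ Metric.cthickening δ K :=
      closure_minimal hsub Metric.isClosed_cthickening
    exact ⟨ρ.hasCompactSupport_normed.contDiff_convolution_left _ ρ.contDiff_normed
        hv.locallyIntegrable,
      hK.cthickening.of_isClosed_subset (isClosed_tsupport _) hts, hts.trans hδΩ⟩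
  refine ⟨fun k => φ (k + k₀), htest, ?_, fun k => ?_⟩
  · filter_upwards [ae_tendsto_shrinkingBump_convolution volume hv.locallyIntegrable] with x hx
    exact hx.comp (tendsto_add_atTop_nat k₀)
  set ρ := shrinkingBump (Vec n) (k + k₀)
  have hbound : ∀ (i : Fin n) (y : Vec n),
      (fderiv ℝ (φ (k + k₀)) y (EuclideanSpace.single i 1)) ^ 2 ≤
        (ρ.normed volume ⋆[ContinuousLinearMap.lsmul ℝ ℝ] fun x => H i x ^ 2) y := by
    intro i y
    have e := fderiv_convolution_eq (ρ := ρ.normed volume) (e := EuclideanSpace.single i 1)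
      (H := H i) ρ.contDiff_normed
      ρ.hasCompactSupport_normed hv (hweak i) y
    rw [hφ]
    simp only
    rw [e, convolution_eq_swap, convolution_eq_swap]
    simp only [ContinuousLinearMap.lsmul_apply, smul_eq_mul]
    obtain ⟨C, hC⟩ := ((ρ.contDiff_normed (μ := volume)
      (n := 0)).continuous).bounded_above_of_compact_support ρ.hasCompactSupport_normed
    have hm : AEStronglyMeasurable (fun x => ρ.normed volume (y - x)) volume :=
      (ρ.continuous_normed.comp (continuous_const.sub continuous_id)).aestronglyMeasurable
    refine sq_integral_mul_le (fun x => ρ.nonneg_normed _) ?_ ?_ ?_ ?_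
    · rw [integral_sub_left_eq_self (fun x => ρ.normed volume x)]
      exact ρ.integral_normed
    · exact ρ.integrable_normed.comp_sub_left y
    · exact (hH i).bdd_mul hm (Eventually.of_forall fun x => hC _)
    · exact (hH2 i).bdd_mul hm (Eventually.of_forall fun x => hC _)
  have hci : ∀ i, Integrable
      (ρ.normed volume ⋆[ContinuousLinearMap.lsmul ℝ ℝ] fun x => H i x ^ 2) := fun i =>
    ρ.integrable_normed.integrable_convolution _ (hH2 i)
  calc ∫ x in Ω, gradSq (φ (k + k₀)) x ≤ ∫ x, gradSq (φ (k + k₀)) x :=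
        setIntegral_le_integral (htest k).integrable_gradSq
          (Eventually.of_forall fun x => gradSq_nonneg _ _)
    _ ≤ ∫ x, ∑ i, (ρ.normed volume ⋆[ContinuousLinearMap.lsmul ℝ ℝ] fun x => H i x ^ 2) x :=
        integral_mono (htest k).integrable_gradSq (integrable_finsetSum _ fun i _ => hci i)
          fun x => Finset.sum_le_sum fun i _ => hbound i x
    _ = ∑ i, ∫ x, H i x ^ 2 := by
        rw [integral_finsetSum _ fun i _ => hci i]
        refine Finset.sum_congr rfl fun i _ => ?_
        rw [integral_convolution _ ρ.integrable_normed (hH2 i), ρ.integral_normed]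
        simp

end Mollification

/-! ### Measurability and integrability of the flux -/

section Caratheodory

/-- Along a simple function the composition is a finite sum of restrictions of the maps with frozen
second argument. Continuity in that argument carries measurability to limits of simple functions. -/
theorem aestronglyMeasurable_caratheodory {Z E F : Type*} [MeasurableSpace Z] {κ : Measure Z}
    [TopologicalSpace E] [NormedAddCommGroup F]
    {A : Z → E → F} (hA : ∀ e, AEStronglyMeasurable (fun z => A z e) κ)
    (hc : ∀ᵐ z ∂κ, Continuous (A z)) {f : Z → E} (hf : AEStronglyMeasurable f κ) :
    AEStronglyMeasurable (fun z => A z (f z)) κ := by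
  have hsimple : ∀ s : SimpleFunc Z E, AEStronglyMeasurable (fun z => A z (s z)) κ := by
    intro s
    have e : (fun z => A z (s z)) =
        fun z => ∑ c ∈ s.range, (s ⁻¹' {c}).indicator (fun z => A z c) z := by
      ext1 z
      rw [Finset.sum_eq_single (s z)]
      · simp
      · intro c _ hcs
        rw [indicator_of_notMem]
        simpa using Ne.symm hcs
      · simp
    rw [e]
    exact Finset.aestronglyMeasurable_fun_sum _ fun c _ =>
      (hA c).indicator (s.measurableSet_preimage _)
  refine aestronglyMeasurable_of_tendsto_ae atTop
    (fun k => hsimple (hf.stronglyMeasurable_mk.approx k)) ?_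
  filter_upwards [hc, hf.ae_eq_mk] with z hz hfz
  rw [hfz]
  exact (hz.tendsto _).comp (hf.stronglyMeasurable_mk.tendsto_approx z)

variable {n N : ℕ} {Ω : Set (Vec n)} {T ν L μ : ℝ}
  {A : Vec n × ℝ → Vec N → Mat N n → Mat N n}

theorem IsAdmissible.memLp_flux (hA : IsAdmissible Ω T ν L μ A) {u : Vec n × ℝ → Vec N}
    {G : Vec n × ℝ → Mat N n} {Q : Set (Vec n × ℝ)} (hQ : Q ⊆ cyl Ω T)
    (hu : AEStronglyMeasurable u (volume.restrict (cyl Ω T)))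
    (hG : MemLp G 2 (volume.restrict Q)) :
    MemLp (fun z => A z (u z) (G z)) 2 (volume.restrict Q) := by
  have hle : volume.restrict Q ≤ volume.restrict (cyl Ω T) := Measure.restrict_mono hQ le_rfl
  have hm : AEStronglyMeasurable (fun z => A z (u z) (G z)) (volume.restrict Q) :=
    aestronglyMeasurable_caratheodory (A := fun z (q : Vec N × Mat N n) => A z q.1 q.2)
      (fun q => (hA.measurable q.1 q.2).mono_measure hle) (ae_mono hle hA.continuous)
      ((hu.mono_measure hle).prodMk hG.1)
  refine hG.of_le_mul (c := L) hm ?_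
  filter_upwards [ae_mono hle hA.growth] with z hz
  exact hz _ _

end Caratheodory

/-! ### Testing the equation with products θ(t)ψ(x) -/

section ProductTests

variable {n N : ℕ} {Ω : Set (Vec n)} {T : ℝ}

/-- Integrability on products of compact subsets of `Ω` with compact subintervals of `(0,T)`. -/
def LocInt (Ω : Set (Vec n)) (T : ℝ) (U : Vec n × ℝ → ℝ) : Prop :=
  ∀ K, IsCompact K → K ⊆ Ω → ∀ α β, 0 < α → β < T → IntegrableOn U (K ×ˢ Ioo α β)

theorem MemLpLoc.memLp_prod {E : Type*} [NormedAddCommGroup E] {p : ℝ≥0∞} {f : Vec n × ℝ → E}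
    (hf : MemLpLoc p (cyl Ω T) f) {K : Set (Vec n)} (hK : IsCompact K) (hKΩ : K ⊆ Ω)
    {α β : ℝ} (hα : 0 < α) (hβ : β < T) : MemLp f p (volume.restrict (K ×ˢ Ioo α β)) := by
  refine (hf (K ×ˢ Icc α β) (hK.prod isCompact_Icc) ?_).mono_measure
    (Measure.restrict_mono (Set.prod_mono le_rfl Ioo_subset_Icc_self) le_rfl)
  exact Set.prod_mono hKΩ fun t ht => ⟨hα.trans_le ht.1, ht.2.trans_lt hβ⟩

theorem volume_prod_Ioo_lt_top {K : Set (Vec n)} (hK : IsCompact K) (α β : ℝ) :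
    volume (K ×ˢ Ioo α β) < ⊤ := by
  rw [Measure.volume_eq_prod, Measure.prod_prod]
  exact ENNReal.mul_lt_top hK.measure_lt_top measure_Ioo_lt_top

theorem MemLpLoc.locInt {ι : Type*} [Fintype ι] {p : ℝ≥0∞} (hp : 1 ≤ p)
    {f : Vec n × ℝ → EuclideanSpace ℝ ι} (hf : MemLpLoc p (cyl Ω T) f) (j : ι) :
    LocInt Ω T fun z => f z j := by
  intro K hK hKΩ α β hα hβ
  have : IsFiniteMeasure (volume.restrict (K ×ˢ Ioo α β)) :=
    ⟨by simpa using volume_prod_Ioo_lt_top hK α β⟩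
  exact ((EuclideanSpace.proj j : EuclideanSpace ℝ ι →L[ℝ] ℝ).integrable_comp
    ((hf.memLp_prod hK hKΩ hα hβ).integrable hp))

theorem exists_Icc_of_isCompact {C : Set ℝ} (hC : IsCompact C) (hCT : C ⊆ Ioo 0 T) (hT : 0 < T) :
    ∃ α β, 0 < α ∧ β < T ∧ C ⊆ Ioo α β := by
  rcases C.eq_empty_or_nonempty with rfl | hne
  -- For an empty support any interval inside (0,T) will do, even an empty one.
  · exact ⟨T / 2, T / 2, by linarith, by linarith, by simp⟩
  · obtain ⟨a, haC, ha⟩ := hC.exists_isLeast hne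
    obtain ⟨b, hbC, hb⟩ := hC.exists_isGreatest hne
    have h1 := (hCT haC).1
    have h2 := (hCT hbC).2
    exact ⟨a / 2, (b + T) / 2, by linarith, by linarith, fun x hx =>
      ⟨by linarith [ha hx], by linarith [hb hx]⟩⟩

theorem LocInt.integrable_mul {U : Vec n × ℝ → ℝ} (hU : LocInt Ω T U) (hT : 0 < T)
    {ψ : Vec n → ℝ} (hψ : Continuous ψ) (hψc : HasCompactSupport ψ) (hψΩ : tsupport ψ ⊆ Ω)
    {θ : ℝ → ℝ} (hθ : Continuous θ) (hθc : HasCompactSupport θ) (hθT : tsupport θ ⊆ Ioo 0 T) :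
    Integrable (fun z => θ z.2 * (ψ z.1 * U z))
      ((volume.restrict Ω).prod (volume.restrict (Ioo 0 T))) := by
  obtain ⟨α, β, hα, hβ, hsub⟩ := exists_Icc_of_isCompact hθc hθT hT
  have h1 := hU _ hψc hψΩ α β hα hβ
  obtain ⟨C, hC⟩ := hψ.bounded_above_of_compact_support hψc
  obtain ⟨C', hC'⟩ := hθ.bounded_above_of_compact_support hθc
  have h2 : IntegrableOn (fun z => θ z.2 * (ψ z.1 * U z)) (tsupport ψ ×ˢ Ioo α β) :=
    Integrable.bdd_mul (c := C') (Integrable.bdd_mul (c := C) h1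
      (hψ.comp continuous_fst).aestronglyMeasurable (Eventually.of_forall fun z => hC _))
      (hθ.comp continuous_snd).aestronglyMeasurable (Eventually.of_forall fun z => hC' _)
  have h3 : Integrable (fun z => θ z.2 * (ψ z.1 * U z)) := by
    refine IntegrableOn.integrable_of_forall_notMem_eq_zero h2 ?_
    rintro ⟨x, τ⟩ hz
    rw [mem_prod, not_and_or] at hz
    rcases hz with hz | hz
    · simp only
      rw [image_eq_zero_of_notMem_tsupport hz]
      simp
    · simp only
      rw [image_eq_zero_of_notMem_tsupport fun h => hz (hsub h)]
      simp
  rw [Measure.prod_restrict]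
  exact h3.integrableOn

theorem LocInt.integral_mul_eq {U : Vec n × ℝ → ℝ} (hU : LocInt Ω T U) (hT : 0 < T)
    {ψ : Vec n → ℝ} (hψ : Continuous ψ) (hψc : HasCompactSupport ψ) (hψΩ : tsupport ψ ⊆ Ω)
    {θ : ℝ → ℝ} (hθ : Continuous θ) (hθc : HasCompactSupport θ) (hθT : tsupport θ ⊆ Ioo 0 T) :
    ∫ z in cyl Ω T, θ z.2 * (ψ z.1 * U z) =
      ∫ τ in Ioo 0 T, θ τ * ∫ x in Ω, ψ x * U (x, τ) := by
  have hi := hU.integrable_mul hT hψ hψc hψΩ hθ hθc hθT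
  rw [cyl, Measure.volume_eq_prod, ← Measure.prod_restrict, integral_prod_symm _ hi]
  simp_rw [integral_const_mul]

theorem LocInt.integrableOn_integral {U : Vec n × ℝ → ℝ} (hU : LocInt Ω T U)
    (hΩ : MeasurableSet Ω)
    {ψ : Vec n → ℝ} (hψ : Continuous ψ) (hψc : HasCompactSupport ψ) (hψΩ : tsupport ψ ⊆ Ω)
    {α β : ℝ} (hα : 0 < α) (hβ : β < T) :
    IntegrableOn (fun τ => ∫ x in Ω, ψ x * U (x, τ)) (Ioo α β) := by
  obtain ⟨C, hC⟩ := hψ.bounded_above_of_compact_support hψc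
  have h1 : Integrable (fun z => ψ z.1 * U z)
      ((volume.restrict (tsupport ψ)).prod (volume.restrict (Ioo α β))) := by
    rw [Measure.prod_restrict]
    exact Integrable.bdd_mul (c := C) (hU _ hψc hψΩ α β hα hβ)
      (hψ.comp continuous_fst).aestronglyMeasurable (Eventually.of_forall fun z => hC _)
  have e : ∀ τ, ∫ x in Ω, ψ x * U (x, τ) = ∫ x in tsupport ψ, ψ x * U (x, τ) := by
    intro τ
    apply setIntegral_eq_of_subset_of_forall_sdiff_eq_zero hΩ hψΩ
    intro x hx
    rw [image_eq_zero_of_notMem_tsupport hx.2, zero_mul]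
  simp_rw [e]
  exact h1.integral_prod_right

theorem IsTest.hasFDerivAt_mul {ψ : Vec n → ℝ} {θ : ℝ → ℝ} (hψ : IsTest Ω ψ)
    (hθ : IsTest (Ioo 0 T) θ) (z : Vec n × ℝ) :
    HasFDerivAt (fun z : Vec n × ℝ => θ z.2 * ψ z.1)
      (θ z.2 • (fderiv ℝ ψ z.1).comp (ContinuousLinearMap.fst ℝ (Vec n) ℝ) +
        ψ z.1 • (fderiv ℝ θ z.2).comp (ContinuousLinearMap.snd ℝ (Vec n) ℝ)) z := by
  have h1 : HasFDerivAt ψ (fderiv ℝ ψ z.1) z.1 := (hψ.1.differentiable (by simp) _).hasFDerivAt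
  have h2 : HasFDerivAt θ (fderiv ℝ θ z.2) z.2 := (hθ.1.differentiable (by simp) _).hasFDerivAt
  exact (h2.comp z hasFDerivAt_snd).mul (h1.comp z hasFDerivAt_fst)

theorem IsTest.mul {ψ : Vec n → ℝ} {θ : ℝ → ℝ} (hψ : IsTest Ω ψ) (hθ : IsTest (Ioo 0 T) θ) :
    IsTest (cyl Ω T) fun z : Vec n × ℝ => θ z.2 * ψ z.1 := by
  have hsub : tsupport (fun z : Vec n × ℝ => θ z.2 * ψ z.1) ⊆ tsupport ψ ×ˢ tsupport θ := by
    apply closure_minimal _ ((isClosed_tsupport _).prod (isClosed_tsupport _))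
    intro z hz
    exact ⟨subset_tsupport _ (right_ne_zero_of_mul hz), subset_tsupport _ (left_ne_zero_of_mul hz)⟩
  exact ⟨(hθ.1.comp contDiff_snd).mul (hψ.1.comp contDiff_fst),
    (hψ.2.1.prod hθ.2.1).of_isClosed_subset (isClosed_tsupport _) hsub,
    hsub.trans (Set.prod_mono hψ.2.2 hθ.2.2)⟩

theorem IsTest.smul_single {ψ : Vec n → ℝ} {θ : ℝ → ℝ} (hψ : IsTest Ω ψ)
    (hθ : IsTest (Ioo 0 T) θ) (j : Fin N) :
    IsTest (cyl Ω T) fun z : Vec n × ℝ =>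
      (θ z.2 * ψ z.1) • (EuclideanSpace.single j 1 : Vec N) := by
  have h := hψ.mul hθ
  have hsub : tsupport (fun z : Vec n × ℝ => (θ z.2 * ψ z.1) • (EuclideanSpace.single j 1 : Vec N))
      ⊆ tsupport fun z : Vec n × ℝ => θ z.2 * ψ z.1 := by
    apply closure_mono
    intro z hz h0
    exact hz (by simp only [h0, zero_smul])
  exact ⟨h.1.smul contDiff_const, h.2.1.of_isClosed_subset (isClosed_tsupport _) hsub,
    hsub.trans h.2.2⟩

/-- The weak formulation tested with products. -/
theorem integral_deriv_mul_of_weak {u : Vec n × ℝ → Vec N} {F : Vec n × ℝ → Mat N n} (hT : 0 < T)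
    (hu : ∀ j, LocInt Ω T fun z => u z j) (hF : ∀ p, LocInt Ω T fun z => F z p)
    (hw : ∀ φ : Vec n × ℝ → Vec N, IsTest (cyl Ω T) φ →
      ∫ z in cyl Ω T, (-inner ℝ (u z) (timeDeriv φ z) + inner ℝ (F z) (spaceGrad φ z)) = 0)
    (j : Fin N) {ψ : Vec n → ℝ} (hψ : IsTest Ω ψ) {θ : ℝ → ℝ} (hθ : IsTest (Ioo 0 T) θ) :
    ∫ τ in Ioo 0 T, deriv θ τ * ∫ x in Ω, ψ x * u (x, τ) j =
      -∫ τ in Ioo 0 T, θ τ * -∑ i, ∫ x in Ω,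
        fderiv ℝ ψ x (EuclideanSpace.single i 1) * F (x, τ) (j, i) := by
  have h := hw _ (hψ.smul_single hθ j)
  have ht : ∀ z, inner ℝ (u z) (timeDeriv (fun z : Vec n × ℝ =>
      (θ z.2 * ψ z.1) • (EuclideanSpace.single j 1 : Vec N)) z) =
      deriv θ z.2 * (ψ z.1 * u z j) := by
    intro z
    rw [timeDeriv, ((hψ.hasFDerivAt_mul hθ z).smul_const _).fderiv]
    simp [inner_smul_right, EuclideanSpace.inner_single_right]
    ring
  have hx : ∀ z, inner ℝ (F z) (spaceGrad (fun z : Vec n × ℝ =>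
      (θ z.2 * ψ z.1) • (EuclideanSpace.single j 1 : Vec N)) z) =
      ∑ i, θ z.2 * (fderiv ℝ ψ z.1 (EuclideanSpace.single i 1) * F z (j, i)) := by
    intro z
    rw [spaceGrad, ((hψ.hasFDerivAt_mul hθ z).smul_const _).fderiv, PiLp.inner_apply,
      Fintype.sum_prod_type, Finset.sum_eq_single j]
    · refine Finset.sum_congr rfl fun i _ => ?_
      simp
      ring
    · intro b _ hb
      apply Finset.sum_eq_zero
      intro i _
      simp [hb]
    · simp
  have hi1 := (hu j).integrable_mul hT hψ.1.continuous hψ.2.1 hψ.2.2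
    (hθ.1.continuous_deriv (by simp)) hθ.2.1.deriv ((tsupport_deriv_subset).trans hθ.2.2)
  have hsx : ∀ i : Fin n, tsupport (fun x => fderiv ℝ ψ x (EuclideanSpace.single i 1)) ⊆ Ω :=
    fun i => (tsupport_fderiv_apply_subset ℝ _).trans hψ.2.2
  have hi2 := fun i : Fin n => (hF (j, i)).integrable_mul hT
    (hψ.continuous_partial (EuclideanSpace.single i 1)) (hψ.hasCompactSupport_partial _) (hsx i)
    hθ.1.continuous hθ.2.1 hθ.2.2
  simp_rw [ht, hx] at h
  have e1 := (hu j).integral_mul_eq hT hψ.1.continuous hψ.2.1 hψ.2.2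
    (hθ.1.continuous_deriv (by simp)) hθ.2.1.deriv ((tsupport_deriv_subset).trans hθ.2.2)
  have e2 := fun i : Fin n => (hF (j, i)).integral_mul_eq hT
    (hψ.continuous_partial (EuclideanSpace.single i 1)) (hψ.hasCompactSupport_partial _) (hsx i)
    hθ.1.continuous hθ.2.1 hθ.2.2
  have hcyl : (volume.restrict (cyl Ω T) : Measure (Vec n × ℝ)) =
      (volume.restrict Ω).prod (volume.restrict (Ioo 0 T)) := by
    rw [cyl, Measure.volume_eq_prod, Measure.prod_restrict]
  rw [hcyl] at h e1 e2
  have hi1n : Integrable (fun z : Vec n × ℝ => -(deriv θ z.2 * (ψ z.1 * u z j)))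
      ((volume.restrict Ω).prod (volume.restrict (Ioo 0 T))) := hi1.neg
  rw [integral_add hi1n (integrable_finsetSum _ fun i _ => hi2 i), integral_neg, e1,
    integral_finsetSum _ fun i _ => hi2 i] at h
  simp_rw [e2] at h
  have e3 : ∫ τ in Ioo 0 T, θ τ * -∑ i, ∫ x in Ω,
      fderiv ℝ ψ x (EuclideanSpace.single i 1) * F (x, τ) (j, i) =
      -∑ i, ∫ τ in Ioo 0 T, θ τ * ∫ x in Ω,
        fderiv ℝ ψ x (EuclideanSpace.single i 1) * F (x, τ) (j, i) := by
    rw [← integral_finsetSum, ← integral_neg]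
    · simp_rw [mul_neg, Finset.mul_sum]
    · intro i _
      refine (hi2 i).integral_prod_right.congr (Eventually.of_forall fun τ => ?_)
      simp only [integral_const_mul]
  rw [e3, neg_neg]
  linarith

end ProductTests

/-! ### Integrability of time slices -/

section Slices

variable {n : ℕ} {E : Type*} [NormedAddCommGroup E] {D : Set (Vec n)} {I : Set ℝ}

theorem ae_aestronglyMeasurable_slice {f : Vec n × ℝ → E}
    (hf : AEStronglyMeasurable f (volume.restrict (D ×ˢ I))) :
    ∀ᵐ t ∂(volume.restrict I), AEStronglyMeasurable (fun x => f (x, t)) (volume.restrict D) := by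
  rw [Measure.volume_eq_prod, ← Measure.prod_restrict] at hf
  exact hf.prod_swap.prodMk_left

theorem MemLp.ae_slice {f : Vec n × ℝ → E} {p : ℝ} (hp : 0 < p)
    (hf : MemLp f (ENNReal.ofReal p) (volume.restrict (D ×ˢ I))) :
    ∀ᵐ t ∂(volume.restrict I), MemLp (fun x => f (x, t)) (ENNReal.ofReal p)
      (volume.restrict D) := by
  have h1 := (memLp_ofReal_iff hp hf.1).1 hf
  rw [Measure.volume_eq_prod, ← Measure.prod_restrict] at h1
  filter_upwards [ae_aestronglyMeasurable_slice hf.1, h1.prod_left_ae] with t ht1 ht2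
  exact (memLp_ofReal_iff hp ht1).2 ht2

theorem MemLp.integrable_slice_norm {f : Vec n × ℝ → E} {p : ℝ} (hp : 0 < p)
    (hf : MemLp f (ENNReal.ofReal p) (volume.restrict (D ×ˢ I))) :
    IntegrableOn (fun t => ∫ x in D, ‖f (x, t)‖ ^ p) I := by
  have h1 := (memLp_ofReal_iff hp hf.1).1 hf
  rw [Measure.volume_eq_prod, ← Measure.prod_restrict] at h1
  exact h1.integral_prod_right

theorem memLp_two_iff {X : Type*} [MeasurableSpace X] {κ : Measure X} {f : X → E} :
    MemLp f 2 κ ↔ MemLp f (ENNReal.ofReal 2) κ := by simp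

theorem integrable_norm_sq {X : Type*} [MeasurableSpace X] {κ : Measure X} {f : X → E}
    (hf : MemLp f 2 κ) : Integrable (fun x => ‖f x‖ ^ 2) κ := by
  have := (memLp_ofReal_iff two_pos hf.1).1 (memLp_two_iff.1 hf)
  simpa using this

theorem integrable_slice_norm_sq {f : Vec n × ℝ → E}
    (hf : MemLp f 2 (volume.restrict (D ×ˢ I))) :
    IntegrableOn (fun t => ∫ x in D, ‖f (x, t)‖ ^ 2) I := by
  simpa using MemLp.integrable_slice_norm two_pos (memLp_two_iff.1 hf)

end Slices

/-! ### Time increments paired with a fixed spatial function -/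

section Pairing

variable {n N : ℕ} {Ω D : Set (Vec n)} {T α β : ℝ} {u : Vec n × ℝ → Vec N}
  {F : Vec n × ℝ → Mat N n}

theorem exists_good_times_of_weak (hΩ : IsOpen Ω) (hT : 0 < T)
    (hu : ∀ j, LocInt Ω T fun z => u z j) (hF : ∀ p, LocInt Ω T fun z => F z p)
    (hw : ∀ φ : Vec n × ℝ → Vec N, IsTest (cyl Ω T) φ →
      ∫ z in cyl Ω T, (-inner ℝ (u z) (timeDeriv φ z) + inner ℝ (F z) (spaceGrad φ z)) = 0) :
    ∃ S ⊆ Ioo 0 T, (∀ᵐ t, t ∈ Ioo 0 T → t ∈ S) ∧ ∀ j : Fin N, ∀ ψ : Vec n → ℝ, IsTest Ω ψ →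
      ∀ s ∈ S, ∀ t ∈ S, (∫ x in Ω, ψ x * u (x, t) j) - (∫ x in Ω, ψ x * u (x, s) j) =
        ∫ τ in s..t, -∑ i, ∫ x in Ω,
          fderiv ℝ ψ x (EuclideanSpace.single i 1) * F (x, τ) (j, i) := by
  choose S hST hS h using fun j => exists_good_times hΩ (hu j)
  refine ⟨Ioo 0 T ∩ ⋂ j, S j, inter_subset_left, ?_, ?_⟩
  · filter_upwards [ae_all_iff.2 hS] with t ht htT
    exact ⟨htT, mem_iInter.2 fun j => ht j htT⟩
  · intro j ψ hψ s hs t ht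
    refine h j ψ hψ _ (fun α' β' hα hβ => ?_)
      (fun θ hθ => integral_deriv_mul_of_weak hT hu hF hw j hψ hθ) s (mem_iInter.1 hs.2 j) t
      (mem_iInter.1 ht.2 j)
    refine Integrable.neg (integrable_finsetSum _ fun i _ => ?_)
    exact (hF (j, i)).integrableOn_integral hΩ.measurableSet
      (hψ.continuous_partial _) (hψ.hasCompactSupport_partial _)
      ((tsupport_fderiv_apply_subset ℝ _).trans hψ.2.2) hα hβ

/-- Young's inequality at each time separates the flux from the gradient of ψ. As ψ does not depend
on time, its energy merely picks up the factor |t - s|. -/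
theorem abs_integral_flux_le (hDΩ : D ⊆ Ω) (hΩ : MeasurableSet Ω)
    (hF : MemLp F 2 (volume.restrict (D ×ˢ Ioo α β))) {s t : ℝ} (hs : s ∈ Ioo α β)
    (ht : t ∈ Ioo α β) (j : Fin N) {ψ : Vec n → ℝ} (hψ : IsTest D ψ) :
    |∫ τ in s..t, -∑ i, ∫ x in Ω,
      fderiv ℝ ψ x (EuclideanSpace.single i 1) * F (x, τ) (j, i)| ≤
      |∫ τ in s..t, ∫ x in D, ‖F (x, τ)‖ ^ 2| + |t - s| * ∫ x in D, gradSq ψ x := by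
  have hsub : uIoc s t ⊆ Ioo α β :=
    uIoc_subset_uIcc.trans (ordConnected_Ioo.uIcc_subset hs ht)
  have hFi := integrable_slice_norm_sq hF
  have ii : IntervalIntegrable (fun τ => ∫ x in D, ‖F (x, τ)‖ ^ 2) volume s t := by
    rw [intervalIntegrable_iff]
    exact hFi.mono_set hsub
  have hae : ∀ᵐ τ ∂(volume.restrict (Ioo α β)),
      ‖-∑ i, ∫ x in Ω, fderiv ℝ ψ x (EuclideanSpace.single i 1) * F (x, τ) (j, i)‖ ≤
        (∫ x in D, ‖F (x, τ)‖ ^ 2) + ∫ x in D, gradSq ψ x := by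
    filter_upwards [MemLp.ae_slice two_pos (memLp_two_iff.1 hF)] with τ hτ
    rw [← memLp_two_iff] at hτ
    have hcomp : ∀ i, Integrable (fun x => (F (x, τ) (j, i)) ^ 2) (volume.restrict D) := by
      intro i
      refine Integrable.mono' (integrable_norm_sq hτ) ?_ (Eventually.of_forall fun x => ?_)
      · exact ((EuclideanSpace.proj (j, i) : Mat N n →L[ℝ] ℝ).continuous.comp_aestronglyMeasurable
          hτ.1).pow 2
      · rw [Real.norm_of_nonneg (sq_nonneg _), ← sq_abs]
        exact pow_le_pow_left₀ (abs_nonneg _) (PiLp.norm_apply_le (F (x, τ)) (j, i)) 2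
    have hgi : ∀ i, Integrable (fun x => (fderiv ℝ ψ x (EuclideanSpace.single i 1)) ^ 2)
        (volume.restrict D) := by
      intro i
      have hc := hψ.continuous_partial (EuclideanSpace.single i 1)
      have hs := hψ.hasCompactSupport_partial (EuclideanSpace.single i 1)
      simp_rw [pow_two]
      exact ((hc.mul hc).integrable_of_hasCompactSupport (hs.mul_left)).integrableOn
    rw [norm_neg]
    calc _ ≤ ∑ i, ‖∫ x in Ω, fderiv ℝ ψ x (EuclideanSpace.single i 1) * F (x, τ) (j, i)‖ :=
          norm_sum_le _ _
      _ ≤ ∑ i, ∫ x in D, ((F (x, τ) (j, i)) ^ 2 +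
            (fderiv ℝ ψ x (EuclideanSpace.single i 1)) ^ 2) := by
          refine Finset.sum_le_sum fun i _ => ?_
          rw [setIntegral_eq_of_subset_of_forall_sdiff_eq_zero hΩ hDΩ]
          · refine norm_integral_le_of_norm_le ((hcomp i).add (hgi i))
              (Eventually.of_forall fun x => ?_)
            rw [Real.norm_eq_abs, abs_le]
            constructor <;>
            nlinarith [sq_nonneg (F (x, τ) (j, i) - fderiv ℝ ψ x (EuclideanSpace.single i 1)),
              sq_nonneg (F (x, τ) (j, i) + fderiv ℝ ψ x (EuclideanSpace.single i 1))]
          · intro x hx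
            have : fderiv ℝ ψ x (EuclideanSpace.single i 1) = 0 :=
              image_eq_zero_of_notMem_tsupport (f := fun x =>
                fderiv ℝ ψ x (EuclideanSpace.single i 1))
                fun h => hx.2 (hψ.2.2 (tsupport_fderiv_apply_subset ℝ _ h))
            rw [this, zero_mul]
      _ = (∫ x in D, ∑ i, (F (x, τ) (j, i)) ^ 2) + ∫ x in D, gradSq ψ x := by
          unfold gradSq
          rw [integral_finsetSum _ fun i _ => hcomp i, integral_finsetSum _ fun i _ => hgi i,
            ← Finset.sum_add_distrib]
          exact Finset.sum_congr rfl fun i _ => integral_add (hcomp i) (hgi i)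
      _ ≤ _ := by
          refine add_le_add_left ?_ _
          refine setIntegral_mono (integrable_finsetSum _ fun i _ => hcomp i)
            (integrable_norm_sq hτ) fun x => ?_
          simp only
          rw [EuclideanSpace.real_norm_sq_eq, Fintype.sum_prod_type]
          exact Finset.single_le_sum
            (f := fun j => ∑ i, (F (x, τ) (j, i)) ^ 2)
            (fun j _ => Finset.sum_nonneg fun i _ => sq_nonneg _) (Finset.mem_univ j)
  have h1 := intervalIntegral.norm_integral_le_abs_of_norm_le (μ := volume) (a := s) (b := t)
    (ae_restrict_of_ae_restrict_of_subset hsub hae) (ii.add intervalIntegrable_const)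
  rw [Real.norm_eq_abs] at h1
  refine h1.trans ?_
  rw [intervalIntegral.integral_add ii intervalIntegrable_const,
    intervalIntegral.integral_const, smul_eq_mul]
  refine (abs_add_le _ _).trans ?_
  rw [abs_mul, abs_of_nonneg (integral_nonneg fun x => gradSq_nonneg ψ x)]

/-- The flux bound for smooth test functions survives in the limit. It is applied to components of η
u(s)^m or of u(s)^m - g(s)^m, for which only integrability of the product with u(s) - u(t) is at
hand. -/
theorem abs_pairing_le (hDΩ : D ⊆ Ω) (hΩ : MeasurableSet Ω)
    (hF : MemLp F 2 (volume.restrict (D ×ˢ Ioo α β))) {s t : ℝ} (hs : s ∈ Ioo α β)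
    (ht : t ∈ Ioo α β) (j : Fin N)
    (hst : ∀ ψ : Vec n → ℝ, IsTest Ω ψ →
      (∫ x in Ω, ψ x * u (x, t) j) - (∫ x in Ω, ψ x * u (x, s) j) =
        ∫ τ in s..t, -∑ i, ∫ x in Ω,
          fderiv ℝ ψ x (EuclideanSpace.single i 1) * F (x, τ) (j, i))
    (hus : IntegrableOn (fun x => u (x, s) j) D) (hut : IntegrableOn (fun x => u (x, t) j) D)
    {φ : Vec n → ℝ} (hφ : IntegrableOn (fun x => φ x * (u (x, s) j - u (x, t) j)) D)
    {φs : ℕ → Vec n → ℝ} {Rs : ℕ → ℝ} {R : ℝ} (hφs : ∀ k, IsTest D (φs k))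
    (hlim : ∀ᵐ x ∂(volume.restrict D), Tendsto (fun k => φs k x) atTop (𝓝 (φ x)))
    (hRs : ∀ k, ∫ x in D, gradSq (φs k) x ≤ Rs k) (hR : Tendsto Rs atTop (𝓝 R)) :
    |∫ x in D, φ x * (u (x, s) j - u (x, t) j)| ≤
      |∫ τ in s..t, ∫ x in D, ‖F (x, τ)‖ ^ 2| + |t - s| * R := by
  refine abs_integral_mul_le_of_tendsto (abs_nonneg _) (hus.sub hut) (fun ψ hψ => ?_) hφ hφs hlim
    hRs hR
  refine le_trans (le_of_eq ?_) (abs_integral_flux_le hDΩ hΩ hF hs ht j hψ)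
  rw [← hst ψ ⟨hψ.1, hψ.2.1, hψ.2.2.trans hDΩ⟩, abs_sub_comm]
  congr 1
  have hz : ∀ τ, ∫ x in Ω, ψ x * u (x, τ) j = ∫ x in D, ψ x * u (x, τ) j := by
    intro τ
    refine setIntegral_eq_of_subset_of_forall_sdiff_eq_zero hΩ hDΩ fun x hx => ?_
    rw [image_eq_zero_of_notMem_tsupport fun h => hx.2 (hψ.2.2 h), zero_mul]
  obtain ⟨C, hC⟩ := hψ.1.continuous.bounded_above_of_compact_support hψ.2.1
  rw [hz, hz, ← integral_sub]
  · simp only [mul_sub]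
  · exact Integrable.bdd_mul (c := C) hus hψ.1.continuous.aestronglyMeasurable
      (Eventually.of_forall fun x => hC x)
  · exact Integrable.bdd_mul (c := C) hut hψ.1.continuous.aestronglyMeasurable
      (Eventually.of_forall fun x => hC x)

end Pairing

/-! ### Cutoffs, the Leibniz rule and integrability of u -/

section WeakGradient

variable {n N : ℕ} {Ω : Set (Vec n)}

theorem exists_cutoff {K D : Set (Vec n)} (hK : IsCompact K) (hD : IsOpen D) (hKD : K ⊆ D) :
    ∃ η : Vec n → ℝ, IsTest D η ∧ (∀ x ∈ K, η x = 1) ∧ ∀ x, η x ∈ Icc (0 : ℝ) 1 := by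
  obtain ⟨K', hK', hKK', hK'D⟩ := exists_compact_between hK hD hKD
  obtain ⟨f, hf1, hf0, hf⟩ := exists_contMDiffMap_one_nhds_of_subset_interior
    (n := ⊤) (modelWithCornersSelf ℝ (Vec n)) hK.isClosed hKK'
  have hsub : tsupport f ⊆ K' := by
    apply closure_minimal _ hK'.isClosed
    intro x hx
    by_contra h
    exact hx (hf0 x h)
  exact ⟨f, ⟨f.contMDiff.contDiff, hK'.of_isClosed_subset (isClosed_tsupport _) hsub,
    hsub.trans hK'D⟩, fun x hx => hf1.self_of_nhdsSet x hx, hf⟩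

theorem locallyIntegrableOn_apply {ι : Type*} [Fintype ι] {f : Vec n → EuclideanSpace ℝ ι}
    (hf : LocallyIntegrableOn f Ω) (j : ι) : LocallyIntegrableOn (fun x => f x j) Ω := by
  intro x hx
  obtain ⟨s, hs, h⟩ := hf x hx
  exact ⟨s, hs, (EuclideanSpace.proj j : EuclideanSpace ℝ ι →L[ℝ] ℝ).integrable_comp h⟩

theorem integrable_mul_of_locallyIntegrableOn {f η : Vec n → ℝ} (hf : LocallyIntegrableOn f Ω)
    (hη : Continuous η) (hηc : HasCompactSupport η) (hηΩ : tsupport η ⊆ Ω) :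
    Integrable fun x => η x * f x := by
  obtain ⟨C, hC⟩ := hη.bounded_above_of_compact_support hηc
  have h1 : IntegrableOn f (tsupport η) := hf.integrableOn_compact_subset hηΩ hηc
  refine IntegrableOn.integrable_of_forall_notMem_eq_zero (s := tsupport η)
    (Integrable.bdd_mul (c := C) h1 hη.aestronglyMeasurable (Eventually.of_forall hC))
    fun x hx => ?_
  rw [image_eq_zero_of_notMem_tsupport hx, zero_mul]

/-- The Leibniz rule for the product of a weakly differentiable function and a cutoff. -/
theorem IsWeakGrad.mul_cutoff {f : Vec n → Vec N} {G : Vec n → Mat N n}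
    (h : IsWeakGrad Ω f G) {η : Vec n → ℝ} (hη : IsTest Ω η) (j : Fin N) (i : Fin n)
    {ζ : Vec n → ℝ} (hζ : ContDiff ℝ ∞ ζ) :
    ∫ x, η x * f x j * fderiv ℝ ζ x (EuclideanSpace.single i 1) =
      -∫ x, (η x * G x (j, i) + fderiv ℝ η x (EuclideanSpace.single i 1) * f x j) * ζ x := by
  obtain ⟨hf, hG, hw⟩ := h
  set e : Vec n := EuclideanSpace.single i 1
  have hf' := locallyIntegrableOn_apply hf j
  have hG' := locallyIntegrableOn_apply hG (j, i)
  have htest : IsTest Ω fun x => η x * ζ x := by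
    have hsub : tsupport (fun x => η x * ζ x) ⊆ tsupport η := by
      apply closure_mono
      intro x hx
      exact left_ne_zero_of_mul hx
    exact ⟨hη.1.mul hζ, hη.2.1.of_isClosed_subset (isClosed_tsupport _) hsub, hsub.trans hη.2.2⟩
  have hd : ∀ x, fderiv ℝ (fun x => η x * ζ x) x e =
      η x * fderiv ℝ ζ x e + fderiv ℝ η x e * ζ x := by
    intro x
    have h1 : HasFDerivAt η (fderiv ℝ η x) x := (hη.1.differentiable (by simp) _).hasFDerivAt
    have h2 : HasFDerivAt ζ (fderiv ℝ ζ x) x := (hζ.differentiable (by simp) _).hasFDerivAt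
    rw [(h1.fun_mul h2).fderiv]
    simp [mul_comm]
  have hcζ : Continuous fun x => fderiv ℝ ζ x e :=
    (hζ.continuous_fderiv (by simp)).clm_apply continuous_const
  have hcη := hη.continuous_partial e
  have hz : ∀ x ∉ tsupport η, fderiv ℝ η x e = 0 := fun x hx =>
    image_eq_zero_of_notMem_tsupport (f := fun x => fderiv ℝ η x e)
      fun h => hx (tsupport_fderiv_apply_subset ℝ _ h)
  have sub1 : ∀ {g : Vec n → ℝ}, Continuous g → tsupport (fun x => η x * g x) ⊆ tsupport η := by
    intro g _
    apply closure_mono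
    intro x hx
    exact left_ne_zero_of_mul hx
  have sub2 : tsupport (fun x => fderiv ℝ η x e * ζ x) ⊆ tsupport η := by
    apply closure_minimal _ (isClosed_tsupport _)
    intro x hx
    by_contra h
    exact hx (by simp [hz x h])
  have i1 := integrable_mul_of_locallyIntegrableOn (η := fun x => η x * fderiv ℝ ζ x e)
    hf' (hη.1.continuous.mul hcζ)
    (hη.2.1.of_isClosed_subset (isClosed_tsupport _) (sub1 hcζ)) ((sub1 hcζ).trans hη.2.2)
  have i2 := integrable_mul_of_locallyIntegrableOn (η := fun x => fderiv ℝ η x e * ζ x)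
    hf' (hcη.mul hζ.continuous)
    (hη.2.1.of_isClosed_subset (isClosed_tsupport _) sub2) (sub2.trans hη.2.2)
  have i3 := integrable_mul_of_locallyIntegrableOn (η := fun x => η x * ζ x)
    hG' (hη.1.continuous.mul hζ.continuous)
    (hη.2.1.of_isClosed_subset (isClosed_tsupport _) (sub1 hζ.continuous))
    ((sub1 hζ.continuous).trans hη.2.2)
  have hw' : ∫ x in Ω, f x j * fderiv ℝ (fun x => η x * ζ x) x e =
      -∫ x in Ω, G x (j, i) * (η x * ζ x) := hw _ htest j i
  rw [setIntegral_eq_integral_of_forall_compl_eq_zero,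
    setIntegral_eq_integral_of_forall_compl_eq_zero] at hw'
  · simp_rw [hd] at hw'
    have e1 : ∫ x, f x j * (η x * fderiv ℝ ζ x e + fderiv ℝ η x e * ζ x) =
        (∫ x, η x * fderiv ℝ ζ x e * f x j) + ∫ x, fderiv ℝ η x e * ζ x * f x j := by
      rw [← integral_add i1 i2]
      congr 1 with x
      ring
    have e2 : ∫ x, (η x * G x (j, i) + fderiv ℝ η x e * f x j) * ζ x =
        (∫ x, η x * ζ x * G x (j, i)) + ∫ x, fderiv ℝ η x e * ζ x * f x j := by
      rw [← integral_add i3 i2]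
      congr 1 with x
      ring
    have e3 : ∫ x, η x * f x j * fderiv ℝ ζ x e = ∫ x, η x * fderiv ℝ ζ x e * f x j := by
      congr 1 with x
      ring
    have e4 : ∫ x, G x (j, i) * (η x * ζ x) = ∫ x, η x * ζ x * G x (j, i) := by
      congr 1 with x
      ring
    rw [e2, e3]
    rw [e1, e4] at hw'
    linarith
  · intro x hx
    rw [image_eq_zero_of_notMem_tsupport fun h => hx (hη.2.2 h)]
    ring
  · intro x hx
    have hx' : x ∉ tsupport η := fun h => hx (hη.2.2 h)
    rw [hd, image_eq_zero_of_notMem_tsupport hx', hz x hx']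
    ring

/-- For m ≥ 1 one has m + 1 ≤ 2m, so |u|^{m+1} ≤ 1 + |u|^{2m}. For m < 1 this fails, which is why
integrability of u is then part of the notion of solution. -/
theorem memLp_of_memLp_spow {X : Type*} [MeasurableSpace X] {κ : Measure X} [IsFiniteMeasure κ]
    {m : ℝ} (hm : 1 ≤ m) {u : X → Vec N} (hu : AEStronglyMeasurable u κ)
    (h : MemLp (fun x => spow m (u x)) 2 κ) : MemLp u (ENNReal.ofReal (m + 1)) κ := by
  rw [memLp_ofReal_iff (by linarith) hu]
  refine Integrable.mono' ((integrable_const (1 : ℝ)).add (integrable_norm_sq h))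
    ((hu.norm.aemeasurable.pow_const _).aestronglyMeasurable) (Eventually.of_forall fun x => ?_)
  have h0 := norm_nonneg (u x)
  rw [Real.norm_of_nonneg (Real.rpow_nonneg h0 _)]
  simp only [Pi.add_apply]
  rw [norm_spow (by linarith), ← Real.rpow_natCast, ← Real.rpow_mul h0]
  rcases le_total ‖u x‖ 1 with h1 | h1
  · have := Real.rpow_le_one h0 h1 (by linarith : 0 ≤ m + 1)
    have := Real.rpow_nonneg h0 (m * ((2 : ℕ) : ℝ))
    linarith
  · have := Real.rpow_le_rpow_of_exponent_le h1
      (by push_cast; linarith : m + 1 ≤ m * ((2 : ℕ) : ℝ))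
    linarith

variable {T m : ℝ} {A : Vec n × ℝ → Vec N → Mat N n → Mat N n}

theorem aestronglyMeasurable_of_subset_cyl {K : Set (Vec n × ℝ)} {E : Type*} [NormedAddCommGroup E]
    {f : Vec n × ℝ → E} (hf : AEStronglyMeasurable f (volume.restrict (cyl Ω T)))
    (hK : K ⊆ cyl Ω T) : AEStronglyMeasurable f (volume.restrict K) :=
  hf.mono_measure (Measure.restrict_mono hK le_rfl)

theorem IsWeakSolution.memLpLoc {u : Vec n × ℝ → Vec N} (hu : IsWeakSolution m Ω T A u) :
    MemLpLoc (ENNReal.ofReal (m + 1)) (cyl Ω T) u := by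
  obtain ⟨hmeas, hlt, G, ⟨hw, -, -⟩, -⟩ := hu
  rcases lt_or_ge m 1 with h | h
  · exact hlt h
  · intro K hK hKc
    have : IsFiniteMeasure (volume.restrict K) := ⟨by simpa using hK.measure_lt_top⟩
    exact memLp_of_memLp_spow h (aestronglyMeasurable_of_subset_cyl hmeas hKc) (hw K hK hKc)

end WeakGradient

/-! ### Interior estimate for local solutions -/

section Local

variable {n N : ℕ} {Ω : Set (Vec n)} {T m ν L μ : ℝ}
  {A : Vec n × ℝ → Vec N → Mat N n → Mat N n} {u : Vec n × ℝ → Vec N}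

theorem real_inner_eq_sum {ι : Type*} [Fintype ι] (a b : EuclideanSpace ℝ ι) :
    inner ℝ a b = ∑ j, a j * b j := by
  simp [PiLp.inner_apply, mul_comm]

theorem integrable_spow_apply_mul {X : Type*} [MeasurableSpace X] {κ : Measure X} (hm : 0 < m)
    {f d : X → Vec N} (hf : MemLp f (ENNReal.ofReal (m + 1)) κ)
    (hd : MemLp d (ENNReal.ofReal (m + 1)) κ) (j : Fin N) :
    Integrable (fun x => spow m (f x) j * d x j) κ := by
  refine Integrable.mono' ((MemLp.integrable_rpow hm hf).add (MemLp.integrable_rpow hm hd)) ?_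
    (Eventually.of_forall fun x => ?_)
  · exact (((EuclideanSpace.proj j : Vec N →L[ℝ] ℝ).continuous.comp
      (continuous_spow hm)).comp_aestronglyMeasurable hf.1).mul
      ((EuclideanSpace.proj j : Vec N →L[ℝ] ℝ).continuous.comp_aestronglyMeasurable hd.1)
  · rw [norm_mul]
    exact (mul_le_mul (PiLp.norm_apply_le _ j) (PiLp.norm_apply_le _ j) (norm_nonneg _)
      (norm_nonneg _)).trans (norm_spow_mul_norm_le hm _ _)

theorem memLp_apply {ι X : Type*} [Fintype ι] [MeasurableSpace X] {κ : Measure X} {p : ℝ≥0∞}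
    {f : X → EuclideanSpace ℝ ι} (hf : MemLp f p κ) (j : ι) : MemLp (fun x => f x j) p κ :=
  (EuclideanSpace.proj j : EuclideanSpace ℝ ι →L[ℝ] ℝ).comp_memLp' hf

theorem MemLp.bounded_mul {X : Type*} [MeasurableSpace X] {κ : Measure X} {p : ℝ≥0∞}
    {f η : X → ℝ} (hf : MemLp f p κ) (hη : AEStronglyMeasurable η κ) {C : ℝ}
    (hC : ∀ x, ‖η x‖ ≤ C) : MemLp (fun x => η x * f x) p κ := by
  refine hf.of_le_mul (c := C) (hη.mul hf.1) (Eventually.of_forall fun x => ?_)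
  rw [norm_mul]
  exact mul_le_mul_of_nonneg_right (hC x) (norm_nonneg _)

/-- Interior time continuity, on a fixed compact subcylinder. -/
theorem IsWeakSolution.exists_cauchy (hm : 0 < m) (hΩ : IsOpen Ω) (hT : 0 < T)
    (hA : IsAdmissible Ω T ν L μ A) (hu : IsWeakSolution m Ω T A u) {K : Set (Vec n)}
    (hK : IsCompact K) (hKΩ : K ⊆ Ω) {α β : ℝ} (hα : 0 < α) (hαβ : α < β) (hβ : β < T) :
    ∃ S ⊆ Ioo α β, (∀ᵐ t, t ∈ Ioo α β → t ∈ S) ∧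
      (∀ t ∈ S, MemLp (fun x => u (x, t)) (ENNReal.ofReal (m + 1)) (volume.restrict K)) ∧
      ∀ t₀ ∈ Icc α β, ∀ ε > 0, ∃ δ > 0, ∀ t ∈ S, ∀ t' ∈ S, |t - t₀| < δ → |t' - t₀| < δ →
        ∫ x in K, ‖u (x, t) - u (x, t')‖ ^ (m + 1) ≤ ε := by
  have huLoc := hu.memLpLoc
  obtain ⟨hmeas, -, G, ⟨hw, hG, hgrad⟩, hweak⟩ := hu
  have hp1 : (1 : ℝ≥0∞) ≤ ENNReal.ofReal (m + 1) := by
    rw [← ENNReal.ofReal_one]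
    exact ENNReal.ofReal_le_ofReal (by linarith)
  set F : Vec n × ℝ → Mat N n := fun z => A z (u z) (G z) with hFdef
  have hF : MemLpLoc 2 (cyl Ω T) F := fun Q hQ hQc => hA.memLp_flux hQc hmeas (hG Q hQ hQc)
  obtain ⟨S₀, hS₀T, hS₀, hS₀eq⟩ := exists_good_times_of_weak hΩ hT
    (fun j => huLoc.locInt hp1 j) (fun p => hF.locInt (by norm_num) p) hweak
  -- The cutoff lives in the open set D between K and K'. On D × (α,β) all quantities that are
  -- locally integrable in Ω_T become integrable.
  obtain ⟨K', hK', hKK', hK'Ω⟩ := exists_compact_between hK hΩ hKΩ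
  set D := interior K' with hDdef
  have hD : IsOpen D := isOpen_interior
  have hDK' : D ⊆ K' := interior_subset
  have hDΩ : D ⊆ Ω := hDK'.trans hK'Ω
  obtain ⟨η, hη, hη1, hη01⟩ := exists_cutoff hK hD hKK'
  have hηΩ : IsTest Ω η := ⟨hη.1, hη.2.1, hη.2.2.trans hDΩ⟩
  have hηabs : ∀ x, ‖η x‖ ≤ 1 := fun x => by
    rw [Real.norm_of_nonneg (hη01 x).1]
    exact (hη01 x).2
  have hle : volume.restrict (D ×ˢ Ioo α β) ≤ volume.restrict (K' ×ˢ Ioo α β) :=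
    Measure.restrict_mono (Set.prod_mono hDK' le_rfl) le_rfl
  have huQ := (huLoc.memLp_prod hK' hK'Ω hα hβ).mono_measure hle
  have hwQ := (hw.memLp_prod hK' hK'Ω hα hβ).mono_measure hle
  have hGQ := (hG.memLp_prod hK' hK'Ω hα hβ).mono_measure hle
  have hFQ := (hF.memLp_prod hK' hK'Ω hα hβ).mono_measure hle
  have hDfin : IsFiniteMeasure (volume.restrict D) :=
    ⟨by simpa using (measure_mono hDK').trans_lt hK'.measure_lt_top⟩
  -- the gradient of the localized power
  set H : Fin N → Fin n → Vec n × ℝ → ℝ := fun j i z => η z.1 * G z (j, i) +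
    fderiv ℝ η z.1 (EuclideanSpace.single i 1) * spow m (u z) j with hHdef
  have hHQ : ∀ j i, MemLp (H j i) 2 (volume.restrict (D ×ˢ Ioo α β)) := by
    intro j i
    obtain ⟨C, hC⟩ := (hη.continuous_partial
      (EuclideanSpace.single i 1)).bounded_above_of_compact_support
      (hη.hasCompactSupport_partial _)
    exact (MemLp.bounded_mul (memLp_apply hGQ (j, i))
      (hη.1.continuous.comp continuous_fst).aestronglyMeasurable fun z => hηabs z.1).add
      (MemLp.bounded_mul (memLp_apply hwQ j)
        ((hη.continuous_partial _).comp continuous_fst).aestronglyMeasurable fun z => hC z.1)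
  have hH0 : ∀ j i t, ∀ x ∉ D, H j i (x, t) = 0 := by
    intro j i t x hx
    have hx' : x ∉ tsupport η := fun h => hx (hη.2.2 h)
    have hz : fderiv ℝ η x (EuclideanSpace.single i 1) = 0 :=
      image_eq_zero_of_notMem_tsupport (f := fun x => fderiv ℝ η x (EuclideanSpace.single i 1))
        fun h => hx' (tsupport_fderiv_apply_subset ℝ _ h)
    simp [hHdef, hz, image_eq_zero_of_notMem_tsupport hx']
  set S : Set ℝ := {t | t ∈ S₀ ∧ t ∈ Ioo α β ∧
    MemLp (fun x => u (x, t)) (ENNReal.ofReal (m + 1)) (volume.restrict D) ∧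
    IsWeakGrad Ω (fun x => spow m (u (x, t))) (fun x => G (x, t)) ∧
    ∀ j i, MemLp (fun x => H j i (x, t)) 2 (volume.restrict D)} with hSdef
  have hIT : Ioo α β ⊆ Ioo 0 T := Ioo_subset_Ioo hα.le hβ.le
  have hSfull : ∀ᵐ t, t ∈ Ioo α β → t ∈ S := by
    have h1 := (ae_restrict_iff' measurableSet_Ioo).1 (MemLp.ae_slice (by linarith) huQ)
    have h2 := (ae_restrict_iff' measurableSet_Ioo).1 hgrad
    have h3 : ∀ᵐ t, ∀ j i, t ∈ Ioo α β → MemLp (fun x => H j i (x, t)) 2 (volume.restrict D) := by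
      refine ae_all_iff.2 fun j => ae_all_iff.2 fun i => ?_
      have := (ae_restrict_iff' measurableSet_Ioo).1
        (MemLp.ae_slice two_pos (memLp_two_iff.1 (hHQ j i)))
      simpa using this
    filter_upwards [hS₀, h1, h2, h3] with t k0 k1 k2 k3 ht
    exact ⟨k0 (hIT ht), ht, k1 ht, k2 (hIT ht), fun j i => k3 j i ht⟩
  -- The weight turns the pairing of u(s)^m with u(s) - u(t) into a pairing with η u(s)^m, which has
  -- compact support in D and can be mollified to test functions.
  set κ : Measure (Vec n) := (volume.restrict D).withDensity fun x => ((η x).toNNReal : ℝ≥0∞)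
    with hκ
  have hκle : κ ≤ volume.restrict D := by
    calc κ ≤ (volume.restrict D).withDensity 1 := by
          apply withDensity_mono
          refine Eventually.of_forall fun x => ?_
          simpa using (hη01 x).2
      _ = _ := withDensity_one
  have hηm : Measurable fun x => (η x).toNNReal := hη.1.continuous.measurable.real_toNNReal
  have hκint : ∀ f : Vec n → ℝ, ∫ x, f x ∂κ = ∫ x in D, η x * f x := by
    intro f
    rw [hκ, integral_withDensity_eq_integral_smul hηm]
    refine integral_congr_ae (Eventually.of_forall fun x => ?_)
    simp only [NNReal.smul_def, smul_eq_mul, Real.coe_toNNReal _ (hη01 x).1]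
  set a₀ : ℝ → ℝ := fun τ => ∫ x in D, ‖F (x, τ)‖ ^ 2 with ha₀
  have ha₀0 : ∀ t, 0 ≤ a₀ t := fun t => integral_nonneg fun x => sq_nonneg _
  have ha₀i : IntegrableOn a₀ (Ioo α β) := integrable_slice_norm_sq hFQ
  set b : ℝ → ℝ := fun t => ∑ j, ∑ i, ∫ x in D, H j i (x, t) ^ 2 with hb
  have hb0 : ∀ t, 0 ≤ b t := fun t => Finset.sum_nonneg fun j _ => Finset.sum_nonneg fun i _ =>
    integral_nonneg fun x => sq_nonneg _
  have hbi : IntegrableOn b (Ioo α β) := by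
    refine integrable_finsetSum _ fun j _ => integrable_finsetSum _ fun i _ => ?_
    have h := integrable_slice_norm_sq (hHQ j i)
    simp only [Real.norm_eq_abs, sq_abs] at h
    exact h
  have hEi : IntegrableOn (fun t => ∫ x, ‖u (x, t)‖ ^ (m + 1) ∂κ) (Ioo α β) := by
    simp_rw [hκint]
    have h1 := (memLp_ofReal_iff (by linarith) huQ.1).1 huQ
    have h2 : Integrable (fun z : Vec n × ℝ => η z.1 * ‖u z‖ ^ (m + 1))
        ((volume.restrict D).prod (volume.restrict (Ioo α β))) := by
      rw [Measure.prod_restrict]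
      exact Integrable.bdd_mul (c := 1) h1
        (hη.1.continuous.comp continuous_fst).aestronglyMeasurable
        (Eventually.of_forall fun z => hηabs z.1)
    exact h2.integral_prod_right
  have huκ : ∀ t ∈ S, MemLp (fun x => u (x, t)) (ENNReal.ofReal (m + 1)) κ := fun t ht =>
    ht.2.2.1.mono_measure hκle
  -- With g = 0 the Bregman distance to g is |u|^{m+1}/(m+1) and the second pairing vanishes. The
  -- factor N in `a` comes from summing the componentwise bounds.
  obtain ⟨S', hS'S, hS', hcau⟩ := exists_cauchy_of_energy (κ := κ) hm hαβ
    (u := fun t x => u (x, t)) (g := fun _ _ => 0) (S := S) (a := fun τ => N * a₀ τ) (b := b)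
    (M := 0) hSfull huκ (fun t _ => MemLp.zero) (fun t => mul_nonneg (Nat.cast_nonneg _) (ha₀0 t))
    hb0 (ha₀i.const_mul _) hbi hEi
    (by
      have : ∀ v : Vec N, bdryTerm m v 0 = 1 / (m + 1) * ‖v‖ ^ (m + 1) := fun v => by
        simp [bdryTerm, spow_zero, Real.zero_rpow (by linarith : m + 1 ≠ 0)]
      simp_rw [this, integral_const_mul]
      exact hEi.const_mul _)
    (fun t _ => by simp [Real.zero_rpow (by linarith : m + 1 ≠ 0)])
    (by
      intro s hs t ht
      obtain ⟨hs0, hsI, hsu, hsg, hsH⟩ := hs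
      obtain ⟨ht0, htI, htu, -, -⟩ := ht
      have hintg : ∀ j, IntegrableOn (fun x => η x * spow m (u (x, s)) j *
          (u (x, s) j - u (x, t) j)) D := by
        intro j
        have h1 := integrable_spow_apply_mul hm hsu (hsu.sub htu) j
        refine (Integrable.bdd_mul (c := 1) h1 hη.1.continuous.aestronglyMeasurable
          (Eventually.of_forall hηabs)).congr (Eventually.of_forall fun x => ?_)
        simp [mul_assoc]
      have hj : ∀ j, |∫ x in D, η x * spow m (u (x, s)) j * (u (x, s) j - u (x, t) j)| ≤
          |∫ τ in s..t, a₀ τ| + |t - s| * ∑ i, ∫ x in D, H j i (x, s) ^ 2 := by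
        intro j
        have hHi : ∀ i, Integrable fun x => H j i (x, s) := fun i =>
          IntegrableOn.integrable_of_forall_notMem_eq_zero (s := D)
            ((hsH j i).integrable (by norm_num)) (hH0 j i s)
        have hH2 : ∀ i, Integrable fun x => H j i (x, s) ^ 2 := fun i =>
          IntegrableOn.integrable_of_forall_notMem_eq_zero (s := D)
            (by
              have h := integrable_norm_sq (hsH j i)
              simp only [Real.norm_eq_abs, sq_abs] at h
              exact h)
            (fun x hx => by simp [hH0 j i s x hx])
        obtain ⟨φ, hφ, hφlim, hφle⟩ := exists_test_tendsto hD hη.2.1 hη.2.2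
          (v := fun x => η x * spow m (u (x, s)) j) (H := fun i x => H j i (x, s))
          (integrable_mul_of_locallyIntegrableOn (locallyIntegrableOn_apply hsg.1 j)
            hη.1.continuous hη.2.1 (hη.2.2.trans hDΩ))
          (fun x hx => by simp [image_eq_zero_of_notMem_tsupport hx]) hHi hH2
          (fun i ζ hζ => hsg.mul_cutoff hηΩ j i hζ)
        have e : ∀ i, ∫ x, H j i (x, s) ^ 2 = ∫ x in D, H j i (x, s) ^ 2 := fun i =>
          (setIntegral_eq_integral_of_forall_compl_eq_zero
            fun x hx => by simp [hH0 j i s x hx]).symm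
        simp_rw [e] at hφle
        exact abs_pairing_le hDΩ hΩ.measurableSet hFQ hsI htI j
          (fun ψ hψ => hS₀eq j ψ hψ s hs0 t ht0)
          ((memLp_apply hsu j).integrable hp1) ((memLp_apply htu j).integrable hp1)
          (hintg j) hφ (ae_restrict_of_ae hφlim) hφle tendsto_const_nhds
      rw [hκint]
      have e : ∫ x in D, η x * inner ℝ (spow m (u (x, s)) - spow m (0 : Vec N))
          (u (x, s) - u (x, t)) =
          ∑ j, ∫ x in D, η x * spow m (u (x, s)) j * (u (x, s) j - u (x, t) j) := by
        rw [← integral_finsetSum _ fun j _ => hintg j]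
        refine integral_congr_ae (Eventually.of_forall fun x => ?_)
        simp only [spow_zero, sub_zero, real_inner_eq_sum, Finset.mul_sum, PiLp.sub_apply,
          mul_assoc]
      rw [e]
      calc _ ≤ ∑ j, |∫ x in D, η x * spow m (u (x, s)) j * (u (x, s) j - u (x, t) j)| :=
            Finset.abs_sum_le_sum_abs _ _
        _ ≤ ∑ j : Fin N, (|∫ τ in s..t, a₀ τ| + |t - s| * ∑ i, ∫ x in D, H j i (x, s) ^ 2) :=
            Finset.sum_le_sum fun j _ => hj j
        _ = _ := by
            rw [Finset.sum_add_distrib, ← Finset.mul_sum, intervalIntegral.integral_const_mul,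
              abs_mul, Nat.abs_cast]
            simp [hb])
    (by
      intro s hs t ht f hf
      simp only [sub_self, inner_zero_left, integral_zero, abs_zero]
      have : 0 ≤ ∫ x, ‖f x‖ ^ (m + 1) ∂κ :=
        integral_nonneg fun x => Real.rpow_nonneg (norm_nonneg _) _
      positivity)
  have huK : ∀ t ∈ S', MemLp (fun x => u (x, t)) (ENNReal.ofReal (m + 1)) (volume.restrict D) :=
    fun t ht => (hS'S ht).1.2.2.1
  refine ⟨S', fun t ht => (hS'S ht).2, hS', fun t ht =>
    (huK t ht).mono_measure (Measure.restrict_mono hKK' le_rfl), fun t₀ ht₀ ε hε => ?_⟩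
  obtain ⟨δ, hδ, h⟩ := hcau t₀ ht₀ ε hε
  refine ⟨δ, hδ, fun t ht t' ht' h1 h2 => le_trans ?_ (h t ht t' ht' h1 h2)⟩
  rw [hκint]
  have hnn : ∀ x, 0 ≤ η x * ‖u (x, t) - u (x, t')‖ ^ (m + 1) := fun x =>
    mul_nonneg (hη01 x).1 (Real.rpow_nonneg (norm_nonneg _) _)
  calc ∫ x in K, ‖u (x, t) - u (x, t')‖ ^ (m + 1)
      = ∫ x in K, η x * ‖u (x, t) - u (x, t')‖ ^ (m + 1) :=
        setIntegral_congr_fun hK.measurableSet fun x hx => by simp [hη1 x hx]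
    _ ≤ _ := by
        refine setIntegral_mono_set ?_ (Eventually.of_forall hnn) hKK'.eventuallyLE
        exact Integrable.bdd_mul (c := 1)
          (MemLp.integrable_rpow hm ((huK t ht).sub (huK t' ht')))
          hη.1.continuous.aestronglyMeasurable (Eventually.of_forall hηabs)

end Local

/-! ### The representative in C((0,T); L^{m+1}_loc) -/

section Representative

variable {n N : ℕ} {Ω : Set (Vec n)} {T m ν L μ : ℝ}
  {A : Vec n × ℝ → Vec N → Mat N n → Mat N n} {u : Vec n × ℝ → Vec N}

/-- The threshold is the p-th power of ε, with ε cut at 1 to stay finite. It depends neither on the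
function nor on the measure. -/
theorem exists_eLpNorm_le_of_integral_le {p : ℝ} (hp : 0 < p) {ε : ℝ≥0∞} (hε : 0 < ε) :
    ∃ δ > 0, ∀ {X : Type} [MeasurableSpace X] {κ : Measure X} {f : X → Vec N},
      MemLp f (ENNReal.ofReal p) κ → ∫ x, ‖f x‖ ^ p ∂κ ≤ δ →
        eLpNorm f (ENNReal.ofReal p) κ ≤ ε := by
  have hm1 : min ε 1 ≠ ⊤ := (min_le_right ε 1).trans_lt ENNReal.one_lt_top |>.ne
  have hm0 : 0 < (min ε 1).toReal := ENNReal.toReal_pos (by simp [hε.ne']) hm1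
  refine ⟨(min ε 1).toReal ^ p, Real.rpow_pos_of_pos hm0 _, ?_⟩
  intro X _ κ f hf h
  rw [hf.eLpNorm_eq_integral_rpow_norm (by simpa using hp) ENNReal.ofReal_ne_top,
    ENNReal.toReal_ofReal hp.le]
  refine le_trans ?_ (min_le_left ε 1)
  rw [← ENNReal.ofReal_toReal hm1]
  refine ENNReal.ofReal_le_ofReal ?_
  calc _ ≤ ((min ε 1).toReal ^ p) ^ p⁻¹ :=
        Real.rpow_le_rpow (integral_nonneg fun x => Real.rpow_nonneg (norm_nonneg _) _) h
          (by positivity)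
    _ = _ := Real.rpow_rpow_inv hm0.le hp.ne'

/-- A set of full measure meets every nonempty open subset of the interval. The density includes the
endpoints, which gives the values at times 0 and T. -/
theorem Icc_subset_closure_of_ae {α β : ℝ} (hαβ : α < β) {S : Set ℝ}
    (hS : ∀ᵐ t, t ∈ Ioo α β → t ∈ S) : Icc α β ⊆ closure S := by
  rw [← closure_Ioo hαβ.ne]
  refine closure_minimal (fun t ht => ?_) isClosed_closure
  rw [mem_closure_iff]
  intro o ho hto
  have hpos : 0 < volume (o ∩ Ioo α β) :=
    (ho.inter isOpen_Ioo).measure_pos _ ⟨t, hto, ht⟩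
  by_contra hne
  rw [not_nonempty_iff_eq_empty] at hne
  refine hpos.ne' (measure_mono_null (fun x hx => ?_) (ae_iff.1 hS))
  simp only [mem_ofPred_eq, Classical.not_imp]
  exact ⟨hx.2, fun h => (hne ▸ (⟨hx.1, h⟩ : x ∈ o ∩ S) : x ∈ (∅ : Set ℝ))⟩

theorem ae_eq_cyl_of_slices {S : Set ℝ} (hS : ∀ᵐ t, t ∈ Ioo 0 T → t ∈ S)
    (hΩ : MeasurableSet Ω) {v : Vec n × ℝ → Vec N}
    (hv : ∀ t ∈ S, ∀ x, v (x, t) = u (x, t)) : v =ᵐ[volume.restrict (cyl Ω T)] u := by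
  have h : ∀ᵐ z : Vec n × ℝ, z.2 ∈ Ioo 0 T → z.2 ∈ S := by
    rw [Measure.volume_eq_prod]
    exact Measure.quasiMeasurePreserving_snd.ae hS
  filter_upwards [ae_restrict_of_ae h, ae_restrict_mem (hΩ.prod measurableSet_Ioo)] with z hz hzc
  exact hv z.2 (hz hzc.2) z.1

theorem ContInLp.mono {p : ℝ≥0∞} {K K' : Set (Vec n)} {I : Set ℝ} {v : Vec n × ℝ → Vec N}
    (h : ContInLp p K' I v) (hK : K ⊆ K') : ContInLp p K I v := by
  have hle : (volume.restrict K : Measure (Vec n)) ≤ volume.restrict K' :=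
    Measure.restrict_mono hK le_rfl
  exact ⟨fun t ht => (h.1 t ht).mono_measure hle, fun t ht =>
    tendsto_of_tendsto_of_tendsto_of_le_of_le tendsto_const_nhds (h.2 t ht)
      (fun _ => zero_le) fun _ => eLpNorm_mono_measure _ hle⟩

theorem one_le_ofReal_add_one (hm : 0 < m) : (1 : ℝ≥0∞) ≤ ENNReal.ofReal (m + 1) := by
  rw [← ENNReal.ofReal_one]
  exact ENNReal.ofReal_le_ofReal (by linarith)

/-- Local weak solutions are continuous in time with values in `L^{m+1}_loc`. -/
theorem IsWeakSolution.hasContRepLoc (hm : 0 < m) (hΩ : IsOpen Ω) (hT : 0 < T)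
    (hA : IsAdmissible Ω T ν L μ A) (hu : IsWeakSolution m Ω T A u) :
    HasContRepLoc (ENNReal.ofReal (m + 1)) Ω T u := by
  obtain ⟨K, hKc, hKmono, hKΩ, hKex⟩ := exists_compact_exhaustion hΩ
  -- The shift by 3 makes α k ≤ T/3, so the interval from α k to T - α k is nonempty already for k =
  -- 0.
  set α : ℕ → ℝ := fun k => T / (k + 3) with hα
  set β : ℕ → ℝ := fun k => T - T / (k + 3) with hβ
  have hα0 : ∀ k, 0 < α k := fun k => by positivity
  have hα3 : ∀ k, α k ≤ T / 3 := fun k => by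
    apply div_le_div_of_nonneg_left hT.le (by norm_num)
    have : (0 : ℝ) ≤ k := Nat.cast_nonneg k
    linarith
  have hαβ : ∀ k, α k < β k := fun k => by
    have := hα3 k
    have e : β k = T - α k := rfl
    linarith
  have hβT : ∀ k, β k < T := fun k => by
    have := hα0 k
    have e : β k = T - α k := rfl
    linarith
  choose S hSsub hSfull hSmem hScau using fun k =>
    hu.exists_cauchy hm hΩ hT hA (hKc k) (hKΩ k) (hα0 k) (hαβ k) (hβT k)
  have hlim : Tendsto α atTop (𝓝 0) := by
    have h := (tendsto_const_div_atTop_nhds_zero_nat T).comp (tendsto_add_atTop_nat 3)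
    refine h.congr fun k => ?_
    simp [hα]
  have hev : ∀ t ∈ Ioo 0 T, ∀ᶠ k in atTop, t ∈ Ioo (α k) (β k) := by
    intro t ht
    filter_upwards [hlim.eventually_lt_const ht.1,
      hlim.eventually_lt_const (sub_pos.2 ht.2)] with k h1 h2
    refine ⟨h1, ?_⟩
    have e : β k = T - α k := rfl
    linarith
  set S' : Set ℝ := {t | t ∈ Ioo 0 T ∧ ∀ k, t ∈ Ioo (α k) (β k) → t ∈ S k} with hS'
  have hfull : ∀ᵐ t, t ∈ Ioo 0 T → t ∈ S' := by
    filter_upwards [ae_all_iff.2 hSfull] with t ht htT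
    exact ⟨htT, ht⟩
  have hmem : ∀ k, ∀ t ∈ S', MemLp (fun x => u (x, t)) (ENNReal.ofReal (m + 1))
      (volume.restrict (K k)) := by
    intro k t ht
    obtain ⟨j, hj, hkj⟩ := ((hev t ht.1).and (eventually_ge_atTop k)).exists
    exact (hSmem j t (ht.2 j hj)).mono_measure (Measure.restrict_mono (hKmono hkj) le_rfl)
  obtain ⟨v, hvu, hv⟩ := exists_contInLp_extension (one_le_ofReal_add_one hm) hKmono
    (fun k => (hKc k).measurableSet) (I := Ioo 0 T) (S := S') (u := u)
    (Ioo_subset_Icc_self.trans (Icc_subset_closure_of_ae hT hfull)) hmem (by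
      intro k t₀ ht₀ ε hε
      obtain ⟨ε', hε', he⟩ := exists_eLpNorm_le_of_integral_le (N := N)
        (by linarith : 0 < m + 1) hε
      -- The time t₀ may lie outside the k-th interval, so a later j is used with t₀ in the j-th
      -- interval and K k ⊆ K j. The radius is then shrunk to stay in that interval.
      obtain ⟨j, hj, hkj⟩ := ((hev t₀ ht₀).and (eventually_ge_atTop k)).exists
      obtain ⟨δ, hδ, h⟩ := hScau j t₀ (Ioo_subset_Icc_self hj) ε' hε'
      refine ⟨min δ (min (t₀ - α j) (β j - t₀)),
        lt_min hδ (lt_min (sub_pos.2 hj.1) (sub_pos.2 hj.2)), fun t ht t' ht' h1 h2 => ?_⟩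
      have hin : ∀ r ∈ S', |r - t₀| < min δ (min (t₀ - α j) (β j - t₀)) → r ∈ S j := by
        intro r hr hrt
        rw [lt_min_iff, lt_min_iff, abs_lt, abs_lt, abs_lt] at hrt
        exact hr.2 j ⟨by linarith [hrt.2.1.1], by linarith [hrt.2.2.2]⟩
      refine (eLpNorm_mono_measure _ (Measure.restrict_mono (hKmono hkj) le_rfl)).trans
        (he ((hmem j t ht).sub (hmem j t' ht')) ?_)
      exact h t (hin t ht h1) t' (hin t' ht' h2) (h1.trans_le (min_le_left _ _))
        (h2.trans_le (min_le_left _ _)))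
  refine ⟨v, ae_eq_cyl_of_slices hfull hΩ.measurableSet hvu, fun C hC hCΩ => ?_⟩
  obtain ⟨k, hk⟩ := hKex C hC hCΩ
  exact (hv k).mono (hk.trans interior_subset)

end Representative

/-! ### Uniqueness of weak gradients -/

section WeakGradientUniqueness

variable {n N : ℕ} {Ω : Set (Vec n)} {T : ℝ}

theorem ae_eq_of_forall_test (hΩ : IsOpen Ω) {f f' : Vec n → ℝ} (hf : LocallyIntegrableOn f Ω)
    (hf' : LocallyIntegrableOn f' Ω)
    (h : ∀ ψ, IsTest Ω ψ → ∫ x in Ω, ψ x * f x = ∫ x in Ω, ψ x * f' x) :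
    f =ᵐ[volume.restrict Ω] f' := by
  have h0 := hΩ.ae_eq_zero_of_integral_contDiff_smul_eq_zero (hf.sub hf') fun ψ hψ hc hs => by
    have i1 := integrable_mul_of_locallyIntegrableOn hf hψ.continuous hc hs
    have i2 := integrable_mul_of_locallyIntegrableOn hf' hψ.continuous hc hs
    have e : ∀ v : Vec n → ℝ, ∫ x in Ω, ψ x * v x = ∫ x, ψ x * v x := fun v =>
      setIntegral_eq_integral_of_forall_compl_eq_zero fun x hx => by
        rw [image_eq_zero_of_notMem_tsupport fun h => hx (hs h), zero_mul]
    have := h ψ ⟨hψ, hc, hs⟩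
    rw [e, e] at this
    simp only [Pi.sub_apply, smul_eq_mul, mul_sub]
    rw [integral_sub i1 i2, this, sub_self]
  filter_upwards [(ae_restrict_iff' hΩ.measurableSet).2 h0] with x hx
  exact sub_eq_zero.1 hx

theorem IsWeakGrad.ae_eq (hΩ : IsOpen Ω) {f : Vec n → Vec N} {G G' : Vec n → Mat N n}
    (h : IsWeakGrad Ω f G) (h' : IsWeakGrad Ω f G') : G =ᵐ[volume.restrict Ω] G' := by
  have : ∀ p : Fin N × Fin n, ∀ᵐ x ∂(volume.restrict Ω), G x p = G' x p := by
    rintro ⟨j, i⟩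
    refine ae_eq_of_forall_test hΩ (locallyIntegrableOn_apply h.2.1 _)
      (locallyIntegrableOn_apply h'.2.1 _) fun ψ hψ => ?_
    have h1 := h.2.2 ψ hψ j i
    rw [h'.2.2 ψ hψ j i, neg_inj] at h1
    simp_rw [mul_comm (ψ _)]
    exact h1.symm
  filter_upwards [ae_all_iff.2 this] with x hx
  ext p
  exact hx p

theorem IsWeakGrad.sub {f g : Vec n → Vec N} {F G : Vec n → Mat N n}
    (hf : IsWeakGrad Ω f F) (hg : IsWeakGrad Ω g G) :
    IsWeakGrad Ω (fun x => f x - g x) (fun x => F x - G x) := by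
  refine ⟨hf.1.sub hg.1, hf.2.1.sub hg.2.1, fun φ hφ j i => ?_⟩
  have hi : ∀ {ψ v : Vec n → ℝ}, LocallyIntegrableOn v Ω → Continuous ψ → HasCompactSupport ψ →
      tsupport ψ ⊆ Ω → Integrable (fun x => v x * ψ x) (volume.restrict Ω) := by
    intro ψ v hv h1 h2 h3
    simp_rw [mul_comm (v _)]
    exact (integrable_mul_of_locallyIntegrableOn hv h1 h2 h3).integrableOn
  have hc := hφ.continuous_partial (EuclideanSpace.single i 1)
  have hs := hφ.hasCompactSupport_partial (EuclideanSpace.single i 1)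
  have ht := (tsupport_fderiv_apply_subset ℝ (f := φ) (EuclideanSpace.single i 1)).trans hφ.2.2
  simp only [PiLp.sub_apply, sub_mul]
  rw [integral_sub (hi (locallyIntegrableOn_apply hf.1 j) hc hs ht)
    (hi (locallyIntegrableOn_apply hg.1 j) hc hs ht),
    integral_sub (hi (locallyIntegrableOn_apply hf.2.1 _) hφ.1.continuous hφ.2.1 hφ.2.2)
    (hi (locallyIntegrableOn_apply hg.2.1 _) hφ.1.continuous hφ.2.1 hφ.2.2),
    hf.2.2 φ hφ, hg.2.2 φ hφ]
  ring

theorem MemLpLoc.aestronglyMeasurable {E : Type*} [NormedAddCommGroup E] {p : ℝ≥0∞}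
    (hΩ : IsOpen Ω) {f : Vec n × ℝ → E} (hf : MemLpLoc p (cyl Ω T) f) :
    AEStronglyMeasurable f (volume.restrict (cyl Ω T)) := by
  obtain ⟨K, hKc, -, hKΩ, hKex⟩ :=
    exists_compact_exhaustion (hΩ.prod (isOpen_Ioo (a := 0) (b := T)))
  have e : cyl Ω T = ⋃ k, K k := by
    refine subset_antisymm (fun z hz => ?_) (iUnion_subset hKΩ)
    obtain ⟨k, hk⟩ := hKex {z} isCompact_singleton (singleton_subset_iff.2 hz)
    exact mem_iUnion.2 ⟨k, interior_subset (hk rfl)⟩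
  rw [e, aestronglyMeasurable_iUnion_iff]
  exact fun k => (hf _ (hKc k) (hKΩ k)).1

/-- Tonelli for the norm of the difference. Joint measurability is essential: null slices alone do
not make a set null. -/
theorem ae_eq_cyl_of_ae_slice {E : Type*} [NormedAddCommGroup E] {f f' : Vec n × ℝ → E}
    (hf : AEStronglyMeasurable f (volume.restrict (cyl Ω T)))
    (hf' : AEStronglyMeasurable f' (volume.restrict (cyl Ω T)))
    (h : ∀ᵐ t ∂(volume.restrict (Ioo (0 : ℝ) T)),
      (fun x => f (x, t)) =ᵐ[volume.restrict Ω] fun x => f' (x, t)) :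
    f =ᵐ[volume.restrict (cyl Ω T)] f' := by
  have hm : AEMeasurable (fun z => ‖f z - f' z‖ₑ) (volume.restrict (cyl Ω T)) :=
    (hf.sub hf').enorm
  rw [cyl, Measure.volume_eq_prod, ← Measure.prod_restrict] at hm ⊢
  have h0 : ∫⁻ z, ‖f z - f' z‖ₑ ∂((volume.restrict Ω).prod (volume.restrict (Ioo 0 T))) = 0 := by
    rw [lintegral_prod_symm _ hm]
    refine (lintegral_congr_ae (g := fun _ => 0) ?_).trans (by simp)
    filter_upwards [h] with t ht
    refine (lintegral_congr_ae (g := fun _ => 0) ?_).trans (by simp)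
    filter_upwards [ht] with x hx
    simp [hx]
  filter_upwards [(lintegral_eq_zero_iff' hm).1 h0] with z hz
  exact sub_eq_zero.1 (by simpa using hz)

theorem ae_slice_of_ae_eq_cyl {E : Type*} {f f' : Vec n × ℝ → E}
    (h : f =ᵐ[volume.restrict (cyl Ω T)] f') :
    ∀ᵐ t ∂(volume.restrict (Ioo (0 : ℝ) T)),
      (fun x => f (x, t)) =ᵐ[volume.restrict Ω] fun x => f' (x, t) := by
  rw [cyl, Measure.volume_eq_prod, ← Measure.prod_restrict, ← Measure.prod_swap] at h
  exact Measure.ae_ae_of_ae_prod (ae_of_ae_map measurable_swap.aemeasurable h)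

/-- A locally square integrable spatial gradient of a function in `L²(0,T; W^{1,2})` is square
integrable. -/
theorem MemL2W12.memLp_grad (hΩ : IsOpen Ω) {w : Vec n × ℝ → Vec N} {G : Vec n × ℝ → Mat N n}
    (h : MemL2W12 Ω T w) (hG : MemLpLoc 2 (cyl Ω T) G) (hgrad : IsSpatialWeakGrad Ω T w G) :
    MemLp G 2 (volume.restrict (cyl Ω T)) := by
  obtain ⟨-, G', hG', hgrad'⟩ := h
  refine hG'.ae_eq (ae_eq_cyl_of_ae_slice hG'.1 (hG.aestronglyMeasurable hΩ) ?_)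
  filter_upwards [hgrad, hgrad'] with t h1 h2
  exact h2.ae_eq hΩ h1

end WeakGradientUniqueness

/-! ### Functions with zero boundary values -/

section ZeroBoundaryValues

variable {n N : ℕ} {Ω : Set (Vec n)}

theorem toReal_eLpNorm_two_sq {X E : Type*} [MeasurableSpace X] {κ : Measure X}
    [NormedAddCommGroup E] {f : X → E} (hf : MemLp f 2 κ) :
    (eLpNorm f 2 κ).toReal ^ 2 = ∫ x, ‖f x‖ ^ 2 ∂κ := by
  have h0 : 0 ≤ ∫ x, ‖f x‖ ^ 2 ∂κ := integral_nonneg fun x => sq_nonneg _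
  rw [hf.eLpNorm_eq_integral_rpow_norm (by norm_num) (by norm_num)]
  simp only [ENNReal.toReal_ofNat, Real.rpow_ofNat]
  rw [ENNReal.toReal_ofReal (Real.rpow_nonneg h0 _), ← Real.rpow_natCast, ← Real.rpow_mul h0]
  norm_num

/-- Square integrals of an `L²`-convergent sequence are bounded by a convergent sequence. -/
theorem exists_integral_norm_sq_le {X E : Type*} [MeasurableSpace X] {κ : Measure X}
    [NormedAddCommGroup E] {f : X → E} {fs : ℕ → X → E} (hf : MemLp f 2 κ)
    (hfs : ∀ k, MemLp (fs k) 2 κ)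
    (h : Tendsto (fun k => eLpNorm (fun x => fs k x - f x) 2 κ) atTop (𝓝 0)) :
    ∃ R : ℕ → ℝ, (∀ k, ∫ x, ‖fs k x‖ ^ 2 ∂κ ≤ R k) ∧
      Tendsto R atTop (𝓝 (∫ x, ‖f x‖ ^ 2 ∂κ)) := by
  refine ⟨fun k => ((eLpNorm (fun x => fs k x - f x) 2 κ).toReal + (eLpNorm f 2 κ).toReal) ^ 2,
    fun k => ?_, ?_⟩
  · rw [← toReal_eLpNorm_two_sq (hfs k)]
    refine pow_le_pow_left₀ ENNReal.toReal_nonneg ?_ 2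
    have hd : MemLp (fun x => fs k x - f x) 2 κ := (hfs k).sub hf
    rw [← ENNReal.toReal_add hd.2.ne hf.2.ne]
    refine ENNReal.toReal_mono (ENNReal.add_ne_top.2 ⟨hd.2.ne, hf.2.ne⟩) ?_
    refine le_trans (le_of_eq ?_) (eLpNorm_add_le hd.1 hf.1 (by norm_num))
    congr 1
    ext x
    simp
  · rw [← toReal_eLpNorm_two_sq hf]
    have := (ENNReal.tendsto_toReal ENNReal.zero_ne_top).comp h
    simpa using (this.add_const _).pow 2

theorem tendsto_integral_mul_of_tendsto_eLpNorm {X : Type*} [MeasurableSpace X] {κ : Measure X}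
    [IsFiniteMeasure κ] {f : X → ℝ} {fs : ℕ → X → ℝ} (hf : MemLp f 2 κ)
    (hfs : ∀ k, MemLp (fs k) 2 κ)
    (h : Tendsto (fun k => eLpNorm (fun x => fs k x - f x) 2 κ) atTop (𝓝 0))
    {ψ : X → ℝ} (hψ : AEStronglyMeasurable ψ κ) {C : ℝ} (hC : ∀ x, ‖ψ x‖ ≤ C) :
    Tendsto (fun k => ∫ x, fs k x * ψ x ∂κ) atTop (𝓝 (∫ x, f x * ψ x ∂κ)) := by
  have hi : ∀ {v : X → ℝ}, MemLp v 2 κ → Integrable (fun x => v x * ψ x) κ := by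
    intro v hv
    simp_rw [mul_comm (v _)]
    exact Integrable.bdd_mul (c := C) (hv.integrable (by norm_num)) hψ (Eventually.of_forall hC)
  refine tendsto_integral_of_L1' _ (hi hf).1 (Eventually.of_forall fun k => hi (hfs k)) ?_
  have hb : ∀ k, eLpNorm ((fun x => fs k x * ψ x) - fun x => f x * ψ x) 1 κ ≤
      ENNReal.ofReal C * (eLpNorm (fun x => fs k x - f x) 2 κ *
        κ univ ^ (1 / (1 : ℝ≥0∞).toReal - 1 / (2 : ℝ≥0∞).toReal)) := by
    intro k
    have hd : MemLp (fun x => fs k x - f x) 2 κ := (hfs k).sub hf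
    refine (eLpNorm_le_mul_eLpNorm_of_ae_le_mul (c := C) (g := fun x => fs k x - f x)
      (Eventually.of_forall fun x => ?_) 1).trans ?_
    · simp only [Pi.sub_apply]
      rw [← sub_mul, norm_mul, mul_comm]
      exact mul_le_mul_of_nonneg_right (hC x) (norm_nonneg _)
    · gcongr
      exact eLpNorm_le_eLpNorm_mul_rpow_measure_univ (by norm_num) hd.1
  refine tendsto_of_tendsto_of_tendsto_of_le_of_le tendsto_const_nhds ?_ (fun _ => zero_le) hb
  have h1 : Tendsto (fun k => ENNReal.ofReal C * (eLpNorm (fun x => fs k x - f x) 2 κ *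
        κ univ ^ (1 / (1 : ℝ≥0∞).toReal - 1 / (2 : ℝ≥0∞).toReal))) atTop
      (𝓝 (ENNReal.ofReal C * (0 * κ univ ^ (1 / (1 : ℝ≥0∞).toReal - 1 / (2 : ℝ≥0∞).toReal)))) := by
    refine ENNReal.Tendsto.const_mul (ENNReal.Tendsto.mul_const h (Or.inr ?_))
      (Or.inr ENNReal.ofReal_ne_top)
    exact ENNReal.rpow_ne_top_of_nonneg (by norm_num) (measure_ne_top κ _)
  simpa using h1

theorem IsTest.continuous_grad {φ : Vec n → Vec N} (h : IsTest Ω φ) : Continuous (grad φ) := by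
  refine (PiLp.continuous_toLp 2 _).comp (continuous_pi fun p => ?_)
  exact (EuclideanSpace.proj p.1 : Vec N →L[ℝ] ℝ).continuous.comp
    ((h.1.continuous_fderiv (by simp)).clm_apply continuous_const)

theorem IsTest.hasCompactSupport_grad {φ : Vec n → Vec N} (h : IsTest Ω φ) :
    HasCompactSupport (grad φ) := by
  refine (h.2.1.fderiv (𝕜 := ℝ)).mono fun x hx h0 => hx ?_
  ext p
  simp [grad, h0]

theorem IsTest.memLp {E : Type*} [NormedAddCommGroup E] [NormedSpace ℝ E] {φ : Vec n → E}
    (h : IsTest Ω φ) (p : ℝ≥0∞) : MemLp φ p (volume.restrict Ω) :=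
  (h.1.continuous.memLp_of_hasCompactSupport h.2.1).restrict _

theorem IsTest.apply {φ : Vec n → Vec N} (h : IsTest Ω φ) (j : Fin N) :
    IsTest Ω fun x => φ x j := by
  have hsub : tsupport (fun x => φ x j) ⊆ tsupport φ := by
    apply closure_mono
    intro x hx h0
    exact hx (by simp [h0])
  exact ⟨(EuclideanSpace.proj j : Vec N →L[ℝ] ℝ).contDiff.comp h.1,
    h.2.1.of_isClosed_subset (isClosed_tsupport _) hsub, hsub.trans h.2.2⟩

theorem IsTest.fderiv_apply {φ : Vec n → Vec N} (h : IsTest Ω φ) (j : Fin N) (x e : Vec n) :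
    fderiv ℝ (fun x => φ x j) x e = fderiv ℝ φ x e j := by
  have h1 : HasFDerivAt φ (fderiv ℝ φ x) x := (h.1.differentiable (by simp) _).hasFDerivAt
  have h2 := (EuclideanSpace.proj j : Vec N →L[ℝ] ℝ).hasFDerivAt.comp x h1
  have h3 : HasFDerivAt (fun x => φ x j)
    ((EuclideanSpace.proj j : Vec N →L[ℝ] ℝ).comp (fderiv ℝ φ x)) x := h2
  rw [h3.fderiv]
  simp

theorem IsTest.gradSq_apply_le {φ : Vec n → Vec N} (h : IsTest Ω φ) (j : Fin N) (x : Vec n) :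
    gradSq (fun x => φ x j) x ≤ ‖grad φ x‖ ^ 2 := by
  rw [EuclideanSpace.real_norm_sq_eq, Fintype.sum_prod_type, gradSq]
  simp_rw [h.fderiv_apply]
  exact Finset.single_le_sum
    (f := fun j => ∑ i, (grad φ x (j, i)) ^ 2)
    (fun j _ => Finset.sum_nonneg fun i _ => sq_nonneg _) (Finset.mem_univ j)

theorem IsTest.integral_mul_fderiv {φ : Vec n → Vec N} (h : IsTest Ω φ) {ψ : Vec n → ℝ}
    (hψ : IsTest Ω ψ) (j : Fin N) (i : Fin n) :
    ∫ x in Ω, φ x j * fderiv ℝ ψ x (EuclideanSpace.single i 1) =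
      -∫ x in Ω, grad φ x (j, i) * ψ x := by
  have hz : ∀ x ∉ Ω, ψ x = 0 := fun x hx =>
    image_eq_zero_of_notMem_tsupport fun h' => hx (hψ.2.2 h')
  have hz' : ∀ x ∉ Ω, φ x = 0 := fun x hx =>
    image_eq_zero_of_notMem_tsupport fun h' => hx (h.2.2 h')
  rw [setIntegral_eq_integral_of_forall_compl_eq_zero fun x hx => by simp [hz' x hx],
    setIntegral_eq_integral_of_forall_compl_eq_zero fun x hx => by simp [hz x hx]]
  have ha := h.apply j
  have e : ∀ x, grad φ x (j, i) = fderiv ℝ (fun x => φ x j) x (EuclideanSpace.single i 1) :=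
    fun x => by rw [h.fderiv_apply]; rfl
  simp_rw [e]
  have c1 := ha.1.continuous
  have c2 := hψ.1.continuous
  have c3 := ha.continuous_partial (EuclideanSpace.single i 1)
  have c4 := hψ.continuous_partial (EuclideanSpace.single i 1)
  exact integral_mul_fderiv_eq_neg_fderiv_mul_of_integrable
    ((c3.mul c2).integrable_of_hasCompactSupport (hψ.2.1.mul_left))
    ((c1.mul c4).integrable_of_hasCompactSupport (ha.2.1.mul_right))
    ((c1.mul c2).integrable_of_hasCompactSupport (ha.2.1.mul_right))
    (fun x _ => ha.1.differentiable (by simp) x) (fun x _ => hψ.1.differentiable (by simp) x)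

/-- Approximation of a function with zero boundary values by test functions, with control of the
gradients by its weak gradient. -/
theorem MemW120.exists_test (hΩ : IsOpen Ω) (hfin : volume Ω < ⊤) {f : Vec n → Vec N}
    {H : Vec n → Mat N n} (hf : MemW120 Ω f) (hH : IsWeakGrad Ω f H) :
    ∃ (φ : ℕ → Vec n → Vec N) (R : ℕ → ℝ), (∀ k, IsTest Ω (φ k)) ∧
      (∀ᵐ x ∂(volume.restrict Ω), Tendsto (fun k => φ k x) atTop (𝓝 (f x))) ∧
      (∀ k, ∫ x in Ω, ‖grad (φ k) x‖ ^ 2 ≤ R k) ∧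
      Tendsto R atTop (𝓝 (∫ x in Ω, ‖H x‖ ^ 2)) := by
  obtain ⟨hf2, G, hG, φ, hφ, hlim, hglim⟩ := hf
  have : IsFiniteMeasure (volume.restrict Ω) := ⟨by simpa using hfin⟩
  have hφ2 := fun k => (hφ k).memLp 2
  have hgφ2 : ∀ k, MemLp (grad (φ k)) 2 (volume.restrict Ω) := fun k =>
    ((hφ k).continuous_grad.memLp_of_hasCompactSupport (hφ k).hasCompactSupport_grad).restrict _
  have hcomp : ∀ {ι : Type} [Fintype ι] {v : Vec n → EuclideanSpace ℝ ι}
      {vs : ℕ → Vec n → EuclideanSpace ℝ ι} (j : ι),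
      Tendsto (fun k => eLpNorm (fun x => vs k x - v x) 2 (volume.restrict Ω)) atTop (𝓝 0) →
      Tendsto (fun k => eLpNorm (fun x => vs k x j - v x j) 2 (volume.restrict Ω))
        atTop (𝓝 0) := by
    intro ι _ v vs j h
    refine tendsto_of_tendsto_of_tendsto_of_le_of_le tendsto_const_nhds h (fun _ => zero_le)
      fun k => eLpNorm_mono fun x => ?_
    exact PiLp.norm_apply_le (vs k x - v x) j
  -- Integration by parts for the test functions passes to the L² limit, so the limit of gradients
  -- is a weak gradient and agrees with the prescribed H by uniqueness.
  have hweak : IsWeakGrad Ω f G := by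
    have hf1 : IntegrableOn f Ω := hf2.integrable (by norm_num)
    have hG1 : IntegrableOn G Ω := hG.integrable (by norm_num)
    refine ⟨hf1.locallyIntegrableOn, hG1.locallyIntegrableOn, fun ψ hψ j i => ?_⟩
    obtain ⟨C, hC⟩ := hψ.1.continuous.bounded_above_of_compact_support hψ.2.1
    have hc := hψ.continuous_partial (EuclideanSpace.single i 1)
    obtain ⟨C', hC'⟩ := hc.bounded_above_of_compact_support (hψ.hasCompactSupport_partial _)
    have h1 := tendsto_integral_mul_of_tendsto_eLpNorm (memLp_apply hf2 j)
      (fun k => memLp_apply (hφ2 k) j) (hcomp j hlim) hc.aestronglyMeasurable hC'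
    have h2 := tendsto_integral_mul_of_tendsto_eLpNorm (memLp_apply hG (j, i))
      (fun k => memLp_apply (hgφ2 k) (j, i)) (hcomp (j, i) hglim)
      hψ.1.continuous.aestronglyMeasurable hC
    refine tendsto_nhds_unique h1 (h2.neg.congr fun k => ?_)
    exact ((hφ k).integral_mul_fderiv hψ j i).symm
  obtain ⟨R, hRle, hR⟩ := exists_integral_norm_sq_le hG hgφ2 hglim
  -- Only a subsequence converges almost everywhere; the energy bounds R keep their limit along it.
  obtain ⟨ns, hns, hae⟩ := (tendstoInMeasure_of_tendsto_eLpNorm (p := 2) (by norm_num)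
    (fun k => (hφ2 k).1) hf2.1 hlim).exists_seq_tendsto_ae
  refine ⟨fun k => φ (ns k), fun k => R (ns k), fun k => hφ _, hae, fun k => hRle _, ?_⟩
  have e : ∫ x in Ω, ‖H x‖ ^ 2 = ∫ x in Ω, ‖G x‖ ^ 2 := by
    refine integral_congr_ae ?_
    filter_upwards [hH.ae_eq hΩ hweak] with x hx
    rw [hx]
  rw [e]
  exact hR.comp hns.tendsto_atTop

end ZeroBoundaryValues

/-! ### Functions with a weak time derivative -/

section TimeDerivative

variable {n N : ℕ} {Ω : Set (Vec n)} {T : ℝ} {w w' : Vec n × ℝ → Vec N}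

theorem Integrable.locInt_apply {f : Vec n × ℝ → Vec N}
    (hf : Integrable f (volume.restrict (cyl Ω T))) (j : Fin N) : LocInt Ω T fun z => f z j := by
  intro K hK hKΩ α β hα hβ
  refine ((EuclideanSpace.proj j : Vec N →L[ℝ] ℝ).integrable_comp hf).mono_measure
    (Measure.restrict_mono (Set.prod_mono hKΩ (Ioo_subset_Ioo hα.le hβ.le)) le_rfl)

theorem integral_deriv_mul_of_weakTimeDeriv (hT : 0 < T)
    (hw : Integrable w (volume.restrict (cyl Ω T)))
    (hw' : Integrable w' (volume.restrict (cyl Ω T)))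
    (h : ∀ φ : Vec n × ℝ → ℝ, IsTest (cyl Ω T) φ →
      ∫ z in cyl Ω T, timeDeriv φ z • w z = -∫ z in cyl Ω T, φ z • w' z)
    (j : Fin N) {ψ : Vec n → ℝ} (hψ : IsTest Ω ψ) {θ : ℝ → ℝ} (hθ : IsTest (Ioo 0 T) θ) :
    ∫ τ in Ioo 0 T, deriv θ τ * ∫ x in Ω, ψ x * w (x, τ) j =
      -∫ τ in Ioo 0 T, θ τ * ∫ x in Ω, ψ x * w' (x, τ) j := by
  have hcθ : Continuous (deriv θ) := hθ.1.continuous_deriv (by simp)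
  rw [← (Integrable.locInt_apply hw j).integral_mul_eq hT hψ.1.continuous hψ.2.1 hψ.2.2
      hcθ hθ.2.1.deriv ((tsupport_deriv_subset).trans hθ.2.2),
    ← (Integrable.locInt_apply hw' j).integral_mul_eq hT hψ.1.continuous hψ.2.1 hψ.2.2
      hθ.1.continuous hθ.2.1 hθ.2.2]
  have ht : ∀ z, timeDeriv (fun z : Vec n × ℝ => θ z.2 * ψ z.1) z = deriv θ z.2 * ψ z.1 := by
    intro z
    rw [timeDeriv, (hψ.hasFDerivAt_mul hθ z).fderiv]
    simp [mul_comm]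
  have h1 := h _ (hψ.mul hθ)
  simp_rw [ht] at h1
  obtain ⟨C, hC⟩ := hψ.1.continuous.bounded_above_of_compact_support hψ.2.1
  have hi : ∀ {η : ℝ → ℝ} {f : Vec n × ℝ → Vec N}, Continuous η → HasCompactSupport η →
      Integrable f (volume.restrict (cyl Ω T)) →
      Integrable (fun z => (η z.2 * ψ z.1) • f z) (volume.restrict (cyl Ω T)) := by
    intro η f hη hηc hf
    obtain ⟨C', hC'⟩ := hη.bounded_above_of_compact_support hηc
    refine Integrable.bdd_smul hf (C' * C)
      ((hη.comp continuous_snd).mul (hψ.1.continuous.comp continuous_fst)).aestronglyMeasurable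
      (Eventually.of_forall fun z => ?_)
    simp only [Pi.mul_apply, Function.comp_apply]
    rw [norm_mul]
    exact mul_le_mul (hC' _) (hC _) (norm_nonneg _) ((norm_nonneg _).trans (hC' z.2))
  have h2 := congrArg (EuclideanSpace.proj j : Vec N →L[ℝ] ℝ) h1
  rw [map_neg, ← ContinuousLinearMap.integral_comp_comm _ (hi hcθ hθ.2.1.deriv hw),
    ← ContinuousLinearMap.integral_comp_comm _ (hi hθ.1.continuous hθ.2.1 hw')] at h2
  simpa [mul_assoc] using h2

/-- At good times both sides have the same integral against every spatial test function, after
exchanging the time and space integrals, so they agree almost everywhere in Ω. The exceptional set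
of x may depend on s and t. -/
theorem exists_times_sub_eq_integral (hΩ : IsOpen Ω) (hT : 0 < T)
    (hw : Integrable w (volume.restrict (cyl Ω T)))
    (hw' : Integrable w' (volume.restrict (cyl Ω T)))
    (h : ∀ φ : Vec n × ℝ → ℝ, IsTest (cyl Ω T) φ →
      ∫ z in cyl Ω T, timeDeriv φ z • w z = -∫ z in cyl Ω T, φ z • w' z) :
    ∃ S ⊆ Ioo 0 T, (∀ᵐ t, t ∈ Ioo 0 T → t ∈ S) ∧ ∀ s ∈ S, ∀ t ∈ S,
      ∀ᵐ x ∂(volume.restrict Ω), w (x, t) - w (x, s) = ∫ τ in s..t, w' (x, τ) := by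
  choose S hST hSfull hS using fun j : Fin N =>
    exists_good_times hΩ (Integrable.locInt_apply hw j)
  have hwp := hw
  have hwp' := hw'
  rw [cyl, Measure.volume_eq_prod, ← Measure.prod_restrict] at hwp hwp'
  have hsl : ∀ᵐ t, t ∈ Ioo 0 T → IntegrableOn (fun x => w (x, t)) Ω :=
    (ae_restrict_iff' measurableSet_Ioo).1 hwp.prod_left_ae
  refine ⟨{t | t ∈ Ioo 0 T ∧ (∀ j, t ∈ S j) ∧ IntegrableOn (fun x => w (x, t)) Ω},
    fun t ht => ht.1, ?_, ?_⟩
  · filter_upwards [hsl, ae_all_iff.2 hSfull] with t h1 h2 htT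
    exact ⟨htT, fun j => h2 j htT, h1 htT⟩
  rintro s ⟨hsT, hs, hsi⟩ t ⟨htT, ht, hti⟩
  have hsub : uIoc s t ⊆ Ioo 0 T :=
    uIoc_subset_uIcc.trans (ordConnected_Ioo.uIcc_subset hsT htT)
  have hwu : Integrable w' ((volume.restrict Ω).prod (volume.restrict (uIoc s t))) :=
    hwp'.mono_measure (Measure.prod_mono le_rfl (Measure.restrict_mono hsub le_rfl))
  have hintg : ∀ᵐ x ∂(volume.restrict Ω), IntervalIntegrable (fun τ => w' (x, τ)) volume s t := by
    filter_upwards [hwu.prod_right_ae] with x hx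
    rw [intervalIntegrable_iff]
    exact hx
  have hcomp : ∀ j, ∀ᵐ x ∂(volume.restrict Ω),
      w (x, t) j - w (x, s) j = ∫ τ in s..t, w' (x, τ) j := by
    intro j
    have hwj : Integrable (fun z => w' z j)
        ((volume.restrict Ω).prod (volume.restrict (uIoc s t))) :=
      (EuclideanSpace.proj j : Vec N →L[ℝ] ℝ).integrable_comp hwu
    have hIi : IntegrableOn (fun x => ∫ τ in s..t, w' (x, τ) j) Ω := by
      simp_rw [intervalIntegral.intervalIntegral_eq_integral_uIoc]
      exact hwj.integral_prod_left.const_mul _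
    have hsj : IntegrableOn (fun x => w (x, s) j) Ω :=
      (EuclideanSpace.proj j : Vec N →L[ℝ] ℝ).integrable_comp hsi
    have htj : IntegrableOn (fun x => w (x, t) j) Ω :=
      (EuclideanSpace.proj j : Vec N →L[ℝ] ℝ).integrable_comp hti
    refine ae_eq_of_forall_test hΩ (htj.sub hsj).locallyIntegrableOn
      hIi.locallyIntegrableOn fun ψ hψ => ?_
    obtain ⟨C, hC⟩ := hψ.1.continuous.bounded_above_of_compact_support hψ.2.1
    have hb : ∀ {v : Vec n → ℝ}, IntegrableOn v Ω → IntegrableOn (fun x => ψ x * v x) Ω :=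
      fun hv => Integrable.bdd_mul (c := C) hv hψ.1.continuous.aestronglyMeasurable
        (Eventually.of_forall hC)
    simp only [mul_sub]
    rw [integral_sub (hb htj) (hb hsj), hS j ψ hψ (fun τ => ∫ x in Ω, ψ x * w' (x, τ) j)
      (fun α β hα hβ => (Integrable.locInt_apply hw' j).integrableOn_integral hΩ.measurableSet
        hψ.1.continuous hψ.2.1 hψ.2.2 hα hβ)
      (fun θ hθ => integral_deriv_mul_of_weakTimeDeriv hT hw hw' h j hψ hθ) s (hs j) t (ht j)]
    simp_rw [intervalIntegral.intervalIntegral_eq_integral_uIoc, smul_eq_mul]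
    have hψw : Integrable (fun z : Vec n × ℝ => ψ z.1 * w' z j)
        ((volume.restrict Ω).prod (volume.restrict (uIoc s t))) :=
      Integrable.bdd_mul (c := C) hwj (hψ.1.continuous.comp continuous_fst).aestronglyMeasurable
        (Eventually.of_forall fun z => hC _)
    have hswap := integral_integral_swap (f := fun x τ => ψ x * w' (x, τ) j) hψw
    rw [← hswap, ← integral_const_mul]
    refine integral_congr_ae (Eventually.of_forall fun x => ?_)
    simp only [integral_const_mul]
    ring
  filter_upwards [ae_all_iff.2 hcomp, hintg] with x hx hi
  ext j
  have := (EuclideanSpace.proj j : Vec N →L[ℝ] ℝ).intervalIntegral_comp_comm hi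
  simp only [PiLp.sub_apply, hx j]
  simpa using this

/-- Young's inequality for the conjugate exponents (m+1)/m and m+1, with the factors below 1
dropped. -/
theorem mul_le_rpow_add_rpow {m a b : ℝ} (hm : 0 < m) (ha : 0 ≤ a) (hb : 0 ≤ b) :
    a * b ≤ a ^ ((m + 1) / m) + b ^ (m + 1) := by
  have hq : Real.HolderConjugate ((m + 1) / m) (m + 1) := by
    rw [Real.holderConjugate_iff]
    constructor
    · rw [lt_div_iff₀ hm]
      linarith
    · field_simp
  have h := Real.young_inequality_of_nonneg ha hb hq
  have h1 : a ^ ((m + 1) / m) / ((m + 1) / m) ≤ a ^ ((m + 1) / m) :=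
    div_le_self (Real.rpow_nonneg ha _) hq.lt.le
  have h2 : b ^ (m + 1) / (m + 1) ≤ b ^ (m + 1) :=
    div_le_self (Real.rpow_nonneg hb _) (by linarith)
  linarith

/-- Time differences of a function with a weak time derivative, tested with a fixed function. -/
theorem abs_integral_inner_time_difference_le {m : ℝ} (hm : 0 < m)
    (hwi : Integrable w' (volume.restrict (cyl Ω T)))
    (hw' : MemLp w' (ENNReal.ofReal ((m + 1) / m)) (volume.restrict (cyl Ω T)))
    {s t : ℝ} (hs : s ∈ Ioo 0 T) (ht : t ∈ Ioo 0 T)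
    (hst : ∀ᵐ x ∂(volume.restrict Ω), w (x, t) - w (x, s) = ∫ τ in s..t, w' (x, τ))
    {f : Vec n → Vec N} (hf : MemLp f (ENNReal.ofReal (m + 1)) (volume.restrict Ω)) :
    |∫ x in Ω, inner ℝ (w (x, s) - w (x, t)) (f x)| ≤
      |∫ τ in s..t, ∫ x in Ω, ‖w' (x, τ)‖ ^ ((m + 1) / m)| +
        |t - s| * ∫ x in Ω, ‖f x‖ ^ (m + 1) := by
  have hsub : uIoc s t ⊆ Ioo 0 T :=
    uIoc_subset_uIcc.trans (ordConnected_Ioo.uIcc_subset hs ht)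
  have hq : 0 < (m + 1) / m := by positivity
  have hle : (volume.restrict Ω).prod (volume.restrict (uIoc s t)) ≤
      volume.restrict (cyl Ω T) := by
    rw [cyl, Measure.volume_eq_prod, ← Measure.prod_restrict]
    exact Measure.prod_mono le_rfl (Measure.restrict_mono hsub le_rfl)
  have : IsFiniteMeasure (volume.restrict (uIoc s t)) := by
    rw [uIoc]
    infer_instance
  have hpow := ((memLp_ofReal_iff hq hw'.1).1 hw').mono_measure hle
  have hfp := MemLp.integrable_rpow hm hf
  have hw1 := hwi.mono_measure hle
  have hpt : ∀ᵐ x ∂(volume.restrict Ω), ‖inner ℝ (w (x, s) - w (x, t)) (f x)‖ ≤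
      (∫ τ in uIoc s t, ‖w' (x, τ)‖ ^ ((m + 1) / m)) + |t - s| * ‖f x‖ ^ (m + 1) := by
    filter_upwards [hst, hw1.prod_right_ae, hpow.prod_right_ae] with x hx h1 h2
    have hvol : (volume.restrict (uIoc s t)).real univ = |t - s| := by
      simp [Measure.real, uIoc, Real.volume_Ioc, max_sub_min_eq_abs]
    calc _ ≤ ‖w (x, s) - w (x, t)‖ * ‖f x‖ := norm_inner_le_norm _ _
      _ = ‖∫ τ in s..t, w' (x, τ)‖ * ‖f x‖ := by rw [← hx, norm_sub_rev]
      _ ≤ (∫ τ in uIoc s t, ‖w' (x, τ)‖) * ‖f x‖ := by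
          gcongr
          exact intervalIntegral.norm_integral_le_integral_norm_uIoc
      _ = ∫ τ in uIoc s t, ‖w' (x, τ)‖ * ‖f x‖ := (integral_mul_const _ _).symm
      _ ≤ ∫ τ in uIoc s t, (‖w' (x, τ)‖ ^ ((m + 1) / m) + ‖f x‖ ^ (m + 1)) := by
          refine integral_mono (h1.norm.mul_const _) (h2.add (integrable_const _)) fun τ => ?_
          exact mul_le_rpow_add_rpow hm (norm_nonneg _) (norm_nonneg _)
      _ = _ := by
          rw [integral_add h2 (integrable_const _), integral_const, smul_eq_mul, hvol]
  have hI := hpow.integral_prod_left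
  have h := norm_integral_le_of_norm_le (hI.add (hfp.const_mul |t - s|)) hpt
  rw [Real.norm_eq_abs] at h
  refine h.trans (le_of_eq ?_)
  simp only [Pi.add_apply]
  rw [integral_add hI (hfp.const_mul _), integral_const_mul,
    integral_integral_swap (f := fun x τ => ‖w' (x, τ)‖ ^ ((m + 1) / m)) hpow,
    intervalIntegral.abs_integral_eq_abs_integral_uIoc]
  have h0 : 0 ≤ ∫ τ in uIoc s t, ∫ x in Ω, ‖w' (x, τ)‖ ^ ((m + 1) / m) :=
    integral_nonneg fun τ => integral_nonneg fun x => Real.rpow_nonneg (norm_nonneg _) _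
  rw [abs_of_nonneg h0]

end TimeDerivative

/-! ### The Cauchy–Dirichlet problem -/

section Global

variable {n N : ℕ} {Ω : Set (Vec n)} {T m ν L μ : ℝ}
  {A : Vec n × ℝ → Vec N → Mat N n → Mat N n} {g u : Vec n × ℝ → Vec N}

/-- Continuity bounds the norms near each time, and compactness of I makes finitely many of these
bounds enough. For g this provides the constant M of the energy argument. -/
theorem ContInLp.exists_bound {p : ℝ≥0∞} (hp : 1 ≤ p) {K : Set (Vec n)} {I : Set ℝ}
    (hI : IsCompact I) {v : Vec n × ℝ → Vec N} (h : ContInLp p K I v) :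
    ∃ M : ℝ≥0∞, M ≠ ⊤ ∧ ∀ t ∈ I, eLpNorm (fun x => v (x, t)) p (volume.restrict K) ≤ M := by
  suffices hs : ∃ M : ℝ≥0∞, M ≠ ⊤ ∧ ∀ t ∈ I ∩ I,
      eLpNorm (fun x => v (x, t)) p (volume.restrict K) ≤ M by simpa using hs
  refine hI.induction_on (p := fun s => ∃ M : ℝ≥0∞, M ≠ ⊤ ∧ ∀ t ∈ s ∩ I,
    eLpNorm (fun x => v (x, t)) p (volume.restrict K) ≤ M) ⟨0, by simp⟩ ?_ ?_ ?_
  · rintro s s' hs ⟨M, hM, h'⟩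
    exact ⟨M, hM, fun t ht => h' t ⟨hs ht.1, ht.2⟩⟩
  · rintro s s' ⟨M, hM, h1⟩ ⟨M', hM', h2⟩
    refine ⟨max M M', max_ne_top hM hM', fun t ht => ?_⟩
    rcases ht.1 with hs | hs
    · exact (h1 t ⟨hs, ht.2⟩).trans (le_max_left _ _)
    · exact (h2 t ⟨hs, ht.2⟩).trans (le_max_right _ _)
  · intro t₀ ht₀
    refine ⟨{t | t ∈ I ∧ eLpNorm (fun x => v (x, t) - v (x, t₀)) p (volume.restrict K) < 1},
      Filter.inter_mem self_mem_nhdsWithin ((h.2 t₀ ht₀).eventually_lt_const one_pos),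
      1 + eLpNorm (fun x => v (x, t₀)) p (volume.restrict K),
      ENNReal.add_ne_top.2 ⟨ENNReal.one_ne_top, (h.1 t₀ ht₀).2.ne⟩, ?_⟩
    rintro t ⟨⟨htI, ht⟩, -⟩
    have hd : AEStronglyMeasurable (fun x => v (x, t) - v (x, t₀)) (volume.restrict K) :=
      (h.1 t htI).1.sub (h.1 t₀ ht₀).1
    calc _ = eLpNorm ((fun x => v (x, t) - v (x, t₀)) + fun x => v (x, t₀)) p
          (volume.restrict K) := by
          congr 1
          ext x
          simp
      _ ≤ _ := eLpNorm_add_le hd (h.1 t₀ ht₀).1 hp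
      _ ≤ _ := by gcongr

theorem HasContRep.exists_bound {p : ℝ} (hp : 1 ≤ p)
    (h : HasContRep (ENNReal.ofReal p) Ω T g) :
    ∃ M, ∀ᵐ t ∂(volume.restrict (Ioo (0 : ℝ) T)),
      MemLp (fun x => g (x, t)) (ENNReal.ofReal p) (volume.restrict Ω) ∧
      ∫ x in Ω, ‖g (x, t)‖ ^ p ≤ M := by
  obtain ⟨v, hvg, hv⟩ := h
  have hp0 : 0 < p := by linarith
  obtain ⟨M, hM, hb⟩ := hv.exists_bound
    (by rw [← ENNReal.ofReal_one]; exact ENNReal.ofReal_le_ofReal hp) isCompact_Icc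
  refine ⟨M.toReal ^ p, ?_⟩
  filter_upwards [ae_slice_of_ae_eq_cyl hvg, ae_restrict_mem measurableSet_Ioo] with t ht htT
  have htI := Ioo_subset_Icc_self htT
  have hmem := (hv.1 t htI).ae_eq ht
  refine ⟨hmem, ?_⟩
  have h1 := hb t htI
  rw [eLpNorm_congr_ae ht, hmem.eLpNorm_eq_integral_rpow_norm (by simpa using hp0)
    ENNReal.ofReal_ne_top, ENNReal.toReal_ofReal hp0.le, ENNReal.ofReal_le_iff_le_toReal hM] at h1
  have h0 : 0 ≤ ∫ x in Ω, ‖g (x, t)‖ ^ p :=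
    integral_nonneg fun x => Real.rpow_nonneg (norm_nonneg _) _
  calc _ = ((∫ x in Ω, ‖g (x, t)‖ ^ p) ^ p⁻¹) ^ p := (Real.rpow_inv_rpow h0 hp0.ne').symm
    _ ≤ _ := Real.rpow_le_rpow (Real.rpow_nonneg h0 _) h1 hp0.le

theorem memLp_cyl_of_ae_slice {p M : ℝ} (hp : 0 < p)
    (hg : AEStronglyMeasurable g (volume.restrict (cyl Ω T)))
    (h : ∀ᵐ t ∂(volume.restrict (Ioo (0 : ℝ) T)),
      MemLp (fun x => g (x, t)) (ENNReal.ofReal p) (volume.restrict Ω) ∧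
      ∫ x in Ω, ‖g (x, t)‖ ^ p ≤ M) :
    MemLp g (ENNReal.ofReal p) (volume.restrict (cyl Ω T)) := by
  rw [memLp_ofReal_iff hp hg]
  have hm : AEStronglyMeasurable (fun z => ‖g z‖ ^ p) (volume.restrict (cyl Ω T)) :=
    (hg.norm.aemeasurable.pow_const _).aestronglyMeasurable
  rw [cyl, Measure.volume_eq_prod, ← Measure.prod_restrict] at hm ⊢
  rw [integrable_prod_iff' hm]
  refine ⟨?_, Integrable.mono' (integrable_const M) hm.norm.prod_swap.integral_prod_right' ?_⟩
  · filter_upwards [h] with t ht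
    exact (memLp_ofReal_iff hp ht.1.1).1 ht.1
  · filter_upwards [h] with t ht
    have e : ∀ x, ‖‖g (x, t)‖ ^ p‖ = ‖g (x, t)‖ ^ p := fun x =>
      Real.norm_of_nonneg (Real.rpow_nonneg (norm_nonneg _) _)
    simp_rw [e]
    rw [Real.norm_of_nonneg (integral_nonneg fun x => Real.rpow_nonneg (norm_nonneg _) _)]
    exact ht.2

theorem abs_intervalIntegral_mono {f f' : ℝ → ℝ} {s t : ℝ} (hf0 : ∀ r, 0 ≤ f r)
    (hff' : ∀ r, f r ≤ f' r) (hf : IntegrableOn f (uIoc s t)) (hf' : IntegrableOn f' (uIoc s t)) :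
    |∫ r in s..t, f r| ≤ |∫ r in s..t, f' r| := by
  have h0 : 0 ≤ ∫ r in uIoc s t, f r := integral_nonneg hf0
  have h0' : 0 ≤ ∫ r in uIoc s t, f' r := integral_nonneg fun r => (hf0 r).trans (hff' r)
  rw [intervalIntegral.abs_integral_eq_abs_integral_uIoc,
    intervalIntegral.abs_integral_eq_abs_integral_uIoc, abs_of_nonneg h0, abs_of_nonneg h0']
  exact integral_mono hf hf' hff'

/-- All bounds hold on the whole of Ω_T, so the energy argument runs on the full interval and
reaches the times 0 and T. The integrand `a` consists of the flux energy and the power (m+1)/m of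
the time derivative of g^m; `b` is the energy of u^m - g^m. -/
theorem IsGlobalWeakSolution.exists_cauchy (hm : 0 < m) (hΩ : IsOpen Ω) (hfin : volume Ω < ⊤)
    (hT : 0 < T) (hA : IsAdmissible Ω T ν L μ A) (hu : IsGlobalWeakSolution m Ω T A g u)
    (hgt : HasWeakTimeDerivLp (ENNReal.ofReal ((m + 1) / m)) Ω T fun z => spow m (g z)) :
    ∃ S ⊆ Ioo 0 T, (∀ᵐ t, t ∈ Ioo 0 T → t ∈ S) ∧
      (∀ t ∈ S, MemLp (fun x => u (x, t)) (ENNReal.ofReal (m + 1)) (volume.restrict Ω)) ∧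
      ∀ t₀ ∈ Icc 0 T, ∀ ε > 0, ∃ δ > 0, ∀ t ∈ S, ∀ t' ∈ S, |t - t₀| < δ → |t' - t₀| < δ →
        ∫ x in Ω, ‖u (x, t) - u (x, t')‖ ^ (m + 1) ≤ ε := by
  have hp1 := one_le_ofReal_add_one hm
  have hp0 : 0 < m + 1 := by linarith
  have hΩfin : IsFiniteMeasure (volume.restrict Ω) := ⟨by simpa using hfin⟩
  have hcylfin : IsFiniteMeasure (volume.restrict (cyl Ω T)) := by
    rw [cyl, Measure.volume_eq_prod, ← Measure.prod_restrict]
    infer_instance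
  have huLoc := hu.weakSolution.memLpLoc
  obtain ⟨hmeas, -, G, ⟨-, hGloc, hgrad⟩, hweak⟩ := hu.weakSolution
  obtain ⟨hgmeas, hgcont, hγ2, Gγ, hGγ, hgradγ⟩ := hu.datum
  obtain ⟨γ', hγ', hγweak⟩ := hgt
  have hucyl : MemLp u (ENNReal.ofReal (m + 1)) (volume.restrict (cyl Ω T)) := by
    rcases lt_or_ge m 1 with h | h
    · exact hu.memLp h
    · exact memLp_of_memLp_spow h hmeas hu.memL2W12.1
  obtain ⟨M, hM⟩ := hgcont.exists_bound (by linarith)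
  have hgcyl := memLp_cyl_of_ae_slice hp0 hgmeas hM
  have hG := hu.memL2W12.memLp_grad hΩ hGloc hgrad
  set F : Vec n × ℝ → Mat N n := fun z => A z (u z) (G z) with hFdef
  have hF : MemLp F 2 (volume.restrict (cyl Ω T)) := hA.memLp_flux subset_rfl hmeas hG
  have hFloc : MemLpLoc 2 (cyl Ω T) F := fun Q _ hQc =>
    hF.mono_measure (Measure.restrict_mono hQc le_rfl)
  obtain ⟨S₀, -, hS₀, hS₀eq⟩ := exists_good_times_of_weak hΩ hT
    (fun j => huLoc.locInt hp1 j) (fun p => hFloc.locInt (by norm_num) p) hweak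
  have hq1 : (1 : ℝ≥0∞) ≤ ENNReal.ofReal ((m + 1) / m) := by
    rw [← ENNReal.ofReal_one]
    refine ENNReal.ofReal_le_ofReal ?_
    rw [le_div_iff₀ hm]
    linarith
  have hγi' := hγ'.integrable hq1
  obtain ⟨S₁, -, hS₁, hS₁eq⟩ := exists_times_sub_eq_integral hΩ hT
    (hγ2.integrable (by norm_num)) hγi' hγweak
  set a₁ : ℝ → ℝ := fun τ => ∫ x in Ω, ‖F (x, τ)‖ ^ 2 with ha₁
  set a₂ : ℝ → ℝ := fun τ => ∫ x in Ω, ‖γ' (x, τ)‖ ^ ((m + 1) / m) with ha₂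
  have ha₁0 : ∀ t, 0 ≤ a₁ t := fun t => integral_nonneg fun x => sq_nonneg _
  have ha₂0 : ∀ t, 0 ≤ a₂ t := fun t => integral_nonneg fun x =>
    Real.rpow_nonneg (norm_nonneg _) _
  have ha₁i : IntegrableOn a₁ (Ioo 0 T) := integrable_slice_norm_sq hF
  have ha₂i : IntegrableOn a₂ (Ioo 0 T) := MemLp.integrable_slice_norm (by positivity) hγ'
  have ha₁i' : IntegrableOn (fun τ => N * a₁ τ) (Ioo 0 T) := ha₁i.const_mul _
  have hai : IntegrableOn (fun τ => N * a₁ τ + a₂ τ) (Ioo 0 T) := ha₁i'.add ha₂i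
  set b₀ : ℝ → ℝ := fun t => ∫ x in Ω, ‖G (x, t) - Gγ (x, t)‖ ^ 2 with hb₀
  have hb₀0 : ∀ t, 0 ≤ b₀ t := fun t => integral_nonneg fun x => sq_nonneg _
  have hb₀i : IntegrableOn b₀ (Ioo 0 T) := integrable_slice_norm_sq (hG.sub hGγ)
  have hEi : IntegrableOn (fun t => ∫ x in Ω, ‖u (x, t)‖ ^ (m + 1)) (Ioo 0 T) :=
    MemLp.integrable_slice_norm hp0 hucyl
  have hBi : IntegrableOn (fun t => ∫ x in Ω, bdryTerm m (u (x, t)) (g (x, t))) (Ioo 0 T) := by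
    have h := integrable_bdryTerm hm hucyl hgcyl
    rw [cyl, Measure.volume_eq_prod, ← Measure.prod_restrict] at h
    exact h.integral_prod_right
  set S : Set ℝ := {t | t ∈ Ioo 0 T ∧ t ∈ S₀ ∧ t ∈ S₁ ∧
    MemLp (fun x => u (x, t)) (ENNReal.ofReal (m + 1)) (volume.restrict Ω) ∧
    (MemLp (fun x => g (x, t)) (ENNReal.ofReal (m + 1)) (volume.restrict Ω) ∧
      ∫ x in Ω, ‖g (x, t)‖ ^ (m + 1) ≤ M) ∧
    IsWeakGrad Ω (fun x => spow m (u (x, t))) (fun x => G (x, t)) ∧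
    IsWeakGrad Ω (fun x => spow m (g (x, t))) (fun x => Gγ (x, t)) ∧
    MemW120 Ω fun x => spow m (u (x, t)) - spow m (g (x, t))} with hSdef
  have hSfull : ∀ᵐ t, t ∈ Ioo 0 T → t ∈ S := by
    have h1 := (ae_restrict_iff' measurableSet_Ioo).1 (MemLp.ae_slice hp0 hucyl)
    have h2 := (ae_restrict_iff' measurableSet_Ioo).1 hM
    have h3 := (ae_restrict_iff' measurableSet_Ioo).1 hgrad
    have h4 := (ae_restrict_iff' measurableSet_Ioo).1 hgradγ
    have h5 := (ae_restrict_iff' measurableSet_Ioo).1 hu.lateral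
    filter_upwards [hS₀, hS₁, h1, h2, h3, h4, h5] with t g0 g1 g2 g3 g4 g5 g6 ht
    exact ⟨ht, g0 ht, g1 ht, g2 ht, g3 ht, g4 ht, g5 ht, g6 ht⟩
  have hsubI : ∀ {s t : ℝ}, s ∈ Ioo 0 T → t ∈ Ioo 0 T → uIoc s t ⊆ Ioo 0 T := fun hs ht =>
    uIoc_subset_uIcc.trans (ordConnected_Ioo.uIcc_subset hs ht)
  obtain ⟨S', hS'S, hS', hcau⟩ := exists_cauchy_of_energy (κ := volume.restrict Ω) hm hT
    (u := fun t x => u (x, t)) (g := fun t x => g (x, t)) (S := S)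
    (a := fun τ => N * a₁ τ + a₂ τ) (b := fun t => N * b₀ t)
    (M := M) hSfull (fun t ht => ht.2.2.2.1) (fun t ht => ht.2.2.2.2.1.1)
    (fun t => add_nonneg (mul_nonneg (Nat.cast_nonneg _) (ha₁0 t)) (ha₂0 t))
    (fun t => mul_nonneg (Nat.cast_nonneg _) (hb₀0 t)) hai (hb₀i.const_mul _) hEi hBi
    (fun t ht => ht.2.2.2.2.1.2)
    (by
      rintro s ⟨hsT, hs0, -, hsu, ⟨hsg, -⟩, hsG, hsγ, hsW⟩ t ⟨htT, ht0, -, htu, -⟩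
      -- The zero boundary values at time s allow u(s)^m - g(s)^m to be approximated by test
      -- functions in Ω, with energies tending to that of the difference of the two gradients.
      obtain ⟨φ, R, hφ, hφlim, hφR, hR⟩ := hsW.exists_test hΩ hfin (hsG.sub hsγ)
      have hintg : ∀ j, IntegrableOn (fun x => (spow m (u (x, s)) j - spow m (g (x, s)) j) *
          (u (x, s) j - u (x, t) j)) Ω := by
        intro j
        refine ((integrable_spow_apply_mul hm hsu (hsu.sub htu) j).sub
          (integrable_spow_apply_mul hm hsg (hsu.sub htu) j)).congr
          (Eventually.of_forall fun x => ?_)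
        simp [sub_mul]
      have hj : ∀ j, |∫ x in Ω, (spow m (u (x, s)) j - spow m (g (x, s)) j) *
          (u (x, s) j - u (x, t) j)| ≤ |∫ τ in s..t, a₁ τ| + |t - s| * b₀ s := by
        intro j
        refine abs_pairing_le (φs := fun k x => φ k x j) (Rs := R) subset_rfl
          hΩ.measurableSet hF hsT htT j
          (fun ψ hψ => hS₀eq j ψ hψ s hs0 t ht0)
          ((memLp_apply hsu j).integrable hp1) ((memLp_apply htu j).integrable hp1)
          (hintg j) (fun k => (hφ k).apply j) ?_ (fun k => le_trans ?_ (hφR k)) hR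
        · filter_upwards [hφlim] with x hx
          exact ((EuclideanSpace.proj j : Vec N →L[ℝ] ℝ).continuous.tendsto _).comp hx
        · refine setIntegral_mono ((hφ k).apply j).integrable_gradSq.integrableOn ?_
            fun x => (hφ k).gradSq_apply_le j x
          exact integrable_norm_sq (((hφ k).continuous_grad.memLp_of_hasCompactSupport
            (hφ k).hasCompactSupport_grad).restrict _)
      have e : ∫ x in Ω, inner ℝ (spow m (u (x, s)) - spow m (g (x, s)))
          (u (x, s) - u (x, t)) = ∑ j, ∫ x in Ω, (spow m (u (x, s)) j - spow m (g (x, s)) j) *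
          (u (x, s) j - u (x, t) j) := by
        rw [← integral_finsetSum _ fun j _ => hintg j]
        refine integral_congr_ae (Eventually.of_forall fun x => ?_)
        simp only [real_inner_eq_sum, PiLp.sub_apply]
      have ha : |∫ τ in s..t, N * a₁ τ| ≤ |∫ τ in s..t, (N * a₁ τ + a₂ τ)| :=
        abs_intervalIntegral_mono (fun r => mul_nonneg (Nat.cast_nonneg _) (ha₁0 r))
          (fun r => le_add_of_nonneg_right (ha₂0 r)) (ha₁i'.mono_set (hsubI hsT htT))
          (hai.mono_set (hsubI hsT htT))
      rw [e]
      calc _ ≤ ∑ j, |∫ x in Ω, (spow m (u (x, s)) j - spow m (g (x, s)) j) *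
          (u (x, s) j - u (x, t) j)| := Finset.abs_sum_le_sum_abs _ _
        _ ≤ ∑ _j : Fin N, (|∫ τ in s..t, a₁ τ| + |t - s| * b₀ s) :=
            Finset.sum_le_sum fun j _ => hj j
        _ = |∫ τ in s..t, N * a₁ τ| + |t - s| * (N * b₀ s) := by
            rw [intervalIntegral.integral_const_mul, abs_mul, Nat.abs_cast, Finset.sum_const,
              Finset.card_univ, Fintype.card_fin, nsmul_eq_mul]
            ring
        _ ≤ _ := by linarith)
    (by
      rintro s ⟨hsT, -, hs1, -⟩ t ⟨htT, -, ht1, -⟩ f hf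
      refine (abs_integral_inner_time_difference_le (w := fun z => spow m (g z)) hm hγi' hγ' hsT htT
        (hS₁eq s hs1 t ht1) hf).trans ?_
      have ha : |∫ τ in s..t, a₂ τ| ≤ |∫ τ in s..t, (N * a₁ τ + a₂ τ)| :=
        abs_intervalIntegral_mono ha₂0
          (fun r => le_add_of_nonneg_left (mul_nonneg (Nat.cast_nonneg _) (ha₁0 r)))
          (ha₂i.mono_set (hsubI hsT htT)) (hai.mono_set (hsubI hsT htT))
      linarith)
  exact ⟨S', fun t ht => (hS'S ht).2, hS', fun t ht => (hS'S ht).1.2.2.2.1, hcau⟩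

/-- Solutions of the Cauchy–Dirichlet problem are continuous in time up to the endpoints. -/
theorem IsGlobalWeakSolution.hasContRep (hm : 0 < m) (hΩ : IsOpen Ω) (hfin : volume Ω < ⊤)
    (hT : 0 < T) (hA : IsAdmissible Ω T ν L μ A) (hu : IsGlobalWeakSolution m Ω T A g u)
    (hgt : HasWeakTimeDerivLp (ENNReal.ofReal ((m + 1) / m)) Ω T fun z => spow m (g z)) :
    HasContRep (ENNReal.ofReal (m + 1)) Ω T u := by
  obtain ⟨S, -, hS, hmem, hcau⟩ := hu.exists_cauchy hm hΩ hfin hT hA hgt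
  obtain ⟨v, hvu, hv⟩ := exists_contInLp_extension (one_le_ofReal_add_one hm)
    (K := fun _ => Ω) monotone_const (fun _ => hΩ.measurableSet)
    (Icc_subset_closure_of_ae hT hS) (fun _ => hmem) fun _ t₀ ht₀ ε hε => by
      obtain ⟨ε', hε', he⟩ := exists_eLpNorm_le_of_integral_le (N := N)
        (by linarith : 0 < m + 1) hε
      obtain ⟨δ, hδ, h⟩ := hcau t₀ ht₀ ε' hε'
      exact ⟨δ, hδ, fun t ht t' ht' h1 h2 =>
        he ((hmem t ht).sub (hmem t' ht')) (h t ht t' ht' h1 h2)⟩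
  exact ⟨v, ae_eq_cyl_of_slices hS hΩ.measurableSet hvu, hv 0⟩

end Global

end PorousMedium

theorem mainTheorem3 (n N : ℕ) (hn : 2 ≤ n) (m : ℝ) (hm : 0 < m)
    (Ω : Set (PorousMedium.Vec n)) (hΩ : IsOpen Ω) (hΩb : Bornology.IsBounded Ω)
    (T : ℝ) (hT : 0 < T) (ν L μ : ℝ) (hν : 0 < ν) (hνL : ν ≤ L) (hμ : 0 < μ)
    (A : PorousMedium.Vec n × ℝ → PorousMedium.Vec N → PorousMedium.Mat N n →
      PorousMedium.Mat N n)
    (hA : PorousMedium.IsAdmissible Ω T ν L μ A) :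
    (∀ u : PorousMedium.Vec n × ℝ → PorousMedium.Vec N,
      PorousMedium.IsWeakSolution m Ω T A u →
        PorousMedium.HasContRepLoc (ENNReal.ofReal (m + 1)) Ω T u) ∧
    (∀ g u : PorousMedium.Vec n × ℝ → PorousMedium.Vec N,
      PorousMedium.IsGlobalWeakSolution m Ω T A g u →
      PorousMedium.HasWeakTimeDerivLp (ENNReal.ofReal ((m + 1) / m)) Ω T
        (fun z => PorousMedium.spow m (g z)) →
        PorousMedium.HasContRep (ENNReal.ofReal (m + 1)) Ω T u) :=
  ⟨fun _ hu => hu.hasContRepLoc hm hΩ hT hA,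
    fun _ _ hu hg => hu.hasContRep hm hΩ hΩb.measure_lt_top hT hA hg⟩
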